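/- Let $p$ be a prime, $R$ an $\mathbb F_p$-algebra, and $n,l\ge 1$ integers. Let $W_n(R)$ be the ring of $p$-typical Witt vectors of length $n$ (with $W_0(R)=0$), with Frobenius $F$ and Verschiebung $V$, and put $I_{n,R}=\operatorname{Ker}(W_n(R)\to R)$, $J_{n,R}=\operatorname{Ker}(W_n(R)\to W_{n-1}(R))$. A *weak $n$-truncated semidisplay* over $R$ is a quadruple $\mathscr P=(M,Q,F,F_1)$, where $M$ is a $W_n(R)$-module, $Q\subset M$ is a submodule, and $F:M\to M$, $F_1:Q\to M/J_{n,R}M$ are additive maps that are semilinear with respect to $F:W_n(R)\to W_n(R)$, such that (i) $(M,Q)\cong (T,I_{n,R}T)\oplus(L,L)$ for some finitely generated projective $W_n(R)$-module $T$ and some finitely generated projective $W_{n-1}(R)$-module $L$; (ii) $F_1(V(a)x)=a\bar F(x)$ for $a\in W_n(R)$, $x\in M$, where $\bar F(x)$ is the class of $F(x)$ in $M/J_{n,R}M$; (iii) $F(y)=p F_1(y)$ for $y\in Q$ (this makes sense because $pJ_{n,R}=0$). The tensor product of $\mathscr P_i=(M_i,Q_i,F,F_1)$, $1\le i\le l$,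 is the weak $n$-truncated semidisplay $\mathscr P_1\otimes\cdots\otimes\mathscr P_l=(M,Q,F,F_1)$ with $M=M_1\otimes_{W_n(R)}\cdots\otimes_{W_n(R)}M_l$, $Q=\operatorname{Ker}\bigl(M\to (M_1/Q_1)\otimes\cdots\otimes(M_l/Q_l)\bigr)$, $F=F\otimes\cdots\otimes F$, and $F_1$ the unique additive map such that $F_1(x_1\otimes\cdots\otimes x_l)=F(x_1)\otimes\cdots\otimes F_1(x_j)\otimes\cdots\otimes F(x_l)$ in $M/J_{n,R}M$ whenever $x_j\in Q_j$. For an $R$-algebra $R'$ let $\mathfrak Z^*_{\mathscr P}(R')$ be the additive group of $W_n(R)$-linear maps $\eta:M\to W_n(R')$ such that $\eta(F(x))=F(\eta(x))$ for $x\in M$ and $\eta(y)=V(\eta(F_1(y)))$ for $y\in Q$ (the right-hand side is well defined because $V$ kills $J_{n,R'}$). This is a commutative group scheme over $R$; let $\mathfrak Z_{\mathscr P}$ be its Cartier dual, i.e. $\mathfrak Z_{\mathscr P}(R')$ is the group of homomorphisms $\mathfrak Z^*_{\mathscr P}\otimes_RR'\to\mathbb G_{m,R'}$. For commutative group schemes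 $G_1,\dots,G_l$ over $R$, let $\underline{\operatorname{Poly-add}}(G_1\times\cdots\times G_l,\mathbb G_m)$ be the group functor on $R$-algebras whose $R'$-points are the morphisms $(G_1\times\cdots\times G_l)\otimes_RR'\to\mathbb G_{m,R'}$ that are additive in each variable (the group operation is multiplication of values), and let the superscript $(F^n)$ denote the kernel of $F^n$, i.e. the subgroup of those $R'$-points that become trivial after base change along the $p^n$-power map $R'\to R'$. The poly-additive map $\mathfrak Z^*_{\mathscr P_1}\times\cdots\times\mathfrak Z^*_{\mathscr P_l}\to\mathfrak Z^*_{\mathscr P_1\otimes\cdots\otimes\mathscr P_l}$ that takes $(\eta_1,\dots,\eta_l)$ to the map $x_1\otimes\cdots\otimes x_l\mapsto\prod_i\eta_i(x_i)$ induces, by composition, a homomorphism $$\mathfrak Z_{\mathscr P_1\otimes\cdots\otimes\mathscr P_l}\to\underline{\operatorname{Poly-add}}(\mathfrak Z^*_{\mathscr P_1}\times\cdots\times\mathfrak Z^*_{\mathscr P_l},\mathbb G_m)^{(F^n)} .$$ **Proposition.** For any weak $n$-truncated semidisplays $\mathscr P_1,\dots,\mathscr P_l$ over $R$, this homomorphism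 is well defined (composition with the tensor product map takes values in the kernel of $F^n$) and is an isomorphism: for every $R$-algebra $R'$ it is bijective on $R'$-points, compatibly with base change in $R'$. -/

import Mathlib

universe u

set_option linter.unusedSectionVars false

/-! ## Truncated Witt vectors in characteristic `p` -/

namespace TWitt

theorem natCast_eq_zero_of_hom {p : ℕ} {R S : Type u} [CommRing R] [CommRing S] (f : R →+* S)
    (hp : (p : R) = 0) : (p : S) = 0 := by
  have := congrArg f hp
  simpa using this

variable {p : ℕ} [Fact p.Prime] {R S : Type u} [CommRing R] [CommRing S]

theorem charP_of_nontrivial [Nontrivial R] (hp : (p : R) = 0) : CharP R p :=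
  (CharP.charP_iff_prime_eq_zero (Fact.out : p.Prime)).mpr hp

/-- The Frobenius endomorphism `x ↦ x ^ p` of a ring in which `p = 0`. -/
def frob (hp : (p : R) = 0) : R →+* R where
  toFun x := x ^ p
  map_one' := one_pow p
  map_mul' x y := mul_pow x y p
  map_zero' := zero_pow (Fact.out : p.Prime).ne_zero
  map_add' x y := by
    rcases subsingleton_or_nontrivial R with h | h
    · exact Subsingleton.elim _ _
    · have := charP_of_nontrivial hp
      exact add_pow_char x y p

theorem frob_apply (hp : (p : R) = 0) (x : R) : frob hp x = x ^ p := rfl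

variable (n : ℕ)

/-- The ring homomorphism `W_n(R) → W_n(S)` induced by `f : R → S` (apply `f` to the components). -/
noncomputable def map (f : R →+* S) : TruncatedWittVector p n R →+* TruncatedWittVector p n S :=
  RingHom.liftOfSurjective (WittVector.truncate n) (WittVector.truncate_surjective p n R)
    ⟨(WittVector.truncate n).comp (WittVector.map f), by
      intro x hx
      rw [RingHom.mem_ker, RingHom.comp_apply]
      ext i
      have := (WittVector.mem_ker_truncate n x).1 hx i i.2
      simp [this]⟩

theorem map_truncate (f : R →+* S) (x : WittVector p R) :
    map n f (WittVector.truncate n x) = WittVector.truncate n (WittVector.map f x) := by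
  exact RingHom.liftOfRightInverse_comp_apply _ _ _ _ x

theorem coeff_map (f : R →+* S) (x : TruncatedWittVector p n R) (i : Fin n) :
    (map n f x).coeff i = f (x.coeff i) := by
  obtain ⟨x, rfl⟩ := WittVector.truncate_surjective p n R x
  simp [map_truncate]

/-- The Frobenius `F` of `W_n(R)`, where `p = 0` in `R`. -/
noncomputable def frobenius (hp : (p : R) = 0) :
    TruncatedWittVector p n R →+* TruncatedWittVector p n R := map n (frob hp)

/-- The Verschiebung `V : W_n(R) → W_n(R)`, `(x₀, …, x_{n-1}) ↦ (0, x₀, …, x_{n-2})`. -/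
noncomputable def ver : TruncatedWittVector p n R →+ TruncatedWittVector p n R where
  toFun x := WittVector.truncate n (WittVector.verschiebung x.out)
  map_zero' := by
    ext ⟨i, hi⟩
    cases i with
    | zero => simp
    | succ i => 
      have := TruncatedWittVector.coeff_out (p := p) (0 : TruncatedWittVector p n R) ⟨i, by omega⟩
      simp at this
      simp [this]
  map_add' x y := by
    rw [← map_add, ← map_add]
    ext ⟨i, hi⟩
    cases i with
    | zero => simp only [WittVector.coeff_truncate, WittVector.verschiebung_coeff_zero]
    | succ i =>
      simp only [WittVector.coeff_truncate, WittVector.verschiebung_coeff_add_one]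
      have h1 := TruncatedWittVector.coeff_out (p := p) (x + y) ⟨i, by omega⟩
      have h2 := WittVector.coeff_truncate (n := n) (x.out + y.out) ⟨i, by omega⟩
      rw [map_add] at h2
      have e (z : TruncatedWittVector p n R) : WittVector.truncate n z.out = z :=
        TruncatedWittVector.truncateFun_out z
      rw [e, e] at h2
      exact h1.trans h2

theorem ver_truncate (x : WittVector p R) :
    ver n (WittVector.truncate n x) = WittVector.truncate n (WittVector.verschiebung x) := by
  ext ⟨i, hi⟩
  cases i with
  | zero => simp [ver]
  | succ i =>
    have h1 := TruncatedWittVector.coeff_out (WittVector.truncate n x) ⟨i, by omega⟩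
    simpa [ver] using h1

theorem frobenius_truncate (hp : (p : R) = 0) (x : WittVector p R) :
    frobenius n hp (WittVector.truncate n x) = WittVector.truncate n (WittVector.frobenius x) := by
  ext i
  rcases subsingleton_or_nontrivial R with h | h
  · exact Subsingleton.elim _ _
  · have := charP_of_nontrivial hp
    simp [frobenius, coeff_map, frob_apply, WittVector.coeff_frobenius_charP]

theorem ver_mul (hp : (p : R) = 0) (a b : TruncatedWittVector p n R) :
    ver n a * b = ver n (a * frobenius n hp b) := by
  obtain ⟨a, rfl⟩ := WittVector.truncate_surjective p n R a
  obtain ⟨b, rfl⟩ := WittVector.truncate_surjective p n R b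
  rw [frobenius_truncate, ← map_mul, ver_truncate, ver_truncate, ← map_mul,
    WittVector.verschiebung_mul_frobenius]

theorem ver_one (hp : (p : R) = 0) : ver n (1 : TruncatedWittVector p n R) = p := by
  rcases subsingleton_or_nontrivial R with h | h
  · ext i
    exact Subsingleton.elim _ _
  · have := charP_of_nontrivial hp
    rw [← map_one (WittVector.truncate n), ver_truncate,
      ← map_one (WittVector.frobenius (p := p) (R := R)), WittVector.verschiebung_frobenius, one_mul,
      map_natCast]

theorem map_ver (f : R →+* S) (a : TruncatedWittVector p n R) :
    map n f (ver n a) = ver n (map n f a) := by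
  obtain ⟨a, rfl⟩ := WittVector.truncate_surjective p n R a
  rw [map_truncate, ver_truncate, ver_truncate, map_truncate, WittVector.map_verschiebung]

theorem map_frobenius (f : R →+* S) (hp : (p : R) = 0) (hp' : (p : S) = 0)
    (a : TruncatedWittVector p n R) :
    map n f (frobenius n hp a) = frobenius n hp' (map n f a) := by
  ext i
  simp [frobenius, coeff_map, frob_apply]

variable (p R)

/-- `J_{n,R} = Ker (W_n(R) → W_{n-1}(R))`. -/
noncomputable def J : Ideal (TruncatedWittVector p n R) :=
  RingHom.ker (TruncatedWittVector.truncate (p := p) (R := R) (Nat.sub_le n 1))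

/-- `I_{n,R} = Ker (W_n(R) → W_1(R))`. -/
noncomputable def I [NeZero n] : Ideal (TruncatedWittVector p n R) :=
  RingHom.ker (TruncatedWittVector.truncate (p := p) (R := R) (NeZero.one_le : 1 ≤ n))

variable {p R}

theorem mem_J {a : TruncatedWittVector p n R} :
    a ∈ J p R n ↔ ∀ i : Fin n, (i : ℕ) + 1 < n → a.coeff i = 0 := by
  rw [J, RingHom.mem_ker, TruncatedWittVector.ext_iff]
  constructor
  · intro h i hi
    have := h ⟨i, by omega⟩
    simpa [TruncatedWittVector.coeff_truncate] using this
  · intro h i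
    rw [TruncatedWittVector.coeff_truncate]
    simpa using h _ (by have := i.2; simp; omega)

theorem coeff_ver_zero (a : TruncatedWittVector p n R) (h : 0 < n) :
    (ver n a).coeff ⟨0, h⟩ = 0 := by
  simp [ver]

theorem coeff_ver_succ (a : TruncatedWittVector p n R) (i : ℕ) (h : i + 1 < n) :
    (ver n a).coeff ⟨i + 1, h⟩ = a.coeff ⟨i, by omega⟩ := by
  have h1 := TruncatedWittVector.coeff_out a ⟨i, by omega⟩
  simpa [ver] using h1

theorem ver_eq_zero_iff {a : TruncatedWittVector p n R} : ver n a = 0 ↔ a ∈ J p R n := by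
  rw [mem_J, TruncatedWittVector.ext_iff]
  constructor
  · intro h i hi
    have := h ⟨i + 1, hi⟩
    rw [coeff_ver_succ] at this
    simpa using this
  · rintro h ⟨i, hi⟩
    cases i with
    | zero => simp [coeff_ver_zero]
    | succ i => 
      rw [coeff_ver_succ, h _ (by simpa using hi)]
      simp

theorem mem_I [NeZero n] {a : TruncatedWittVector p n R} : a ∈ I p R n ↔ ∃ b, ver n b = a := by
  have hn : 0 < n := NeZero.pos n
  rw [I, RingHom.mem_ker, TruncatedWittVector.ext_iff]
  constructor
  · intro h
    refine ⟨TruncatedWittVector.mk p fun i =>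
      if hi : (i : ℕ) + 1 < n then a.coeff ⟨i + 1, hi⟩ else 0, ?_⟩
    ext ⟨i, hi⟩
    cases i with
    | zero =>
      have := h 0
      rw [TruncatedWittVector.coeff_truncate] at this
      rw [coeff_ver_zero]
      exact (this.trans (by simp)).symm
    | succ i => simp [coeff_ver_succ, hi]
  · rintro ⟨b, rfl⟩ i
    rw [TruncatedWittVector.coeff_truncate]
    obtain rfl : i = 0 := Subsingleton.elim _ _
    exact (coeff_ver_zero n b hn).trans (by simp)

theorem map_mem_J (f : R →+* S) {a : TruncatedWittVector p n R} (ha : a ∈ J p R n) :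
    map n f a ∈ J p S n := by
  rw [mem_J] at ha ⊢
  intro i hi
  rw [coeff_map, ha i hi, map_zero]

theorem p_mul_J (hp : (p : R) = 0) {a : TruncatedWittVector p n R} (ha : a ∈ J p R n) :
    (p : TruncatedWittVector p n R) * a = 0 := by
  rw [← ver_one n hp, ver_mul n hp, one_mul, ver_eq_zero_iff]
  exact map_mem_J n _ ha

end TWitt

/-! ## Tensor products of finite families of modules -/

namespace PiSemi

open PiTensorProduct
open scoped TensorProduct

section lift

variable {A B : Type u} [CommRing A] [CommRing B] {σ : A →+* B} {ι : Type}
  {M : ι → Type u} [∀ i, AddCommGroup (M i)] [∀ i, Module A (M i)]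
  {N : ι → Type u} [∀ i, AddCommGroup (N i)] [∀ i, Module B (N i)]
  {K : Type u} [AddCommGroup K] [Module B K]

theorem lift_aux_update [DecidableEq ι] (g : ∀ i, M i →ₛₗ[σ] N i) (x : ∀ i, M i) (i : ι) (m : M i) :
    (fun j => g j (Function.update x i m j)) = Function.update (fun j => g j (x j)) i (g i m) := by
  ext j
  by_cases h : j = i
  · subst h; simp
  · simp [h]

/-- The additive map underlying `lift`. -/
noncomputable def liftAdd (μ : MultilinearMap B N K) (g : ∀ i, M i →ₛₗ[σ] N i) :
    (⨂[A] i, M i) →+ K :=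
  PiTensorProduct.liftAddHom (fun q => σ q.1 • μ fun i => g i (q.2 i))
    (fun r f i h => by
      rw [μ.map_coord_zero i (by simp [h]), smul_zero])
    (fun f => by simp)
    (fun {_} r f i m₁ m₂ => by
      simp only [lift_aux_update, map_add, μ.map_update_add, smul_add])
    (fun r r' f => by simp [add_smul])
    (fun {_} r f i r' => by
      simp only [lift_aux_update, map_smulₛₗ, μ.map_update_smul, smul_smul, map_mul]
      rw [mul_comm]
      congr 2
      rw [← lift_aux_update, Function.update_eq_self])

theorem liftAdd_smul_tprod (μ : MultilinearMap B N K) (g : ∀ i, M i →ₛₗ[σ] N i) (r : A)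
    (x : ∀ i, M i) : liftAdd μ g (r • tprod A x) = σ r • μ fun i => g i (x i) := by
  rw [← PiTensorProduct.tprodCoeff_eq_smul_tprod]
  rfl

/-- The semilinear map `⨂ Mᵢ → K`, `⊗ xᵢ ↦ μ (gᵢ (xᵢ))ᵢ`, where `μ` is multilinear and the `gᵢ`
are semilinear. -/
noncomputable def lift (μ : MultilinearMap B N K) (g : ∀ i, M i →ₛₗ[σ] N i) :
    (⨂[A] i, M i) →ₛₗ[σ] K where
  __ := liftAdd μ g
  map_smul' r z := by
    change liftAdd μ g (r • z) = σ r • liftAdd μ g z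
    induction z using PiTensorProduct.induction_on with
    | smul_tprod s x => rw [smul_smul, liftAdd_smul_tprod, liftAdd_smul_tprod, map_mul, smul_smul]
    | add y z hy hz => rw [smul_add, map_add, hy, hz, map_add, smul_add]

@[simp] theorem lift_tprod (μ : MultilinearMap B N K) (g : ∀ i, M i →ₛₗ[σ] N i) (x : ∀ i, M i) :
    lift μ g (tprod A x) = μ fun i => g i (x i) := by
  have := liftAdd_smul_tprod μ g 1 x
  rw [one_smul, map_one, one_smul] at this
  exact this

end lift

section quot

variable {A : Type u} [CommRing A] {ι : Type} [DecidableEq ι]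
  {M : ι → Type u} [∀ i, AddCommGroup (M i)] [∀ i, Module A (M i)]

theorem smul_top_tprod (J : Ideal A) (x : ∀ i, M i) (j : ι)
    (hx : x j ∈ J • (⊤ : Submodule A (M j))) : tprod A x ∈ J • (⊤ : Submodule A (⨂[A] i, M i)) := by
  have : ∀ m ∈ J • (⊤ : Submodule A (M j)),
      tprod A (Function.update x j m) ∈ J • (⊤ : Submodule A (⨂[A] i, M i)) := by
    intro m hm
    induction hm using Submodule.smul_induction_on' with
    | smul r hr n hn =>
      rw [MultilinearMap.map_update_smul]
      exact Submodule.smul_mem_smul hr trivial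
    | add x hx y hy h1 h2 =>
      rw [MultilinearMap.map_update_add]
      exact add_mem h1 h2
  simpa using this _ hx

variable [Fintype ι]

theorem tprod_sub_mem (N : ∀ i, Submodule A (M i)) (N' : Submodule A (⨂[A] i, M i))
    (h : ∀ (x : ∀ i, M i) (j : ι), x j ∈ N j → tprod A x ∈ N') (x y : ∀ i, M i)
    (hxy : ∀ i, x i - y i ∈ N i) : tprod A x - tprod A y ∈ N' := by
  have key : ∀ s : Finset ι, tprod A (s.piecewise x y) - tprod A y ∈ N' := by
    intro s
    induction s using Finset.induction_on with
    | empty => simp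
    | insert j s hj ih =>
      rw [Finset.piecewise_insert]
      have e : s.piecewise x y = Function.update (s.piecewise x y) j (y j) := by
        rw [Function.eq_update_self_iff]
        simp [hj]
      have : tprod A (Function.update (s.piecewise x y) j (x j)) - tprod A (s.piecewise x y) ∈ N' := by
        nth_rewrite 2 [e]
        rw [← MultilinearMap.map_update_sub]
        exact h _ j (by simpa using hxy j)
      simpa using add_mem this ih
  simpa using key Finset.univ

/-- The multilinear map `∏ Mᵢ/Nᵢ → (⨂ Mᵢ)/N'` induced by `tprod`. -/
noncomputable def quot (N : ∀ i, Submodule A (M i)) (N' : Submodule A (⨂[A] i, M i))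
    (h : ∀ (x : ∀ i, M i) (j : ι), x j ∈ N j → tprod A x ∈ N') :
    MultilinearMap A (fun i => M i ⧸ N i) ((⨂[A] i, M i) ⧸ N') := by
  have key : ∀ (y : ∀ i, M i ⧸ N i) (x : ∀ i, M i), (∀ i, (N i).mkQ (x i) = y i) →
      N'.mkQ (tprod A fun i => (y i).out) = N'.mkQ (tprod A x) := by
    intro y x hx
    rw [← sub_eq_zero, ← map_sub, Submodule.mkQ_apply, Submodule.Quotient.mk_eq_zero]
    refine tprod_sub_mem N N' h _ _ fun i => ?_
    rw [← Submodule.Quotient.mk_eq_zero, Submodule.Quotient.mk_sub, sub_eq_zero]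
    exact ((Submodule.Quotient.mk_out (y i)).trans (hx i).symm :)
  have upd : ∀ [inst : DecidableEq ι] (y : ∀ i, M i ⧸ N i) (j : ι) (m : M j),
      N'.mkQ (tprod A fun i => (Function.update y j ((N j).mkQ m) i).out) =
        N'.mkQ (tprod A (Function.update (fun i => (y i).out) j m)) := by
    intro inst y j m
    apply key
    intro i
    by_cases hi : i = j
    · subst hi; simp
    · simp [hi]
  refine
    { toFun := fun y => N'.mkQ (tprod A fun i => (y i).out)
      map_update_add' := ?_
      map_update_smul' := ?_ }
  · intro inst y j a b
    obtain ⟨a, rfl⟩ := (N j).mkQ_surjective a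
    obtain ⟨b, rfl⟩ := (N j).mkQ_surjective b
    rw [← map_add, upd, upd, upd, MultilinearMap.map_update_add, map_add]
  · intro inst y j c a
    obtain ⟨a, rfl⟩ := (N j).mkQ_surjective a
    rw [← map_smul, upd, upd, MultilinearMap.map_update_smul, map_smul]

theorem quot_mk (N : ∀ i, Submodule A (M i)) (N' : Submodule A (⨂[A] i, M i))
    (h : ∀ (x : ∀ i, M i) (j : ι), x j ∈ N j → tprod A x ∈ N') (x : ∀ i, M i) :
    quot N N' h (fun i => (N i).mkQ (x i)) = N'.mkQ (tprod A x) := by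
  change N'.mkQ (tprod A fun i => ((N i).mkQ (x i)).out) = _
  rw [← sub_eq_zero, ← map_sub, Submodule.mkQ_apply, Submodule.Quotient.mk_eq_zero]
  refine tprod_sub_mem N N' h _ _ fun i => ?_
  rw [← Submodule.Quotient.mk_eq_zero, Submodule.Quotient.mk_sub, sub_eq_zero]
  exact Submodule.Quotient.mk_out ((N i).mkQ (x i))

theorem ker_map_mkQ (N : ∀ i, Submodule A (M i)) :
    LinearMap.ker (PiTensorProduct.map fun i => (N i).mkQ) =
      Submodule.span A {z | ∃ (x : ∀ i, M i) (j : ι), x j ∈ N j ∧ z = tprod A x} := by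
  set N' := Submodule.span A {z | ∃ (x : ∀ i, M i) (j : ι), x j ∈ N j ∧ z = tprod A x} with hN'
  apply le_antisymm
  · intro z hz
    have h : ∀ (x : ∀ i, M i) (j : ι), x j ∈ N j → tprod A x ∈ N' :=
      fun x j hj => Submodule.subset_span ⟨x, j, hj, rfl⟩
    have e : PiTensorProduct.lift (quot N N' h) ∘ₗ (PiTensorProduct.map fun i => (N i).mkQ) =
        N'.mkQ := by
      ext x
      simp only [LinearMap.compMultilinearMap_apply, LinearMap.comp_apply,
        PiTensorProduct.map_tprod, PiTensorProduct.lift.tprod, quot_mk]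
    have := LinearMap.congr_fun e z
    rw [LinearMap.comp_apply, LinearMap.mem_ker.1 hz, map_zero, eq_comm, Submodule.mkQ_apply,
      Submodule.Quotient.mk_eq_zero] at this
    exact this
  · rw [hN', Submodule.span_le]
    rintro _ ⟨x, j, hj, rfl⟩
    rw [SetLike.mem_coe, LinearMap.mem_ker, PiTensorProduct.map_tprod]
    exact MultilinearMap.map_coord_zero _ j (by simpa using hj)

/-- The multilinear map `∏ Mᵢ/J Mᵢ → (⨂ Mᵢ)/J(⨂ Mᵢ)` induced by `tprod`. -/
noncomputable def quotSMul (J : Ideal A) :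
    MultilinearMap A (fun i => M i ⧸ (J • ⊤ : Submodule A (M i)))
      ((⨂[A] i, M i) ⧸ (J • ⊤ : Submodule A (⨂[A] i, M i))) :=
  quot _ _ (smul_top_tprod J)

theorem quotSMul_mk (J : Ideal A) (x : ∀ i, M i) :
    quotSMul J (fun i => (J • ⊤ : Submodule A (M i)).mkQ (x i)) =
      (J • ⊤ : Submodule A (⨂[A] i, M i)).mkQ (tprod A x) := quot_mk _ _ _ _

end quot

end PiSemi

/-! ## Weak truncated semidisplays -/

section Semidisplay

open TWitt
open scoped TensorProduct

variable {p : ℕ} [Fact p.Prime] {R : Type u} [CommRing R]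

/-- A pair `(M, Q)` of a `W_n(R)`-module and a submodule is *normal* if it is isomorphic to
`(T, I_{n,R} T) ⊕ (L, L)` for some finitely generated projective `W_n(R)`-module `T` and some
finitely generated projective `W_{n-1}(R)`-module `L`. -/
def IsNormalPair (n : ℕ) [NeZero n] {M : Type u} [AddCommGroup M]
    [Module (TruncatedWittVector p n R) M] (Q : Submodule (TruncatedWittVector p n R) M) : Prop :=
  ∃ (T L : Type u) (_ : AddCommGroup T) (_ : AddCommGroup L)
    (_ : Module (TruncatedWittVector p n R) T) (_ : Module (TruncatedWittVector p (n - 1) R) L)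
    (e : M ≃+ T × L),
    Module.Finite (TruncatedWittVector p n R) T ∧
    Module.Projective (TruncatedWittVector p n R) T ∧
    Module.Finite (TruncatedWittVector p (n - 1) R) L ∧
    Module.Projective (TruncatedWittVector p (n - 1) R) L ∧
    (∀ (a : TruncatedWittVector p n R) (x : M),
      e (a • x) = (a • (e x).1, TruncatedWittVector.truncate (Nat.sub_le n 1) a • (e x).2)) ∧
    ∀ x : M, x ∈ Q ↔ (e x).1 ∈ (I p R n • ⊤ : Submodule (TruncatedWittVector p n R) T)

/-- A weak `n`-truncated semidisplay `(M, Q, F, F₁)` over a ring `R` with `p = 0`. In the last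
relation `p • z`, for any `z` lifting `F₁ y ∈ M / J_{n,R} M`, is the element `p F₁(y)` of `M`
(note that `p J_{n,R} = 0`). -/
structure WeakSemidisplay (hp : (p : R) = 0) (n : ℕ) [NeZero n] where
  /-- the module `M` -/
  M : Type u
  [addCommGroup : AddCommGroup M]
  [module : Module (TruncatedWittVector p n R) M]
  /-- the submodule `Q` -/
  Q : Submodule (TruncatedWittVector p n R) M
  /-- the Frobenius-semilinear map `F` -/
  F : M →ₛₗ[frobenius n hp] M
  /-- the Frobenius-semilinear map `F₁` -/
  F₁ : Q →ₛₗ[frobenius n hp] M ⧸ (J p R n • ⊤ : Submodule (TruncatedWittVector p n R) M)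
  normal : IsNormalPair n Q
  F₁_ver_smul : ∀ (a : TruncatedWittVector p n R) (x : M) (h : ver n a • x ∈ Q),
    F₁ ⟨ver n a • x, h⟩ = a • (J p R n • ⊤ : Submodule (TruncatedWittVector p n R) M).mkQ (F x)
  F_eq_p_smul : ∀ (y : Q) (z : M),
    (J p R n • ⊤ : Submodule (TruncatedWittVector p n R) M).mkQ z = F₁ y →
      F y = (p : TruncatedWittVector p n R) • z

attribute [instance] WeakSemidisplay.addCommGroup WeakSemidisplay.module

/-- Reformulation of normality through retractions and dual bases, convenient for tensor products. -/
def IsNormalPair' (n : ℕ) [NeZero n] {M : Type u} [AddCommGroup M]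
    [Module (TruncatedWittVector p n R) M] (Q : Submodule (TruncatedWittVector p n R) M) : Prop :=
  ∃ (T : Type u) (_ : AddCommGroup T) (_ : Module (TruncatedWittVector p n R) T)
    (i : T →ₗ[TruncatedWittVector p n R] M) (π : M →ₗ[TruncatedWittVector p n R] T),
    Module.Finite (TruncatedWittVector p n R) T ∧
    Module.Projective (TruncatedWittVector p n R) T ∧
    (∀ t, π (i t) = t) ∧
    (∀ x, x ∈ Q ↔ π x ∈ (I p R n • ⊤ : Submodule (TruncatedWittVector p n R) T)) ∧
    (∀ x, π x = 0 → ∀ a ∈ J p R n, a • x = 0) ∧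
    ∃ (K : Type) (_ : Fintype K)
      (φ : K → M →ₛₗ[TruncatedWittVector.truncate (p := p) (R := R) (Nat.sub_le n 1)]
        TruncatedWittVector p (n - 1) R) (m : K → M),
      ∀ (x : M) (a : K → TruncatedWittVector p n R),
        (∀ k, TruncatedWittVector.truncate (Nat.sub_le n 1) (a k) = φ k x) →
        x - ∑ k, a k • m k ∈ (J p R n • ⊤ : Submodule (TruncatedWittVector p n R) M)

theorem IsNormalPair.normal' {n : ℕ} [NeZero n] {M : Type u} [AddCommGroup M]
    [Module (TruncatedWittVector p n R) M] {Q : Submodule (TruncatedWittVector p n R) M}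
    (h : IsNormalPair n Q) : IsNormalPair' n Q := by
  obtain ⟨T, L, _, _, _, _, e, _, _, _, _, he, hQ⟩ := h
  have smul_zero_L (a : TruncatedWittVector p n R) (t : T) :
      e.symm (a • t, 0) = a • e.symm (t, 0) := by
    apply e.injective
    rw [he]
    simp
  have hfst (a : TruncatedWittVector p n R) (x : M) : (e (a • x)).1 = a • (e x).1 := by rw [he]
  have hsnd (a : TruncatedWittVector p n R) (x : M) : (e (a • x)).2 =
    TruncatedWittVector.truncate (Nat.sub_le n 1) a • (e x).2 := by rw [he]
  refine ⟨T, inferInstance, inferInstance,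
    { toFun := fun t => e.symm (t, 0)
      map_add' := fun s t => by rw [← map_add]; simp
      map_smul' := smul_zero_L },
    { toFun := fun x => (e x).1
      map_add' := fun s t => by simp
      map_smul' := hfst }, inferInstance, inferInstance, fun t => ?_, hQ, ?_, ?_⟩
  · simp
  · intro x hx a ha
    apply e.injective
    rw [he, map_zero]
    have : TruncatedWittVector.truncate (Nat.sub_le n 1) a = 0 := ha
    have hx' : (e x).1 = 0 := hx
    simp [this, hx']
  · obtain ⟨c, f, g, -, -, hfg⟩ :=
      Module.Finite.exists_comp_eq_id_of_projective (TruncatedWittVector p n R) T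
    obtain ⟨d, f', g', -, -, hfg'⟩ :=
      Module.Finite.exists_comp_eq_id_of_projective (TruncatedWittVector p (n - 1) R) L
    refine ⟨Fin c ⊕ Fin d, inferInstance, Sum.elim
      (fun k =>
        { toFun := fun x => TruncatedWittVector.truncate (Nat.sub_le n 1) (g (e x).1 k)
          map_add' := fun x y => by simp
          map_smul' := fun a x => by rw [hfst]; simp })
      (fun k =>
        { toFun := fun x => g' (e x).2 k
          map_add' := fun x y => by simp
          map_smul' := fun a x => by rw [hsnd]; simp }),
      Sum.elim (fun k => e.symm (f (Pi.single k 1), 0)) (fun k => e.symm (0, f' (Pi.single k 1))),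
      ?_⟩
    intro x a ha
    have h1 : ∀ k : Fin c, a (Sum.inl k) - g (e x).1 k ∈ J p R n := by
      intro k
      have := ha (Sum.inl k)
      rw [J, RingHom.mem_ker, map_sub, this, sub_eq_zero]
      rfl
    have h2 : ∀ k : Fin d, TruncatedWittVector.truncate (Nat.sub_le n 1) (a (Sum.inr k)) =
      g' (e x).2 k := fun k => ha (Sum.inr k)
    have e1 : (e x).1 = ∑ k, g (e x).1 k • f (Pi.single k 1) := by
      conv_lhs => rw [← LinearMap.id_apply (R := TruncatedWittVector p n R) (e x).1, ← hfg,
        LinearMap.comp_apply, ← Finset.univ_sum_single (g (e x).1), map_sum]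
      refine Finset.sum_congr rfl fun k _ => ?_
      rw [← map_smul, ← Pi.single_smul, smul_eq_mul, mul_one]
    have e2 : (e x).2 = ∑ k, g' (e x).2 k • f' (Pi.single k 1) := by
      conv_lhs => rw [← LinearMap.id_apply (R := TruncatedWittVector p (n - 1) R) (e x).2, ← hfg',
        LinearMap.comp_apply, ← Finset.univ_sum_single (g' (e x).2), map_sum]
      refine Finset.sum_congr rfl fun k _ => ?_
      rw [← map_smul, ← Pi.single_smul, smul_eq_mul, mul_one]
    have key : x - ∑ k, a k • Sum.elim (fun k => e.symm (f (Pi.single k 1), (0 : L)))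
        (fun k => e.symm ((0 : T), f' (Pi.single k 1))) k =
        ∑ k, (g (e x).1 k - a (Sum.inl k)) • e.symm (f (Pi.single k 1), (0 : L)) := by
      rw [Fintype.sum_sum_type]
      simp only [Sum.elim_inl, Sum.elim_inr]
      rw [← sub_sub, sub_right_comm, sub_eq_iff_eq_add, ← Finset.sum_add_distrib]
      simp only [← add_smul, sub_add_cancel]
      apply e.injective
      rw [map_sub, map_sum, map_sum]
      simp only [he, AddEquiv.apply_symm_apply, smul_zero]
      ext
      · simp only [Prod.fst_sub, Prod.fst_sum, Finset.sum_const_zero, sub_zero]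
        exact e1
      · simp only [Prod.snd_sub, Prod.snd_sum, Finset.sum_const_zero, h2]
        rw [sub_eq_zero]
        exact e2
    rw [key]
    refine Submodule.sum_mem _ fun k _ => Submodule.smul_mem_smul ?_ trivial
    rw [← neg_mem_iff, neg_sub]
    exact h1 k

theorem IsNormalPair'.normal {n : ℕ} [NeZero n] {M : Type u} [AddCommGroup M]
    [Module (TruncatedWittVector p n R) M] {Q : Submodule (TruncatedWittVector p n R) M}
    (h : IsNormalPair' n Q) : IsNormalPair n Q := by
  obtain ⟨T, _, _, i, π, _, _, hi, hQ, hJ, K, _, φ, m, hm⟩ := h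
  let tr := TruncatedWittVector.truncate (p := p) (R := R) (Nat.sub_le n 1)
  have htr_surj : Function.Surjective tr := TruncatedWittVector.truncate_surjective _
  set L := LinearMap.ker π with hL
  have wd : ∀ (a b : TruncatedWittVector p n R) (l : L), tr a = tr b → a • l = b • l := by
    intro a b l hab
    rw [← sub_eq_zero, ← sub_smul]
    ext
    refine hJ l l.2 _ ?_
    rw [J, RingHom.mem_ker, map_sub, sub_eq_zero]
    exact hab
  let sm : SMul (TruncatedWittVector p (n - 1) R) L :=
    ⟨fun b l => Function.surjInv htr_surj b • l⟩
  have hsm : ∀ (a : TruncatedWittVector p n R) (l : L), tr a • l = a • l := by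
    intro a l
    exact wd _ _ _ (Function.surjInv_eq htr_surj _)
  let _ : Module (TruncatedWittVector p (n - 1) R) L :=
    Function.Surjective.moduleLeft tr htr_surj hsm
  -- the projection onto the kernel
  let q : M →ₗ[TruncatedWittVector p n R] L :=
    (LinearMap.id - i ∘ₗ π).codRestrict L (fun x => by simp [hL, hi])
  have hq : ∀ l : L, q l = l := by
    intro l
    ext
    have : π l = 0 := l.2
    simp [q, this]
  let s : (K → TruncatedWittVector p (n - 1) R) →ₗ[TruncatedWittVector p (n - 1) R] L :=
    Fintype.linearCombination (TruncatedWittVector p (n - 1) R) (fun k => q (m k))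
  let r : L →ₗ[TruncatedWittVector p (n - 1) R] (K → TruncatedWittVector p (n - 1) R) :=
    { toFun := fun l k => φ k l
      map_add' := fun x y => by ext k; simp
      map_smul' := fun b l => by
        obtain ⟨a, rfl⟩ := htr_surj b
        ext1 k
        rw [hsm]
        exact (φ k).map_smulₛₗ a (l : M) }
  have hqJ : ∀ x ∈ (J p R n • ⊤ : Submodule (TruncatedWittVector p n R) M), q x = 0 := by
    intro x hx
    induction hx using Submodule.smul_induction_on' with
    | smul a ha y hy =>
      rw [map_smul]
      ext
      exact hJ _ (q y).2 a ha
    | add x hx y hy h1 h2 => rw [map_add, h1, h2, add_zero]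
  have hsr : s ∘ₗ r = LinearMap.id := by
    ext1 l
    choose a ha using fun k => htr_surj (φ k (l : M))
    have := hqJ _ (hm l a ha)
    rw [map_sub, hq, map_sum, sub_eq_zero] at this
    rw [LinearMap.comp_apply, LinearMap.id_apply]
    conv_rhs => rw [this]
    change ∑ k, φ k l • q (m k) = _
    refine Finset.sum_congr rfl fun k _ => ?_
    rw [map_smul, ← ha k, hsm]
  have hs : Function.Surjective s := fun l => ⟨r l, LinearMap.congr_fun hsr l⟩
  refine ⟨T, L, inferInstance, inferInstance, inferInstance, inferInstance,
    { toFun := fun x => (π x, q x)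
      invFun := fun y => i y.1 + y.2
      left_inv := fun x => by simp [q]
      right_inv := fun y => by
        have h1 : q (i y.1) = 0 := by ext; simp [q, hi]
        have h2 : π y.2 = 0 := y.2.2
        simp [hi, h1, h2, hq]
      map_add' := fun x y => by simp }, inferInstance, inferInstance, Module.Finite.of_surjective s hs,
      Module.Projective.of_split r s hsr, ?_, hQ⟩
  intro a x
  change (π (a • x), q (a • x)) = (a • π x, tr a • q x)
  rw [hsm, map_smul, map_smul]

/-! ## Tensor products of weak truncated semidisplays -/

namespace WeakSemidisplay

variable {hp : (p : R) = 0} {n : ℕ} [NeZero n] {ι : Type} [Fintype ι] [DecidableEq ι]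

/-- The module `⨂ Mᵢ` (over `W_n(R)`). -/
abbrev TensorM (P : ι → WeakSemidisplay hp n) : Type u := ⨂[TruncatedWittVector p n R] i, (P i).M

/-- The kernel of `⨂ Mᵢ → ⨂ Mᵢ/Qᵢ`. -/
noncomputable def tensorQ (P : ι → WeakSemidisplay hp n) :
    Submodule (TruncatedWittVector p n R) (TensorM P) :=
  LinearMap.ker (PiTensorProduct.map fun i => (P i).Q.mkQ)

/-- The map `F ⊗ ⋯ ⊗ F`. -/
noncomputable def tensorF (P : ι → WeakSemidisplay hp n) : TensorM P →ₛₗ[frobenius n hp] TensorM P :=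
  PiSemi.lift (PiTensorProduct.tprod _) fun i => (P i).F

theorem tensorF_tprod (P : ι → WeakSemidisplay hp n) (x : ∀ i, (P i).M) :
    tensorF P (PiTensorProduct.tprod _ x) = PiTensorProduct.tprod _ fun i => (P i).F (x i) :=
  PiSemi.lift_tprod _ _ _

theorem tprod_mem_tensorQ (P : ι → WeakSemidisplay hp n) (x : ∀ i, (P i).M) (j : ι)
    (hx : x j ∈ (P j).Q) : PiTensorProduct.tprod _ x ∈ tensorQ P := by
  rw [tensorQ, PiSemi.ker_map_mkQ]
  exact Submodule.subset_span ⟨x, j, hx, rfl⟩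

theorem ver_smul_mem (P : WeakSemidisplay hp n) (a : TruncatedWittVector p n R) (x : P.M) :
    ver n a • x ∈ P.Q := by
  obtain ⟨T, _, _, i, π, _, _, hi, hQ, -⟩ := P.normal.normal'
  rw [hQ, map_smul]
  exact Submodule.smul_mem_smul ((mem_I n).2 ⟨a, rfl⟩) trivial

theorem J_smul_quot {M : Type u} [AddCommGroup M] [Module (TruncatedWittVector p n R) M]
    (w : M ⧸ (J p R n • ⊤ : Submodule (TruncatedWittVector p n R) M))
    {a : TruncatedWittVector p n R} (ha : a ∈ J p R n) : a • w = 0 := by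
  obtain ⟨w, rfl⟩ := Submodule.mkQ_surjective _ w
  rw [← map_smul, Submodule.mkQ_apply, Submodule.Quotient.mk_eq_zero]
  exact Submodule.smul_mem_smul ha trivial

/-- The map `V(a) ↦ a • w` on `I_{n,R}`. -/
theorem exists_div_ver (hp : (p : R) = 0) {M : Type u} [AddCommGroup M]
    [Module (TruncatedWittVector p n R) M]
    (w : M ⧸ (J p R n • ⊤ : Submodule (TruncatedWittVector p n R) M)) :
    ∃ G : I p R n →ₛₗ[frobenius n hp] M ⧸ (J p R n • ⊤ : Submodule (TruncatedWittVector p n R) M),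
      ∀ (c : I p R n) (b : TruncatedWittVector p n R), ver n b = c → G c = b • w := by
  choose d hd using fun c : I p R n => (mem_I n).1 c.2
  have key : ∀ b b' : TruncatedWittVector p n R, ver n b = ver n b' → b • w = b' • w := by
    intro b b' h
    rw [← sub_eq_zero, ← sub_smul]
    refine J_smul_quot w ?_
    rw [← ver_eq_zero_iff, map_sub, h, sub_self]
  refine ⟨{ toFun := fun c => d c • w, map_add' := fun c c' => ?_, map_smul' := fun r c => ?_ }, ?_⟩
  · rw [← add_smul]
    exact key _ _ (by rw [map_add, hd, hd, hd]; rfl)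
  · rw [smul_smul]
    exact key _ _ (by rw [hd, mul_comm, ← ver_mul n hp, hd, mul_comm]; rfl)
  · intro c b hb
    exact key _ _ (by rw [hd, hb])

theorem prod_aux {A : Type u} [CommRing A] (q : A) (S : Finset ι) (hS : S.Nonempty) (j : ι) :
    q ^ (S.card - 1) * ∏ i, (if i ∉ S ∧ i = j then q else 1) = ∏ i, if i ∈ S ∧ i ≠ j then q else 1 := by
  have h1 : ∏ i, (if i ∈ S ∧ i ≠ j then q else 1) = q ^ (S.erase j).card := by
    rw [Finset.prod_ite, Finset.prod_const, Finset.prod_const_one, mul_one]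
    congr 2
    ext i
    simp [and_comm]
  have hpos := hS.card_pos
  rw [h1]
  by_cases hj : j ∈ S
  · have : ∏ i, (if i ∉ S ∧ i = j then q else 1) = 1 := by
      refine Finset.prod_eq_one fun i _ => ?_
      rw [if_neg]
      rintro ⟨h, rfl⟩
      exact h hj
    rw [this, mul_one, Finset.card_erase_of_mem hj]
  · have : ∏ i, (if i ∉ S ∧ i = j then q else 1) = q := by
      rw [Finset.prod_eq_single j]
      · simp [hj]
      · intro i _ hi
        simp [hi]
      · simp
    rw [this, Finset.erase_eq_of_notMem hj, ← pow_succ]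
    congr 1
    omega

/-- The data of a normal decomposition needed for the construction of `F₁` on tensor products:
a splitting of the identity into `x ↦ ∑ φ_k(x) m_k` and a projection to a submodule of `Q`. -/
theorem exists_splitting (P : WeakSemidisplay hp n) :
    ∃ (c : ℕ) (φ : Fin c → P.M →ₗ[TruncatedWittVector p n R] TruncatedWittVector p n R)
      (m : Fin c → P.M), (∀ x, x - ∑ k, φ k x • m k ∈ P.Q) ∧ ∀ k, ∀ x ∈ P.Q, φ k x ∈ I p R n := by
  obtain ⟨T, _, _, i, π, _, _, hi, hQ, -⟩ := P.normal.normal'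
  obtain ⟨c, f, g, -, -, hfg⟩ :=
    Module.Finite.exists_comp_eq_id_of_projective (TruncatedWittVector p n R) T
  refine ⟨c, fun k => LinearMap.proj k ∘ₗ g ∘ₗ π, fun k => i (f (Pi.single k 1)), ?_, ?_⟩
  · intro x
    have e1 : π x = ∑ k, g (π x) k • f (Pi.single k 1) := by
      conv_lhs => rw [← LinearMap.id_apply (R := TruncatedWittVector p n R) (π x), ← hfg,
        LinearMap.comp_apply, ← Finset.univ_sum_single (g (π x)), map_sum]
      refine Finset.sum_congr rfl fun k _ => ?_
      rw [← map_smul, ← Pi.single_smul, smul_eq_mul, mul_one]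
    have : π (x - ∑ k, (LinearMap.proj k ∘ₗ g ∘ₗ π) x • i (f (Pi.single k 1))) = 0 := by
      rw [map_sub, map_sum, sub_eq_zero]
      simp only [map_smul, hi]
      exact e1
    rw [hQ, this]
    exact zero_mem _
  · intro k x hx
    rw [hQ] at hx
    have : ∀ t ∈ (I p R n • ⊤ : Submodule (TruncatedWittVector p n R) T), g t k ∈ I p R n := by
      intro t ht
      induction ht using Submodule.smul_induction_on' with
      | smul a ha y hy =>
        rw [map_smul, Pi.smul_apply, smul_eq_mul]
        exact Ideal.mul_mem_right _ _ ha
      | add x hx y hy h1 h2 => rw [map_add]; exact add_mem h1 h2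
    exact this _ hx

/-- Existence of the map `F₁` on a tensor product. -/
theorem exists_tensorF₁ (P : ι → WeakSemidisplay hp n) :
    ∃ G : tensorQ P →ₛₗ[frobenius n hp]
        TensorM P ⧸ (J p R n • ⊤ : Submodule (TruncatedWittVector p n R) (TensorM P)),
      ∀ (x : ∀ i, (P i).M) (j : ι) (hx : x j ∈ (P j).Q) (w : (P j).M),
        (J p R n • ⊤ : Submodule (TruncatedWittVector p n R) (P j).M).mkQ w = (P j).F₁ ⟨x j, hx⟩ →
        G ⟨PiTensorProduct.tprod _ x, tprod_mem_tensorQ P x j hx⟩ =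
          (J p R n • ⊤ : Submodule (TruncatedWittVector p n R) (TensorM P)).mkQ
            (PiTensorProduct.tprod _ (Function.update (fun i => (P i).F (x i)) j w)) := by
  choose c φ m hφQ hφI using fun i => exists_splitting (P i)
  -- the projections
  let πT : ∀ i, (P i).M →ₗ[TruncatedWittVector p n R] (P i).M := fun i =>
    ∑ k, (φ i k).smulRight (m i k)
  have hπT : ∀ i x, πT i x = ∑ k, φ i k x • m i k := fun i x => by
    simp [πT, LinearMap.sum_apply]
  let πL : ∀ i, (P i).M →ₗ[TruncatedWittVector p n R] (P i).Q := fun i =>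
    (LinearMap.id - πT i).codRestrict _ fun x => by
      simpa [hπT] using hφQ i x
  have hπL : ∀ i x, (πL i x : (P i).M) = x - πT i x := fun i x => rfl
  let Jt : Submodule (TruncatedWittVector p n R) (TensorM P) := J p R n • ⊤
  let Ji : ∀ i, Submodule (TruncatedWittVector p n R) (P i).M := fun i => J p R n • ⊤
  let gL : ∀ i, (P i).M →ₛₗ[frobenius n hp] (P i).M ⧸ Ji i := fun i => (P i).F₁.comp (πL i)
  let gT : ∀ i, (P i).M →ₛₗ[frobenius n hp] (P i).M ⧸ Ji i := fun i =>
    (Ji i).mkQ.comp ((P i).F.comp (πT i))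
  let A : Finset ι → TensorM P →ₛₗ[frobenius n hp] TensorM P ⧸ Jt := fun S =>
    PiSemi.lift (PiSemi.quotSMul (J p R n)) fun i => if i ∈ S then gL i else gT i
  -- the part on the tensor product of the `T`
  choose D hD using exists_div_ver (p := p) (R := R) (n := n) hp (M := TensorM P)
  let Φ : (∀ i, Fin (c i)) → TensorM P →ₗ[TruncatedWittVector p n R] TruncatedWittVector p n R :=
    fun k => PiSemi.lift (MultilinearMap.mkPiAlgebra _ ι _) fun i => φ i (k i)
  have hΦ : ∀ k x, Φ k (PiTensorProduct.tprod _ x) = ∏ i, φ i (k i) (x i) := fun k x => by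
    simp [Φ]
  have hΦI : ∀ k, ∀ z ∈ tensorQ P, Φ k z ∈ I p R n := by
    intro k z hz
    rw [tensorQ, PiSemi.ker_map_mkQ] at hz
    induction hz using Submodule.span_induction with
    | mem z hz =>
      obtain ⟨x, j, hj, rfl⟩ := hz
      rw [hΦ]
      exact Ideal.prod_mem _ (Finset.mem_univ j) (hφI j _ _ hj)
    | zero => rw [map_zero]; exact zero_mem _
    | add x y _ _ h1 h2 => rw [map_add]; exact add_mem h1 h2
    | smul a x _ h => rw [map_smul]; exact Ideal.mul_mem_left _ _ h
  let Φ' : (∀ i, Fin (c i)) → tensorQ P →ₗ[TruncatedWittVector p n R] I p R n := fun k =>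
    (Φ k).restrict (hΦI k)
  let mF : (∀ i, Fin (c i)) → TensorM P ⧸ Jt := fun k =>
    Jt.mkQ (PiTensorProduct.tprod _ fun i => (P i).F (m i (k i)))
  refine ⟨∑ k, (D (mF k)).comp (Φ' k) +
    ∑ S ∈ (Finset.univ : Finset (Finset ι)).erase ∅,
      (p ^ (S.card - 1) : TruncatedWittVector p n R) • (A S).comp (tensorQ P).subtype, ?_⟩
  intro x j hx w hw
  -- lifts of `F₁` on the `L`-components
  choose ℓ hℓ using fun i => Submodule.mkQ_surjective (Ji i) ((P i).F₁ (πL i (x i)))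
  have hFL : ∀ i, (P i).F (x i - πT i (x i)) = (p : TruncatedWittVector p n R) • ℓ i := fun i =>
    (P i).F_eq_p_smul (πL i (x i)) (ℓ i) (hℓ i)
  choose b hb using fun k => (mem_I n).1 (hφI j k _ hx)
  let c0 : (P j).M := ∑ k, b k • (P j).F (m j k)
  have hTj : πT j (x j) = ∑ k, ver n (b k) • m j k := by simp only [hπT, hb]
  have hTQ : πT j (x j) ∈ (P j).Q := by
    rw [hTj]
    exact Submodule.sum_mem _ fun k _ => ver_smul_mem _ _ _
  have hc0 : (Ji j).mkQ c0 = (P j).F₁ ⟨πT j (x j), hTQ⟩ := by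
    have : (⟨πT j (x j), hTQ⟩ : (P j).Q) =
        ∑ k, (⟨ver n (b k) • m j k, ver_smul_mem _ _ _⟩ : (P j).Q) := by
      ext
      refine hTj.trans ?_
      simp
    rw [this, map_sum]
    simp only [map_sum, map_smul, (P j).F₁_ver_smul]
    rfl
  have hFT : (P j).F (πT j (x j)) = (p : TruncatedWittVector p n R) • c0 := (P j).F_eq_p_smul ⟨_, hTQ⟩ c0 hc0
  have hw' : (Ji j).mkQ w = (Ji j).mkQ (ℓ j + c0) := by
    rw [map_add, hℓ, hc0, ← map_add]
    refine hw.trans (congrArg _ ?_)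
    ext
    simp [hπL]
  -- the two sides of the expansion
  let U : ∀ i, (P i).M := Function.update (fun i => (p : TruncatedWittVector p n R) • ℓ i) j (ℓ j)
  let Vv : ∀ i, (P i).M := Function.update (fun i => (P i).F (πT i (x i))) j c0
  have hUV : ∀ i, (Ji i).mkQ (Function.update (fun i => (P i).F (x i)) j w i) =
      (Ji i).mkQ ((U + Vv) i) := by
    intro i
    by_cases hi : i = j
    · subst hi
      simpa [U, Vv] using hw'
    · simp only [Function.update_of_ne hi, U, Vv, Pi.add_apply, ← hFL, ← map_add]
      simp
  have hR : Jt.mkQ (PiTensorProduct.tprod (TruncatedWittVector p n R)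
      (Function.update (fun i => (P i).F (x i)) j w)) =
      ∑ S : Finset ι, Jt.mkQ (PiTensorProduct.tprod _ (S.piecewise U Vv)) := by
    rw [← map_sum, ← MultilinearMap.map_add_univ]
    rw [← PiSemi.quotSMul_mk, ← PiSemi.quotSMul_mk]
    congr 1
    ext i
    exact hUV i
  rw [hR, ← Finset.add_sum_erase _ _ (Finset.mem_univ (∅ : Finset ι)), LinearMap.add_apply, LinearMap.sum_apply,
    LinearMap.sum_apply]
  congr 1
  · -- the `T`-part
    let cf : ∀ i, Fin (c i) → TruncatedWittVector p n R := fun i k =>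
      frobenius n hp (φ i k (x i))
    let cf' : ∀ i, Fin (c i) → TruncatedWittVector p n R := Function.update cf j b
    have hV : ∀ i, Vv i = ∑ k, cf' i k • (P i).F (m i k) := by
      intro i
      by_cases hi : i = j
      · subst hi
        simp [Vv, cf', c0]
      · simp only [Vv, cf', Function.update_of_ne hi, cf, hπT, map_sum, map_smulₛₗ]
    have : (∅ : Finset ι).piecewise U Vv = fun i => ∑ k, cf' i k • (P i).F (m i k) := by
      rw [Finset.piecewise_empty]
      ext i
      exact hV i
    rw [this, MultilinearMap.map_sum, map_sum]
    refine Finset.sum_congr rfl fun k _ => ?_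
    rw [MultilinearMap.map_smul_univ, map_smul, LinearMap.comp_apply]
    refine hD (mF k) _ _ ?_
    have hΦ' : ((Φ' k ⟨PiTensorProduct.tprod _ x, tprod_mem_tensorQ P x j hx⟩ : I p R n) :
        TruncatedWittVector p n R) = Φ k (PiTensorProduct.tprod _ x) := rfl
    refine Eq.trans ?_ hΦ'.symm
    rw [hΦ, ← Finset.mul_prod_erase _ _ (Finset.mem_univ j),
      ← Finset.mul_prod_erase _ _ (Finset.mem_univ j), ← hb, ver_mul n hp, map_prod]
    congr 2
    · simp [cf']
    · refine Finset.prod_congr rfl fun i hi => ?_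
      simp only [cf', Function.update_of_ne (Finset.ne_of_mem_erase hi), cf]
  · refine Finset.sum_congr rfl fun S hS => ?_
    have hS : S.Nonempty := Finset.nonempty_iff_ne_empty.2 (Finset.ne_of_mem_erase hS)
    have hA : A S (PiTensorProduct.tprod _ x) = Jt.mkQ (PiTensorProduct.tprod _
        (S.piecewise ℓ fun i => (P i).F (πT i (x i)))) := by
      rw [← PiSemi.quotSMul_mk, PiSemi.lift_tprod]
      congr 1
      ext i
      by_cases hi : i ∈ S
      · simp only [hi, if_true, Finset.piecewise_eq_of_mem]
        exact (hℓ i).symm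
      · simp only [hi, if_false, Finset.piecewise_eq_of_notMem, not_false_eq_true]
        rfl
    rw [LinearMap.smul_apply, LinearMap.comp_apply]
    change _ • A S (PiTensorProduct.tprod _ x) = _
    rw [hA, ← map_smul]
    congr 1
    let mm : ∀ i, (P i).M := fun i => if i ∈ S then ℓ i else Vv i
    have e1 : (S.piecewise ℓ fun i => (P i).F (πT i (x i))) =
        fun i => (if i ∉ S ∧ i = j then (p : TruncatedWittVector p n R) else 1) • mm i := by
      ext i
      by_cases hi : i ∈ S
      · simp [hi, mm]
      · by_cases hij : i = j
        · subst hij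
          simp [hi, mm, Vv, hFT]
        · simp [hi, mm, Vv, hij]
    have e2 : S.piecewise U Vv =
        fun i => (if i ∈ S ∧ i ≠ j then (p : TruncatedWittVector p n R) else 1) • mm i := by
      ext i
      by_cases hi : i ∈ S
      · by_cases hij : i = j
        · subst hij
          simp [hi, mm, U]
        · simp [hi, mm, U, hij]
      · simp [hi, mm]
    rw [e1, e2, MultilinearMap.map_smul_univ, MultilinearMap.map_smul_univ, smul_smul,
      prod_aux _ S hS j]

/-- The map `F₁` of a tensor product: the unique semilinear map such that
`F₁(⊗ xᵢ) = F(x₁) ⊗ ⋯ ⊗ F₁(x_j) ⊗ ⋯ ⊗ F(x_l)` whenever `x_j ∈ Q_j`. -/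
noncomputable def tensorF₁ (P : ι → WeakSemidisplay hp n) : tensorQ P →ₛₗ[frobenius n hp]
    TensorM P ⧸ (J p R n • ⊤ : Submodule (TruncatedWittVector p n R) (TensorM P)) :=
  Classical.choose (exists_tensorF₁ P)

theorem tensorF₁_tprod (P : ι → WeakSemidisplay hp n) (x : ∀ i, (P i).M) (j : ι)
    (hx : x j ∈ (P j).Q) (w : (P j).M)
    (hw : (J p R n • ⊤ : Submodule (TruncatedWittVector p n R) (P j).M).mkQ w =
      (P j).F₁ ⟨x j, hx⟩) :
    tensorF₁ P ⟨PiTensorProduct.tprod _ x, tprod_mem_tensorQ P x j hx⟩ =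
      (J p R n • ⊤ : Submodule (TruncatedWittVector p n R) (TensorM P)).mkQ
        (PiTensorProduct.tprod _ (Function.update (fun i => (P i).F (x i)) j w)) :=
  Classical.choose_spec (exists_tensorF₁ P) x j hx w hw

theorem tensorQ_induction (P : ι → WeakSemidisplay hp n) {motive : tensorQ P → Prop}
    (tprod : ∀ (x : ∀ i, (P i).M) (j : ι) (hx : x j ∈ (P j).Q),
      motive ⟨PiTensorProduct.tprod _ x, tprod_mem_tensorQ P x j hx⟩)
    (zero : motive 0) (add : ∀ y z, motive y → motive z → motive (y + z))
    (smul : ∀ (a : TruncatedWittVector p n R) y, motive y → motive (a • y)) (y : tensorQ P) :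
    motive y := by
  obtain ⟨y, hy⟩ := y
  have hy' := hy
  rw [tensorQ, PiSemi.ker_map_mkQ] at hy'
  have := Submodule.span_induction (p := fun z _ => ∀ h : z ∈ tensorQ P, motive ⟨z, h⟩)
    ?_ ?_ ?_ ?_ hy'
  · exact this hy
  · rintro _ ⟨x, j, hj, rfl⟩ h
    exact tprod x j hj
  · intro h
    exact zero
  · intro y z hy hz h1 h2 h
    rw [← PiSemi.ker_map_mkQ] at hy hz
    exact add ⟨y, hy⟩ ⟨z, hz⟩ (h1 hy) (h2 hz)
  · intro a y hy h1 h
    rw [← PiSemi.ker_map_mkQ] at hy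
    exact smul a ⟨y, hy⟩ (h1 hy)

theorem tensorF₁_unique (P : ι → WeakSemidisplay hp n)
    (G : tensorQ P →+ TensorM P ⧸ (J p R n • ⊤ : Submodule (TruncatedWittVector p n R) (TensorM P)))
    (hG : ∀ (x : ∀ i, (P i).M) (j : ι) (hx : x j ∈ (P j).Q) (w : (P j).M),
      (J p R n • ⊤ : Submodule (TruncatedWittVector p n R) (P j).M).mkQ w = (P j).F₁ ⟨x j, hx⟩ →
      G ⟨PiTensorProduct.tprod _ x, tprod_mem_tensorQ P x j hx⟩ =
        (J p R n • ⊤ : Submodule (TruncatedWittVector p n R) (TensorM P)).mkQ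
          (PiTensorProduct.tprod _ (Function.update (fun i => (P i).F (x i)) j w))) (y : tensorQ P) :
    G y = tensorF₁ P y := by
  have key : ∀ a : TruncatedWittVector p n R, G (a • y) = tensorF₁ P (a • y) := by
    induction y using tensorQ_induction with
    | tprod x j hx =>
      intro a
      have hx' : (Function.update x j (a • x j)) j ∈ (P j).Q := by
        simpa using Submodule.smul_mem _ a hx
      have e : a • (⟨PiTensorProduct.tprod _ x, tprod_mem_tensorQ P x j hx⟩ : tensorQ P) =
          ⟨PiTensorProduct.tprod _ (Function.update x j (a • x j)),
            tprod_mem_tensorQ P _ j hx'⟩ := by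
        ext
        simp [MultilinearMap.map_update_smul]
      obtain ⟨w, hw⟩ := Submodule.mkQ_surjective _ ((P j).F₁ ⟨_, hx'⟩)
      rw [e, hG _ j hx' w hw, tensorF₁_tprod P _ j hx' w hw]
    | zero => simp
    | add y z hy hz => intro a; rw [smul_add, map_add, map_add, hy, hz]
    | smul b y hy => intro a; rw [smul_smul, hy]
  simpa using key 1

theorem tensorF_eq_p_smul (P : ι → WeakSemidisplay hp n) (y : tensorQ P) (z : TensorM P)
    (hz : (J p R n • ⊤ : Submodule (TruncatedWittVector p n R) (TensorM P)).mkQ z = tensorF₁ P y) :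
    tensorF P y = (p : TruncatedWittVector p n R) • z := by
  have hpJ : ∀ w ∈ (J p R n • ⊤ : Submodule (TruncatedWittVector p n R) (TensorM P)),
      (p : TruncatedWittVector p n R) • w = 0 := by
    intro w hw
    induction hw using Submodule.smul_induction_on' with
    | smul a ha y hy =>
      rw [smul_smul, p_mul_J n hp ha, zero_smul]
    | add x hx y hy h1 h2 => rw [smul_add, h1, h2, add_zero]
  have red : ∀ (y : tensorQ P) (z z' : TensorM P),
      (J p R n • ⊤ : Submodule (TruncatedWittVector p n R) (TensorM P)).mkQ z = tensorF₁ P y →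
      (J p R n • ⊤ : Submodule (TruncatedWittVector p n R) (TensorM P)).mkQ z' = tensorF₁ P y →
      (p : TruncatedWittVector p n R) • z = (p : TruncatedWittVector p n R) • z' := by
    intro y z z' h h'
    rw [← sub_eq_zero, ← smul_sub]
    apply hpJ
    rw [← Submodule.Quotient.mk_eq_zero, ← Submodule.mkQ_apply, map_sub, h, h', sub_self]
  induction y using tensorQ_induction generalizing z with
  | tprod x j hx =>
    obtain ⟨w, hw⟩ := Submodule.mkQ_surjective _ ((P j).F₁ ⟨_, hx⟩)
    rw [red _ z _ hz (tensorF₁_tprod P x j hx w hw).symm, tensorF_tprod]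
    have h1 : (fun i => (P i).F (x i)) =
        Function.update (fun i => (P i).F (x i)) j ((p : TruncatedWittVector p n R) • w) := by
      rw [Function.eq_update_self_iff]
      exact (P j).F_eq_p_smul ⟨_, hx⟩ w hw
    conv_lhs => rw [h1]
    rw [MultilinearMap.map_update_smul]
  | zero =>
    rw [red 0 z 0 hz (by simp)]
    simp
  | add y y' hy hy' =>
    obtain ⟨w, hw⟩ := Submodule.mkQ_surjective _ (tensorF₁ P y)
    obtain ⟨w', hw'⟩ := Submodule.mkQ_surjective _ (tensorF₁ P y')
    rw [red _ z (w + w') hz (by rw [map_add, map_add, hw, hw']), smul_add, ← hy w hw, ← hy' w' hw',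
      ← map_add]
    rfl
  | smul a y hy =>
    obtain ⟨w, hw⟩ := Submodule.mkQ_surjective _ (tensorF₁ P y)
    rw [red _ z (frobenius n hp a • w) hz (by
      rw [LinearMap.map_smul, hw, LinearMap.map_smulₛₗ (tensorF₁ P)]), smul_comm, ← hy w hw,
      ← LinearMap.map_smulₛₗ]
    rfl

theorem tensorF₁_ver_smul [Nonempty ι] (P : ι → WeakSemidisplay hp n)
    (a : TruncatedWittVector p n R) (x : TensorM P) (h : ver n a • x ∈ tensorQ P) :
    tensorF₁ P ⟨ver n a • x, h⟩ =
      a • (J p R n • ⊤ : Submodule (TruncatedWittVector p n R) (TensorM P)).mkQ (tensorF P x) := by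
  obtain ⟨j⟩ := ‹Nonempty ι›
  have mem : ∀ (b : TruncatedWittVector p n R) (x : ∀ i, (P i).M),
      Function.update x j (ver n b • x j) j ∈ (P j).Q := by
    intro b x
    simpa using ver_smul_mem (P j) b (x j)
  have eq : ∀ (b r : TruncatedWittVector p n R) (x : ∀ i, (P i).M),
      ver n b • r • PiTensorProduct.tprod (TruncatedWittVector p n R) x =
        PiTensorProduct.tprod _
          (Function.update x j (ver n (b * frobenius n hp r) • x j)) := by
    intro b r x
    rw [smul_smul, ver_mul n hp, MultilinearMap.map_update_smul, Function.update_eq_self]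
  have mem' : ∀ (b : TruncatedWittVector p n R) (x : TensorM P), ver n b • x ∈ tensorQ P := by
    intro b x
    induction x using PiTensorProduct.induction_on with
    | smul_tprod r x =>
      rw [eq]
      exact tprod_mem_tensorQ P _ j (mem _ _)
    | add x y hx hy => rw [smul_add]; exact add_mem hx hy
  induction x using PiTensorProduct.induction_on with
  | smul_tprod r x =>
    have e : (⟨ver n a • r • PiTensorProduct.tprod (TruncatedWittVector p n R) x, h⟩ : tensorQ P) =
      ⟨_, tprod_mem_tensorQ P _ j (mem (a * frobenius n hp r) x)⟩ := Subtype.ext (eq a r x)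
    have hm : ver n (a * frobenius n hp r) • x j ∈ (P j).Q := ver_smul_mem _ _ _
    rw [e, tensorF₁_tprod P _ j (mem _ _) ((a * frobenius n hp r) • (P j).F (x j))]
    · rw [LinearMap.map_smulₛₗ (tensorF P), tensorF_tprod, LinearMap.map_smul, smul_smul]
      have : Function.update (fun i => (P i).F (Function.update x j
          (ver n (a * frobenius n hp r) • x j) i)) j ((a * frobenius n hp r) • (P j).F (x j)) =
          Function.update (fun i => (P i).F (x i)) j ((a * frobenius n hp r) • (P j).F (x j)) := by
        ext i
        by_cases hi : i = j
        · subst hi; simp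
        · simp [hi]
      rw [this, MultilinearMap.map_update_smul, Function.update_eq_self, LinearMap.map_smul]
    · rw [LinearMap.map_smul, ← (P j).F₁_ver_smul _ _ hm]
      congr 2
      simp
  | add x y hx hy =>
    have e : (⟨ver n a • (x + y), h⟩ : tensorQ P) =
        ⟨ver n a • x, mem' a x⟩ + ⟨ver n a • y, mem' a y⟩ := by
      ext
      simp
    rw [e, map_add, hx, hy, map_add, map_add, smul_add]

theorem tensor_normal [Nonempty ι] (P : ι → WeakSemidisplay hp n) : IsNormalPair n (tensorQ P) := by
  apply IsNormalPair'.normal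
  choose T hT1 hT2 i π hfin hproj hi hQ hJ K hK φ m hm using fun i => (P i).normal.normal'
  let iT : (⨂[TruncatedWittVector p n R] i, T i) →ₗ[TruncatedWittVector p n R] TensorM P :=
    PiTensorProduct.map i
  let πT : TensorM P →ₗ[TruncatedWittVector p n R] (⨂[TruncatedWittVector p n R] i, T i) :=
    PiTensorProduct.map π
  have hπi : ∀ t, πT (iT t) = t := by
    intro t
    have : πT ∘ₗ iT = LinearMap.id := by
      rw [← PiTensorProduct.map_comp, ← PiTensorProduct.map_id]
      congr 1
      ext j t
      exact hi j t
    exact LinearMap.congr_fun this t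
  have smul_mem : ∀ a ∈ I p R n, ∀ x : TensorM P, a • x ∈ tensorQ P := by
    obtain ⟨j⟩ := ‹Nonempty ι›
    intro a ha x
    induction x using PiTensorProduct.induction_on with
    | smul_tprod r x =>
      rw [smul_comm]
      refine Submodule.smul_mem _ _ ?_
      have := MultilinearMap.map_update_smul (PiTensorProduct.tprod (TruncatedWittVector p n R))
        x j a (x j)
      rw [Function.update_eq_self] at this
      rw [← this]
      refine tprod_mem_tensorQ P _ j ?_
      obtain ⟨b, rfl⟩ := (mem_I n).1 ha
      simpa using ver_smul_mem (P j) b (x j)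
    | add x y hx hy => rw [smul_add]; exact add_mem hx hy
  refine ⟨_, inferInstance, inferInstance, iT, πT, inferInstance, ?_, hπi, ?_, ?_, ?_⟩
  · choose c f g _ _ hfg using fun i =>
      Module.Finite.exists_comp_eq_id_of_projective (TruncatedWittVector p n R) (T i)
    have : Module.Free (TruncatedWittVector p n R)
        (⨂[TruncatedWittVector p n R] i, (Fin (c i) → TruncatedWittVector p n R)) :=
      Module.Free.of_basis (Basis.piTensorProduct fun i => Pi.basisFun _ (Fin (c i)))
    refine Module.Projective.of_split (PiTensorProduct.map g) (PiTensorProduct.map f) ?_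
    rw [← PiTensorProduct.map_comp, ← PiTensorProduct.map_id]
    congr 1
    ext j t
    exact LinearMap.congr_fun (hfg j) t
  · intro x
    constructor
    · intro hx
      have hx' := hx
      rw [tensorQ, PiSemi.ker_map_mkQ] at hx'
      clear hx
      induction hx' using Submodule.span_induction with
      | mem z hz =>
        obtain ⟨x, j, hj, rfl⟩ := hz
        rw [PiTensorProduct.map_tprod]
        exact PiSemi.smul_top_tprod _ _ j ((hQ j _).1 hj)
      | zero => rw [map_zero]; exact zero_mem _
      | add x y _ _ h1 h2 => rw [map_add]; exact add_mem h1 h2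
      | smul a x _ h => rw [map_smul]; exact Submodule.smul_mem _ _ h
    · intro hx
      have h1 : ∀ t ∈ (I p R n • ⊤ : Submodule (TruncatedWittVector p n R)
          (⨂[TruncatedWittVector p n R] i, T i)), iT t ∈ tensorQ P := by
        intro t ht
        induction ht using Submodule.smul_induction_on' with
        | smul a ha y hy => rw [map_smul]; exact smul_mem a ha _
        | add x hx y hy h1 h2 => rw [map_add]; exact add_mem h1 h2
      have h2 : x - iT (πT x) ∈ tensorQ P := by
        rw [tensorQ, LinearMap.mem_ker, map_sub, sub_eq_zero]
        clear hx
        induction x using PiTensorProduct.induction_on with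
        | smul_tprod r x =>
          simp only [map_smul, iT, πT, PiTensorProduct.map_tprod]
          congr 2
          ext k
          rw [← sub_eq_zero, ← map_sub, Submodule.mkQ_apply, Submodule.Quotient.mk_eq_zero, hQ]
          rw [map_sub, hi, sub_self]
          exact zero_mem _
        | add x y hx hy => simp only [map_add, hx, hy]
      simpa using add_mem h2 (h1 _ hx)
  · intro x hx a ha
    have key : ∀ x : TensorM P, a • (x - iT (πT x)) = 0 := by
      intro x
      induction x using PiTensorProduct.induction_on with
      | smul_tprod r x =>
        have := PiSemi.tprod_sub_mem (fun k => LinearMap.ker (LinearMap.lsmul _ (P k).M a))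
          (LinearMap.ker (LinearMap.lsmul _ (TensorM P) a)) (fun x j hj => by
            rw [LinearMap.mem_ker, LinearMap.lsmul_apply] at hj ⊢
            have := MultilinearMap.map_update_smul
              (PiTensorProduct.tprod (TruncatedWittVector p n R)) x j a (x j)
            rw [Function.update_eq_self] at this
            rw [← this, hj]
            exact MultilinearMap.map_coord_zero _ j (by simp)) x (fun k => i k (π k (x k)))
          (fun k => by
            rw [LinearMap.mem_ker, LinearMap.lsmul_apply]
            refine hJ k _ ?_ a ha
            rw [map_sub, hi, sub_self])
        rw [LinearMap.mem_ker, LinearMap.lsmul_apply] at this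
        simp only [map_smul, iT, πT, PiTensorProduct.map_tprod]
        rw [← smul_sub, smul_comm, this, smul_zero]
      | add x y hx hy =>
        rw [map_add, map_add, add_sub_add_comm, smul_add, hx, hy, add_zero]
    have := key x
    rwa [hx, map_zero, sub_zero] at this
  · have key : ∀ x : TensorM P, ∃ a : (∀ i, K i) → TruncatedWittVector p n R,
        (∀ k, TruncatedWittVector.truncate (Nat.sub_le n 1) (a k) =
          PiSemi.lift (MultilinearMap.mkPiAlgebra _ ι (TruncatedWittVector p (n - 1) R))
            (fun i => φ i (k i)) x) ∧
        x - ∑ k, a k • (PiTensorProduct.tprod (TruncatedWittVector p n R) fun i => m i (k i)) ∈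
          (J p R n • ⊤ : Submodule (TruncatedWittVector p n R) (TensorM P)) := by
      intro x
      induction x using PiTensorProduct.induction_on with
      | smul_tprod r x =>
        choose a ha using fun i k => TruncatedWittVector.truncate_surjective (p := p) (R := R)
          (Nat.sub_le n 1) (φ i k (x i))
        refine ⟨fun k => r * ∏ i, a i (k i), fun k => ?_, ?_⟩
        · rw [map_mul, map_prod, map_smulₛₗ, PiSemi.lift_tprod, smul_eq_mul]
          simp [ha]
        · have h1 := PiSemi.tprod_sub_mem _ _ (PiSemi.smul_top_tprod (J p R n)) x
            (fun i => ∑ k, a i k • m i k) (fun i => hm i (x i) (a i) (ha i))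
          rw [MultilinearMap.map_sum] at h1
          simp only [MultilinearMap.map_smul_univ] at h1
          have h2 := Submodule.smul_mem _ r h1
          rw [smul_sub, Finset.smul_sum] at h2
          simpa only [smul_smul] using h2
      | add x y hx hy =>
        obtain ⟨a, ha, ha'⟩ := hx
        obtain ⟨b, hb, hb'⟩ := hy
        refine ⟨a + b, fun k => ?_, ?_⟩
        · rw [Pi.add_apply, map_add, ha, hb, map_add]
        · simp only [Pi.add_apply, add_smul, Finset.sum_add_distrib]
          rw [add_sub_add_comm]
          exact add_mem ha' hb'
    let e := Fintype.equivFin (∀ i, K i)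
    refine ⟨Fin _, inferInstance, fun k => PiSemi.lift
      (MultilinearMap.mkPiAlgebra _ ι (TruncatedWittVector p (n - 1) R)) (fun i => φ i (e.symm k i)),
      fun k => PiTensorProduct.tprod (TruncatedWittVector p n R) fun i => m i (e.symm k i), ?_⟩
    intro x a ha
    obtain ⟨b, hb, hb'⟩ := key x
    rw [← e.symm.sum_comp] at hb'
    have h : ∑ k, b (e.symm k) • (PiTensorProduct.tprod (TruncatedWittVector p n R)
        fun i => m i (e.symm k i)) - ∑ k, a k • (PiTensorProduct.tprod (TruncatedWittVector p n R)
        fun i => m i (e.symm k i)) ∈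
          (J p R n • ⊤ : Submodule (TruncatedWittVector p n R) (TensorM P)) := by
      rw [← Finset.sum_sub_distrib]
      refine Submodule.sum_mem _ fun k _ => ?_
      rw [← sub_smul]
      refine Submodule.smul_mem_smul ?_ trivial
      rw [J, RingHom.mem_ker, map_sub, hb, ha, sub_self]
    simpa using add_mem hb' h

/-- The tensor product `P₁ ⊗ ⋯ ⊗ P_l` of weak truncated semidisplays. -/
noncomputable def tensor [Nonempty ι] (P : ι → WeakSemidisplay hp n) : WeakSemidisplay hp n where
  M := TensorM P
  Q := tensorQ P
  F := tensorF P
  F₁ := tensorF₁ P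
  normal := tensor_normal P
  F₁_ver_smul := tensorF₁_ver_smul P
  F_eq_p_smul := tensorF_eq_p_smul P

end WeakSemidisplay

end Semidisplay

/-! ## Commutative group functors, Cartier duals and poly-additive maps -/

/-- A functor from commutative `R`-algebras (given by their structure maps `f : R → S`) to
(additively written) abelian groups. -/
structure GroupFunctor (R : Type u) [CommRing R] where
  /-- the group of `S`-points -/
  obj : ∀ {S : Type u} [CommRing S], (R →+* S) → Type u
  [group : ∀ {S : Type u} [CommRing S] (f : R →+* S), AddCommGroup (obj f)]
  /-- the map on points induced by a homomorphism of `R`-algebras -/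
  map : ∀ {S S' : Type u} [CommRing S] [CommRing S'] (f : R →+* S) (h : S →+* S'),
    obj f →+ obj (h.comp f)
  map_id : ∀ {S : Type u} [CommRing S] (f : R →+* S) (x : obj f), map f (RingHom.id S) x = x
  map_comp : ∀ {S S' S'' : Type u} [CommRing S] [CommRing S'] [CommRing S''] (f : R →+* S)
    (h : S →+* S') (k : S' →+* S'') (x : obj f), map f (k.comp h) x = map (h.comp f) k (map f h x)

attribute [instance] GroupFunctor.group

section PolyAdd

variable {R : Type u} [CommRing R] {R' R'' : Type u} [CommRing R'] [CommRing R'']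

/-- The group of `R'`-points of the Cartier dual `Hom(G, 𝔾ₘ)` of a group functor `G` over `R`, where
`R'` is an `R`-algebra with structure map `f`: homomorphisms `G ⊗ R' → 𝔾ₘ` of group functors
over `R'`. -/
@[ext] structure CartierDual (G : GroupFunctor R) (f : R →+* R') where
  /-- the map on `S`-points, for every `R'`-algebra `S` -/
  toFun : ∀ {S : Type u} [CommRing S] (g : R' →+* S), G.obj (g.comp f) → Sˣ
  map_add : ∀ {S : Type u} [CommRing S] (g : R' →+* S) (a b : G.obj (g.comp f)),
    toFun g (a + b) = toFun g a * toFun g b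
  natural : ∀ {S S' : Type u} [CommRing S] [CommRing S'] (g : R' →+* S) (h : S →+* S')
    (a : G.obj (g.comp f)),
    toFun (h.comp g) (G.map (g.comp f) h a) = Units.map (h : S →* S') (toFun g a)

/-- The group of `R'`-points of the group functor of poly-additive maps `∏ Gᵢ → 𝔾ₘ`, where the `Gᵢ`
are group functors over `R` and `R'` is an `R`-algebra with structure map `f`: morphisms
`∏ Gᵢ ⊗ R' → 𝔾ₘ` over `R'` that are additive in every variable. -/
@[ext] structure PolyAdd {ι : Type} [DecidableEq ι] (G : ι → GroupFunctor R) (f : R →+* R') where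
  /-- the map on `S`-points, for every `R'`-algebra `S` -/
  toFun : ∀ {S : Type u} [CommRing S] (g : R' →+* S), (∀ i, (G i).obj (g.comp f)) → Sˣ
  map_update_add : ∀ {S : Type u} [CommRing S] (g : R' →+* S) (x : ∀ i, (G i).obj (g.comp f))
    (i : ι) (a b : (G i).obj (g.comp f)),
    toFun g (Function.update x i (a + b)) =
      toFun g (Function.update x i a) * toFun g (Function.update x i b)
  natural : ∀ {S S' : Type u} [CommRing S] [CommRing S'] (g : R' →+* S) (h : S →+* S')
    (x : ∀ i, (G i).obj (g.comp f)),
    toFun (h.comp g) (fun i => (G i).map (g.comp f) h (x i)) = Units.map (h : S →* S') (toFun g x)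

namespace CartierDual

variable {G : GroupFunctor R} {f : R →+* R'}

instance : One (CartierDual G f) := ⟨⟨fun _ _ => 1, by simp, by simp⟩⟩
instance : Mul (CartierDual G f) := ⟨fun χ ψ => ⟨fun g a => χ.toFun g a * ψ.toFun g a,
  fun g a b => by rw [χ.map_add, ψ.map_add, mul_mul_mul_comm],
  fun g h a => by rw [χ.natural, ψ.natural, _root_.map_mul]⟩⟩
instance : Inv (CartierDual G f) := ⟨fun χ => ⟨fun g a => (χ.toFun g a)⁻¹,
  fun g a b => by rw [χ.map_add, mul_inv],
  fun g h a => by rw [χ.natural, _root_.map_inv]⟩⟩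

/-- The group structure is given by multiplication of values. -/
instance : CommGroup (CartierDual G f) where
  mul_assoc χ ψ ω := by ext; exact congrArg Units.val (mul_assoc _ _ _)
  one_mul χ := by ext; exact congrArg Units.val (one_mul _)
  mul_one χ := by ext; exact congrArg Units.val (mul_one _)
  inv_mul_cancel χ := by ext; exact congrArg Units.val (inv_mul_cancel _)
  mul_comm χ ψ := by ext; exact congrArg Units.val (mul_comm _ _)

/-- Functoriality in the `R`-algebra `R'`: restriction of a homomorphism to `R''`-algebras. -/
def baseChange (G : GroupFunctor R) (f : R →+* R') (h : R' →+* R'') :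
    CartierDual G f →* CartierDual G (h.comp f) where
  toFun χ := ⟨fun g => χ.toFun (g.comp h), fun g => χ.map_add (g.comp h),
    fun g k => χ.natural (g.comp h) k⟩
  map_one' := rfl
  map_mul' _ _ := rfl

end CartierDual

namespace PolyAdd

variable {ι : Type} [DecidableEq ι] {G : ι → GroupFunctor R} {f : R →+* R'}

instance : One (PolyAdd G f) := ⟨⟨fun _ _ => 1, by simp, by simp⟩⟩
instance : Mul (PolyAdd G f) := ⟨fun χ ψ => ⟨fun g a => χ.toFun g a * ψ.toFun g a,
  fun g x i a b => by rw [χ.map_update_add, ψ.map_update_add, mul_mul_mul_comm],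
  fun g h a => by rw [χ.natural, ψ.natural, _root_.map_mul]⟩⟩
instance : Inv (PolyAdd G f) := ⟨fun χ => ⟨fun g a => (χ.toFun g a)⁻¹,
  fun g x i a b => by rw [χ.map_update_add, mul_inv],
  fun g h a => by rw [χ.natural, _root_.map_inv]⟩⟩

/-- The group structure is given by multiplication of values. -/
instance : CommGroup (PolyAdd G f) where
  mul_assoc χ ψ ω := by ext; exact congrArg Units.val (mul_assoc _ _ _)
  one_mul χ := by ext; exact congrArg Units.val (one_mul _)
  mul_one χ := by ext; exact congrArg Units.val (mul_one _)
  inv_mul_cancel χ := by ext; exact congrArg Units.val (inv_mul_cancel _)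
  mul_comm χ ψ := by ext; exact congrArg Units.val (mul_comm _ _)

/-- Functoriality in the `R`-algebra `R'`: restriction of a poly-additive map to `R''`-algebras. -/
def baseChange (G : ι → GroupFunctor R) (f : R →+* R') (h : R' →+* R'') :
    PolyAdd G f →* PolyAdd G (h.comp f) where
  toFun χ := ⟨fun g => χ.toFun (g.comp h), fun g => χ.map_update_add (g.comp h),
    fun g k => χ.natural (g.comp h) k⟩
  map_one' := rfl
  map_mul' _ _ := rfl

/-- The `R'`-points of the kernel of `Fⁿ : X → (Frⁿ)^* X`, where `X` is the group functor of
poly-additive maps `∏ Gᵢ → 𝔾ₘ` over the ring `R` (in which `p = 0`). On `R'`-points, `Fⁿ` is the map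
induced by the `R`-algebra homomorphism `Frⁿ : R' → R'`, where the target is an `R`-algebra via
`Frⁿ ∘ f = f ∘ Frⁿ`. -/
def frobKer {p : ℕ} [Fact p.Prime] (hp : (p : R) = 0) (n : ℕ) (G : ι → GroupFunctor R)
    (f : R →+* R') : Subgroup (PolyAdd G f) :=
  (baseChange G f (TWitt.frob (TWitt.natCast_eq_zero_of_hom f hp) ^ n)).ker

end PolyAdd

end PolyAdd

/-! ## The Zink functor -/

namespace WeakSemidisplay

open TWitt
open scoped TensorProduct

variable {p : ℕ} [Fact p.Prime] {R : Type u} [CommRing R] {hp : (p : R) = 0} {n : ℕ} [NeZero n]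
  {S S' : Type u} [CommRing S] [CommRing S']

/-- The group of morphisms from the base change of `P` to `S` to the unit object
`(W_n(S), I_{n,S}, F, V⁻¹)`: the `W_n(R)`-linear maps `η : M → W_n(S)` with `η(F x) = F(η x)` for
`x ∈ M` and `η(y) = V(η(F₁ y))` for `y ∈ Q`. (The element `V(η(z))` does not depend on the choice of
a lift `z ∈ M` of `F₁(y) ∈ M / J_{n,R} M`.) -/
def homUnit (P : WeakSemidisplay hp n) (f : R →+* S) :
    AddSubgroup (P.M →ₛₗ[TWitt.map (p := p) n f] TruncatedWittVector p n S) where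
  carrier := {η | (∀ x, η (P.F x) = frobenius n (natCast_eq_zero_of_hom f hp) (η x)) ∧
    ∀ (y : P.Q) (z : P.M),
      (J p R n • ⊤ : Submodule (TruncatedWittVector p n R) P.M).mkQ z = P.F₁ y →
      η y = ver n (η z)}
  zero_mem' := by simp
  add_mem' := by
    rintro η θ ⟨h1, h2⟩ ⟨h3, h4⟩
    refine ⟨fun x => ?_, fun y z hz => ?_⟩
    · simp [h1, h3]
    · simp [h2 y z hz, h4 y z hz]
  neg_mem' := by
    rintro η ⟨h1, h2⟩
    refine ⟨fun x => ?_, fun y z hz => ?_⟩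
    · simp [h1]
    · simp [h2 y z hz]

theorem twitt_map_comp (f : R →+* S) (h : S →+* S') (a : TruncatedWittVector p n R) :
    TWitt.map n (h.comp f) a = TWitt.map n h (TWitt.map n f a) := by
  ext i
  simp [coeff_map]

theorem twitt_map_id (a : TruncatedWittVector p n R) : TWitt.map n (RingHom.id R) a = a := by
  ext i
  simp [coeff_map]

/-- Functoriality of `homUnit` in the `R`-algebra `S`. -/
noncomputable def homUnitMap (P : WeakSemidisplay hp n) (f : R →+* S) (h : S →+* S') :
    homUnit P f →+ homUnit P (h.comp f) where
  toFun η :=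
    ⟨{ toFun := fun x => TWitt.map n h (η.1 x)
       map_add' := fun x y => by simp
       map_smul' := fun a x => by simp [twitt_map_comp] }, by
      refine ⟨fun x => ?_, fun y z hz => ?_⟩
      · change TWitt.map n h (η.1 (P.F x)) = frobenius n _ (TWitt.map n h (η.1 x))
        rw [η.2.1, map_frobenius n h]
      · change TWitt.map n h (η.1 y) = ver n (TWitt.map n h (η.1 z))
        rw [η.2.2 y z hz, map_ver]⟩
  map_zero' := by ext x; simp
  map_add' η θ := by ext x; simp

theorem homUnitMap_apply (P : WeakSemidisplay hp n) (f : R →+* S) (h : S →+* S')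
    (η : homUnit P f) (x : P.M) : (homUnitMap P f h η).1 x = TWitt.map n h (η.1 x) := rfl

/-- The Cartier dual of the group scheme attached to `P` by the Zink functor: the group functor of
morphisms from `P` to the unit object. -/
noncomputable def zinkDual (P : WeakSemidisplay hp n) : GroupFunctor R where
  obj f := homUnit P f
  map f h := homUnitMap P f h
  map_id f η := by
    ext x : 2
    exact twitt_map_id _
  map_comp f h k η := by
    ext x : 2
    exact twitt_map_comp h k _

/-- The `R'`-points of the group scheme attached to `P` by the Zink functor: the Cartier dual of the
group functor of morphisms from `P` to the unit object. -/
abbrev zink (P : WeakSemidisplay hp n) {R' : Type u} [CommRing R'] (f : R →+* R') : Type (u + 1) :=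
  CartierDual P.zinkDual f

variable {ι : Type} [Fintype ι] [DecidableEq ι] [Nonempty ι]

/-- The tensor product `⊗ xᵢ ↦ ∏ ηᵢ(xᵢ)` of morphisms `ηᵢ` from `Pᵢ` to the unit object. -/
noncomputable def tensorHom (P : ι → WeakSemidisplay hp n) (f : R →+* S)
    (η : ∀ i, homUnit (P i) f) : homUnit (tensor P) f :=
  ⟨PiSemi.lift (MultilinearMap.mkPiAlgebra (TruncatedWittVector p n S) ι _) fun i => (η i).1, by
    set θ : TensorM P →ₛₗ[TWitt.map (p := p) n f] TruncatedWittVector p n S :=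
      PiSemi.lift (MultilinearMap.mkPiAlgebra (TruncatedWittVector p n S) ι _) fun i => (η i).1
    have hθ : ∀ x, θ (PiTensorProduct.tprod _ x) = ∏ i, (η i).1 (x i) := fun x => by simp [θ]
    have hp' := natCast_eq_zero_of_hom f hp
    constructor
    · intro x
      change θ (tensorF P x) = frobenius n hp' (θ x)
      induction x using PiTensorProduct.induction_on with
      | smul_tprod r x =>
        rw [LinearMap.map_smulₛₗ, LinearMap.map_smulₛₗ, LinearMap.map_smulₛₗ, tensorF_tprod, hθ, hθ,
          smul_eq_mul, smul_eq_mul, map_mul, map_frobenius n f hp hp', map_prod]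
        congr 1
        exact Finset.prod_congr rfl fun i _ => (η i).2.1 _
      | add x y hx hy => rw [map_add, map_add, hx, hy, map_add, map_add]
    · have red : ∀ z z' : TensorM P,
          (J p R n • ⊤ : Submodule (TruncatedWittVector p n R) (TensorM P)).mkQ z =
          (J p R n • ⊤ : Submodule (TruncatedWittVector p n R) (TensorM P)).mkQ z' →
          ver n (θ z) = ver n (θ z') := by
        intro z z' h
        rw [← sub_eq_zero, ← map_sub, ← map_sub, ver_eq_zero_iff]
        rw [← sub_eq_zero, ← map_sub, Submodule.mkQ_apply, Submodule.Quotient.mk_eq_zero] at h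
        generalize z - z' = w at h
        induction h using Submodule.smul_induction_on' with
        | smul a ha y hy =>
          rw [LinearMap.map_smulₛₗ, smul_eq_mul]
          exact Ideal.mul_mem_right _ _ (map_mem_J n f ha)
        | add x hx y hy h1 h2 => rw [map_add]; exact add_mem h1 h2
      intro (y : tensorQ P) (z : TensorM P)
        (hz : (J p R n • ⊤ : Submodule (TruncatedWittVector p n R) (TensorM P)).mkQ z =
          tensorF₁ P y)
      change θ y = ver n (θ z)
      induction y using tensorQ_induction generalizing z with
      | tprod x j hx =>
        obtain ⟨w, hw⟩ := Submodule.mkQ_surjective _ ((P j).F₁ ⟨_, hx⟩)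
        rw [red z _ (hz.trans (tensorF₁_tprod P x j hx w hw)), hθ, hθ,
          ← Finset.mul_prod_erase _ _ (Finset.mem_univ j),
          ← Finset.mul_prod_erase _ _ (Finset.mem_univ j), (η j).2.2 ⟨_, hx⟩ w hw,
          ver_mul n hp', map_prod, Function.update_self]
        congr 2
        refine Finset.prod_congr rfl fun i hi => ?_
        rw [Function.update_of_ne (Finset.ne_of_mem_erase hi), (η i).2.1]
      | zero =>
        rw [red z 0 (by rw [hz, map_zero, map_zero])]
        simp
      | add y y' hy hy' =>
        obtain ⟨w, hw⟩ := Submodule.mkQ_surjective _ (tensorF₁ P y)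
        obtain ⟨w', hw'⟩ := Submodule.mkQ_surjective _ (tensorF₁ P y')
        rw [red z (w + w') (by rw [hz, map_add, map_add, hw, hw']), map_add, map_add, ← hy w hw,
          ← hy' w' hw', ← map_add]
        rfl
      | smul a y hy =>
        obtain ⟨w, hw⟩ := Submodule.mkQ_surjective _ (tensorF₁ P y)
        rw [red z (frobenius n hp a • w) (by
            rw [hz, LinearMap.map_smul, hw, LinearMap.map_smulₛₗ (tensorF₁ P)]),
          LinearMap.map_smulₛₗ, map_frobenius n f hp hp', smul_eq_mul, mul_comm, ← ver_mul n hp',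
          ← hy w hw, mul_comm, ← smul_eq_mul, ← LinearMap.map_smulₛₗ]
        rfl⟩

theorem tensorHom_tprod (P : ι → WeakSemidisplay hp n) (f : R →+* S)
    (η : ∀ i, homUnit (P i) f) (x : ∀ i, (P i).M) :
    (tensorHom P f η).1 (PiTensorProduct.tprod _ x) = ∏ i, (η i).1 (x i) := by
  refine (PiSemi.lift_tprod _ _ _).trans ?_
  simp

theorem homUnit_tensor_ext (P : ι → WeakSemidisplay hp n) (f : R →+* S)
    {θ θ' : homUnit (tensor P) f}
    (h : ∀ x : ∀ i, (P i).M, θ.1 (PiTensorProduct.tprod _ x) = θ'.1 (PiTensorProduct.tprod _ x)) :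
    θ = θ' := by
  apply Subtype.ext
  apply LinearMap.ext
  intro (x : TensorM P)
  induction x using PiTensorProduct.induction_on with
  | smul_tprod r x => exact (θ.1.map_smulₛₗ _ _).trans ((h x ▸ (θ'.1.map_smulₛₗ _ _).symm))
  | add x y hx hy => exact (θ.1.map_add _ _).trans ((congrArg₂ _ hx hy).trans (θ'.1.map_add _ _).symm)

theorem tensorHom_update_add (P : ι → WeakSemidisplay hp n) (f : R →+* S)
    (η : ∀ i, homUnit (P i) f) (i : ι) (a b : homUnit (P i) f) :
    tensorHom P f (Function.update η i (a + b)) =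
      tensorHom P f (Function.update η i a) + tensorHom P f (Function.update η i b) := by
  apply homUnit_tensor_ext
  intro x
  have key : ∀ c : homUnit (P i) f,
      (tensorHom P f (Function.update η i c)).1 (PiTensorProduct.tprod _ x) =
        c.1 (x i) * ∏ k ∈ Finset.univ.erase i, (η k).1 (x k) := by
    intro c
    rw [tensorHom_tprod, ← Finset.mul_prod_erase _ _ (Finset.mem_univ i), Function.update_self]
    congr 1
    refine Finset.prod_congr rfl fun k hk => ?_
    rw [Function.update_of_ne (Finset.ne_of_mem_erase hk)]
  have e : ((tensorHom P f (Function.update η i a) + tensorHom P f (Function.update η i b)).1)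
      (PiTensorProduct.tprod _ x) =
      (tensorHom P f (Function.update η i a)).1 (PiTensorProduct.tprod _ x) +
      (tensorHom P f (Function.update η i b)).1 (PiTensorProduct.tprod _ x) := rfl
  rw [e, key, key, key, ← add_mul]
  rfl

theorem map_tensorHom (P : ι → WeakSemidisplay hp n) (f : R →+* S) (h : S →+* S')
    (η : ∀ i, homUnit (P i) f) :
    homUnitMap (tensor P) f h (tensorHom P f η) =
      tensorHom P (h.comp f) fun i => homUnitMap (P i) f h (η i) := by
  apply homUnit_tensor_ext
  intro x
  rw [tensorHom_tprod]
  refine (homUnitMap_apply _ _ _ _ _).trans ?_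
  rw [tensorHom_tprod, map_prod]
  rfl

/-- The homomorphism from (the `R'`-points of) the Zink group scheme of `P₁ ⊗ ⋯ ⊗ P_l` to the group
of poly-additive maps to `𝔾ₘ`, given by composition with the poly-additive map `tensorHom`. -/
noncomputable def zinkToPolyAdd (P : ι → WeakSemidisplay hp n) {R' : Type u} [CommRing R']
    (f : R →+* R') : zink (tensor P) f →* PolyAdd (fun i => (P i).zinkDual) f where
  toFun χ :=
    { toFun := fun g η => χ.toFun g (tensorHom P (g.comp f) η)
      map_update_add := fun g η i a b => 
        (congrArg (χ.toFun g) (tensorHom_update_add P _ η i a b)).trans (χ.map_add g _ _)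
      natural := fun g h η => 
        (congrArg (χ.toFun (h.comp g)) (map_tensorHom P (g.comp f) h η).symm).trans
          (χ.natural g h _) }
  map_one' := rfl
  map_mul' _ _ := rfl

end WeakSemidisplay

/-!
Write `q = p ^ n`. The proof rests on a description of the functions on the group functor
`𝔷*_P = Hom(P, W_n)` by means of Artin–Hasse exponentials.

*Coordinates.* The normal decomposition of `P` yields a frame, i.e. linear forms `φⱼ` on `M` and
elements `mⱼ` such that `x ↦ ∑ φⱼ(x) mⱼ` is a projection with image `T`. A homomorphism `η` to the
unit object is determined by the Witt vectors `aⱼ = η(mⱼ)`: iterating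
`η(x) = ∑ φⱼ(x) aⱼ + V(η(F₁(x - ∑ φⱼ(x) mⱼ)))` recovers `η`. The remaining condition is a system of
equations `F(aⱼ) = τⱼ(a)` with additive `τⱼ` (`FrobSystem`), and `𝔷*_P` is a retract of the functor
of solutions (`Frame.toHom_ofHom`). If the `k`-th component of a Witt vector is given the weight
`p ^ k`, then Witt vector addition and `V` respect weights, so the coordinate ring of the functor of
solutions has the form `R'[x] / (xₛ ^ p - gₛ)`, where `gₛ` has smaller weight than `xₛ ^ p`. Hence
the monomials with exponents `< p` form a basis (`WeightedReduction.existsUnique_sum_smul`).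

*The Artin–Hasse basis.* Let `c_t(x)` be the coefficient of `X ^ t` in `∏ₖ AH(xₖ X ^ (p ^ k))`.
Integrality and additivity of the Artin–Hasse exponential give
`c_t(x + y) = ∑_{r + s = t} c_r(x) c_s(y)` for `t < q`. Up to units and terms of smaller weight the
products `∏ⱼ c_{β(j)}(aⱼ)` with `β(j) < q` are the monomials with exponents `< p`, so every function
on the functor of solutions is a unique linear combination of these products
(`FrobSystem.existsUnique_expansion`), and similarly for a product of such functors. In this
divided-power-like basis additive functions are easily found: they are the linear combinations of
the `(aⱼ)₀`, and poly-additive functions are the linear combinations of the `∏ᵢ (a_{i,jᵢ})₀`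
(`FrobSystem.coeff_eq_zero_of_polyAdditive`). Moreover the coefficients of a multiplicative function
satisfy `c_δ c_ε = c_{δ + ε}`, where `c_{δ + ε}` has to be read as zero if an index is `≥ q`; thus
the non-constant ones are killed by the `q`-power map, which shows that the comparison homomorphism
has values in the kernel of `Fⁿ`.

*Bijectivity.* Conversely, if `r ^ q = 0`, then `η ↦ ∏ₖ AH(η(m)ₖ r ^ (p ^ k))` is a character. For
a poly-additive map `y` in the kernel of `Fⁿ`, the coefficients of `y - 1` generate a nilpotent
ideal `I`. If `y ≡ 1` modulo `I ^ k`, then `y - 1` is poly-additive modulo `I ^ (k + 1)`, and `y` is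
there the image of a product of such exponential characters; dividing by it and iterating proves
surjectivity (`exists_zinkToPolyAdd_eq`). Injectivity follows by a similar induction from the
description of additive and poly-additive functions (`zinkToPolyAdd_injective`).
-/

/-! ### The Artin–Hasse exponential -/

namespace ArtinHasse

open PowerSeries

/-- A power series `f` over a torsion-free ring is determined, up to degree `N`, by its constant
coefficient and its logarithmic derivative. -/
theorem coeff_eq_of_derivative_eq {A : Type*} [CommRing A] [IsDomain A] [CharZero A]
    {f g v w : A⟦X⟧} (hf : d⁄dX A f = f * v) (hg : d⁄dX A g = g * w)
    (h0 : constantCoeff f = constantCoeff g) (N : ℕ)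
    (hvw : ∀ i, i + 1 < N → coeff i v = coeff i w) : ∀ i < N, coeff i f = coeff i g := by
  intro i
  induction i using Nat.strong_induction_on with
  | _ i ih =>
    intro hi
    cases i with
    | zero => simpa using h0
    | succ i =>
      have h1 := congrArg (coeff i) hf
      have h2 := congrArg (coeff i) hg
      rw [coeff_derivative, coeff_mul] at h1 h2
      have h3 : coeff (i + 1) f * ((i : A) + 1) = coeff (i + 1) g * ((i : A) + 1) := by
        rw [h1, h2]
        refine Finset.sum_congr rfl fun x hx => ?_
        have := Finset.HasAntidiagonal.mem_antidiagonal.1 hx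
        rw [ih x.1 (by omega) (by omega), hvw x.2 (by omega)]
      exact mul_right_cancel₀ (Nat.cast_add_one_ne_zero i) h3

variable (p : ℕ) [Fact p.Prime]

open Classical in
/-- The power series `∑ₖ X ^ (p ^ k - 1)`, the logarithmic derivative of the Artin–Hasse
exponential. -/
noncomputable def logDeriv (A : Type*) [CommRing A] : A⟦X⟧ :=
  mk fun i => if ∃ k, i + 1 = p ^ k then 1 else 0

/-- The coefficients of the Artin–Hasse exponential `exp (∑ₖ X ^ (p ^ k) / p ^ k)`, as elements
of `ℚ_p`. -/
noncomputable def coeffQ : ℕ → ℚ_[p]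
  | 0 => 1
  | j + 1 => (∑ i : Fin (j + 1), coeffQ (j - i) * coeff (i : ℕ) (logDeriv p ℚ_[p])) / (j + 1)

theorem derivative_mk_coeffQ :
    d⁄dX ℚ_[p] (mk (coeffQ p)) = mk (coeffQ p) * logDeriv p ℚ_[p] := by
  ext j
  have h : ((j : ℚ_[p]) + 1) ≠ 0 := Nat.cast_add_one_ne_zero j
  rw [coeff_derivative, coeff_mk, coeffQ, div_mul_cancel₀ _ h, mul_comm, coeff_mul,
    Finset.Nat.sum_antidiagonal_eq_sum_range_succ_mk, Finset.sum_range]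
  exact Finset.sum_congr rfl fun i _ => by rw [coeff_mk, mul_comm]

/-- Splitting off the summand `k = 0`. -/
theorem logDeriv_eq (A : Type*) [CommRing A] :
    logDeriv p A = 1 + X ^ (p - 1) * expand p (Fact.out : p.Prime).ne_zero (logDeriv p A) := by
  have hp := (Fact.out : p.Prime)
  ext i
  rw [map_add, coeff_X_pow_mul', coeff_expand, coeff_one, logDeriv, coeff_mk]
  rcases Nat.eq_zero_or_pos i with rfl | hi
  · have h1 : ∃ k, 0 + 1 = p ^ k := ⟨0, by simp⟩
    have h2 : ¬ (p - 1 ≤ 0) := by have := hp.two_le; omega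
    rw [if_pos h1, if_neg h2]
    simp
  · rw [if_neg hi.ne', zero_add]
    by_cases h : ∃ k, i + 1 = p ^ k
    · obtain ⟨k, hk⟩ := h
      rw [if_pos ⟨k, hk⟩]
      cases k with
      | zero => simp at hk; omega
      | succ k =>
        have h1 : p ≤ i + 1 := by
          rw [hk, pow_succ]
          exact Nat.le_mul_of_pos_left _ (pow_pos hp.pos k)
        have h2 : i - (p - 1) = p * (p ^ k - 1) := by
          have h3 : p * (p ^ k - 1) = p ^ (k + 1) - p := by
            rw [Nat.mul_sub, mul_one, pow_succ, mul_comm]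
          have := hp.two_le
          omega
        rw [if_pos (by omega), h2, if_pos (Dvd.intro _ rfl), Nat.mul_div_cancel_left _ hp.pos,
          coeff_mk, if_pos ⟨k, Nat.sub_add_cancel (Nat.one_le_pow _ _ hp.pos)⟩]
    · rw [if_neg h]
      split_ifs with h1 h2
      · obtain ⟨c, hc⟩ := h2
        rw [hc, Nat.mul_div_cancel_left _ hp.pos, coeff_mk, if_neg]
        rintro ⟨k, hk⟩
        refine h ⟨k + 1, ?_⟩
        rw [pow_succ, ← hk, add_mul, one_mul, mul_comm]
        have := hp.two_le
        omega
      · rfl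
      · rfl

/-- The functional equation `g(X) ^ p = g(X ^ p) exp(p X)` of the Artin–Hasse exponential. -/
theorem mk_coeffQ_pow :
    mk (coeffQ p) ^ p = expand p (Fact.out : p.Prime).ne_zero (mk (coeffQ p)) *
      rescale (p : ℚ_[p]) (exp ℚ_[p]) := by
  have hp := (Fact.out : p.Prime)
  set g : ℚ_[p]⟦X⟧ := mk (coeffQ p) with hg
  have hD := derivative_mk_coeffQ p
  rw [← hg] at hD
  have hr : d⁄dX ℚ_[p] (rescale (p : ℚ_[p]) (exp ℚ_[p])) =
      rescale (p : ℚ_[p]) (exp ℚ_[p]) * (p : ℚ_[p]⟦X⟧) := by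
    rw [← exp_pow_eq_rescale_exp, derivative_pow, derivative_exp, mul_assoc, mul_comm,
      ← pow_succ, Nat.sub_add_cancel hp.one_le]
  have he : d⁄dX ℚ_[p] (expand p hp.ne_zero g) =
      expand p hp.ne_zero g * (expand p hp.ne_zero (logDeriv p ℚ_[p]) *
        ((p : ℚ_[p]⟦X⟧) * X ^ (p - 1))) := by
    rw [expand_apply, derivative_subst (HasSubst.X_pow hp.ne_zero), hD, ← expand_apply p hp.ne_zero, map_mul,
      ← expand_apply p hp.ne_zero, derivative_pow]
    simp [mul_assoc]
  have h1 : d⁄dX ℚ_[p] (g ^ p) = g ^ p * ((p : ℚ_[p]⟦X⟧) * logDeriv p ℚ_[p]) := by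
    rw [derivative_pow, hD]
    have h : g ^ p = g ^ (p - 1) * g := by rw [← pow_succ, Nat.sub_add_cancel hp.one_le]
    rw [h]
    ring
  have h2 : d⁄dX ℚ_[p] (expand p hp.ne_zero g * rescale (p : ℚ_[p]) (exp ℚ_[p])) =
      (expand p hp.ne_zero g * rescale (p : ℚ_[p]) (exp ℚ_[p])) *
        ((p : ℚ_[p]⟦X⟧) * logDeriv p ℚ_[p]) := by
    rw [Derivation.leibniz, hr, he, smul_eq_mul, smul_eq_mul]
    conv_rhs => rw [logDeriv_eq]
    ring
  ext i
  refine coeff_eq_of_derivative_eq h1 h2 ?_ (i + 1) (fun _ _ => rfl) i (Nat.lt_succ_self i)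
  have : constantCoeff g = 1 := by rw [hg, ← coeff_zero_eq_constantCoeff_apply, coeff_mk, coeffQ]
  rw [map_pow, map_mul, constantCoeff_expand, this, ← coeff_zero_eq_constantCoeff_apply, coeff_rescale]
  simp

theorem norm_pow_div_factorial_lt (j : ℕ) (hj : j ≠ 0) :
    ‖(p : ℚ_[p]) ^ j / (j.factorial : ℚ_[p])‖ < 1 := by
  have hp := (Fact.out : p.Prime)
  have hf : (j.factorial : ℚ_[p]) ≠ 0 := by exact_mod_cast j.factorial_ne_zero
  rw [norm_div, Padic.norm_p_pow, Padic.norm_eq_zpow_neg_valuation hf, Padic.valuation_natCast,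
    ← zpow_sub₀ (by exact_mod_cast hp.ne_zero)]
  apply zpow_lt_one_of_neg₀ (by exact_mod_cast hp.one_lt)
  have := padicValNat_factorial_lt_of_ne_zero (p := p) hj
  omega

/-- The coefficients of the Artin–Hasse exponential `g` are `p`-integral. This is Dwork's argument:
if the coefficients of degree `< m` are integral, then the coefficients of `X ^ m` in the functional
equation `g(X) ^ p = g(X ^ p) exp(p X)` are integral up to the term `p gₘ` on the left hand side, and
the integral parts are congruent modulo `p` since `G ^ p ≡ G(X ^ p)` and `exp(p X) ≡ 1`. For `p = 2`
the latter uses that `2 ^ j / j!` is even for `j ≥ 1`. -/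
theorem norm_coeffQ_le (m : ℕ) : ‖coeffQ p m‖ ≤ 1 := by
  have hp := (Fact.out : p.Prime)
  induction m using Nat.strong_induction_on with
  | _ m ih =>
  rcases Nat.eq_zero_or_pos m with rfl | hm
  · simp [coeffQ]
  -- the truncation below degree `m`, with integral coefficients
  let G : ℤ_[p]⟦X⟧ := mk fun i => if h : i < m then ⟨coeffQ p i, ih i h⟩ else 0
  let E : ℤ_[p]⟦X⟧ := mk fun j => if hj : j = 0 then 1 else
    ⟨(p : ℚ_[p]) ^ j / (j.factorial : ℚ_[p]), (norm_pow_div_factorial_lt p j hj).le⟩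
  let φ : ℤ_[p] →+* ℚ_[p] := PadicInt.Coe.ringHom
  have hG : ∀ i < m, φ (coeff i G) = coeffQ p i := by
    intro i hi
    rw [coeff_mk]
    exact congrArg φ (dif_pos hi)
  have hE : map φ E = rescale (p : ℚ_[p]) (exp ℚ_[p]) := by
    ext j
    by_cases hj : j = 0
    · subst hj; simp [E, φ]
    · have : coeff j E = ⟨(p : ℚ_[p]) ^ j / (j.factorial : ℚ_[p]),
          (norm_pow_div_factorial_lt p j hj).le⟩ := by
        rw [coeff_mk]
        exact dif_neg hj
      rw [coeff_map, this, coeff_rescale, coeff_exp]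
      refine (div_eq_mul_inv _ _).trans ?_
      simp
  obtain ⟨r, hr⟩ : ∃ r : ℚ_[p]⟦X⟧, mk (coeffQ p) = map φ G + X ^ m * r := by
    have : X ^ m ∣ mk (coeffQ p) - map φ G := by
      rw [X_pow_dvd_iff]
      intro i hi
      simp [hG i hi]
    obtain ⟨r, hr⟩ := this
    exact ⟨r, by rw [← hr]; ring⟩
  have hr0 : constantCoeff r = coeffQ p m := by
    have := congrArg (coeff m) hr
    rw [map_add, coeff_X_pow_mul', if_pos le_rfl, Nat.sub_self, coeff_mk, coeff_map] at this
    rw [this]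
    simp [G]
  have hG0 : constantCoeff (map φ G) = 1 := by
    rw [← coeff_zero_eq_constantCoeff_apply, coeff_map, hG 0 hm, coeffQ]
  have hpow : coeff m (mk (coeffQ p) ^ p) = φ (coeff m (G ^ p)) + p * coeffQ p m := by
    obtain ⟨k, hk⟩ := Polynomial.powAddExpansion (map φ G) (X ^ m * r) p
    rw [hr, hk, map_add, map_add, ← map_pow, coeff_map]
    have e1 : (p : ℚ_[p]⟦X⟧) * map φ G ^ (p - 1) * (X ^ m * r) =
      X ^ m * ((p : ℚ_[p]⟦X⟧) * map φ G ^ (p - 1) * r) := by ring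
    have e2 : k * (X ^ m * r) ^ 2 = X ^ (m + m) * (r ^ 2 * k) := by ring
    rw [e1, e2, coeff_X_pow_mul', if_pos le_rfl, coeff_X_pow_mul', if_neg (by omega), Nat.sub_self,
      add_zero, coeff_zero_eq_constantCoeff_apply]
    have : constantCoeff ((p : ℚ_[p]⟦X⟧) * map φ G ^ (p - 1) * r) = p * coeffQ p m := by
      rw [RingHom.map_mul, RingHom.map_mul, RingHom.map_pow, hG0, hr0]
      simp
    rw [this]
  have hexp : coeff m (expand p hp.ne_zero (mk (coeffQ p)) * rescale (p : ℚ_[p]) (exp ℚ_[p])) =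
      φ (coeff m (expand p hp.ne_zero G * E)) := by
    rw [← coeff_map, RingHom.map_mul (PowerSeries.map φ), hE, coeff_mul, coeff_mul]
    refine Finset.sum_congr rfl fun x hx => ?_
    congr 1
    have hx := Finset.HasAntidiagonal.mem_antidiagonal.1 hx
    rw [coeff_map, coeff_expand, coeff_expand]
    split_ifs with h
    · rw [hG, coeff_mk]
      refine lt_of_le_of_lt ?_ (Nat.div_lt_self hm hp.one_lt)
      exact Nat.div_le_div_right (by omega)
    · simp
  have hmod : (p : ℤ_[p]) ∣ coeff m (expand p hp.ne_zero G * E) - coeff m (G ^ p) := by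
    have hker : ∀ z : ℤ_[p], (p : ℤ_[p]) ∣ z ↔ PadicInt.toZMod z = 0 := by
      intro z
      rw [← RingHom.mem_ker, PadicInt.ker_toZMod, PadicInt.maximalIdeal_eq_span_p,
        Ideal.mem_span_singleton]
    have hE1 : map PadicInt.toZMod E = 1 := by
      ext j
      rw [coeff_map, coeff_one]
      by_cases hj : j = 0
      · subst hj; simp [E]
      · rw [if_neg hj, ← hker, ← PadicInt.norm_lt_one_iff_dvd]
        simpa [E, hj] using norm_pow_div_factorial_lt p j hj
    rw [hker, map_sub, ← coeff_map, ← coeff_map, map_mul, hE1, mul_one, map_pow, map_expand,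
      sub_eq_zero]
    have := MvPowerSeries.map_frobenius_expand (p := p) (hp := hp.ne_zero) (σ := Unit) (R := ZMod p)
      (f := map PadicInt.toZMod G)
    rw [ZMod.frobenius_zmod, MvPowerSeries.map_id] at this
    exact congrArg (coeff m) this
  obtain ⟨z, hz⟩ := hmod
  have key := congrArg (coeff m) (mk_coeffQ_pow p)
  rw [hpow, hexp, ← eq_sub_iff_add_eq', ← map_sub, hz, map_mul, map_natCast] at key
  rw [mul_left_cancel₀ (by exact_mod_cast hp.ne_zero) key]
  exact z.2

/-- The coefficients of the Artin–Hasse exponential, as `p`-adic integers. -/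
noncomputable def coeffZ (j : ℕ) : ℤ_[p] := ⟨coeffQ p j, norm_coeffQ_le p j⟩

theorem map_logDeriv {A B : Type*} [CommRing A] [CommRing B] (f : A →+* B) :
    map f (logDeriv p A) = logDeriv p B := by
  ext i
  rw [coeff_map, logDeriv, logDeriv, coeff_mk, coeff_mk]
  split_ifs <;> simp

theorem derivative_map {A B : Type*} [CommRing A] [CommRing B] (f : A →+* B) (g : A⟦X⟧) :
    d⁄dX B (map f g) = map f (d⁄dX A g) := by
  ext i
  simp [coeff_derivative]

theorem derivative_rescale {A : Type*} [CommRing A] (a : A) (g : A⟦X⟧) :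
    d⁄dX A (rescale a g) = C a * rescale a (d⁄dX A g) := by
  ext i
  simp only [coeff_derivative, coeff_rescale, coeff_C_mul]
  ring

theorem rescale_map {A B : Type*} [CommRing A] [CommRing B] (f : A →+* B) (a : A) (g : A⟦X⟧) :
    map f (rescale a g) = rescale (f a) (map f g) := by
  ext i
  simp [coeff_rescale]

theorem derivative_mk_coeffZ :
    d⁄dX ℤ_[p] (mk (coeffZ p)) = mk (coeffZ p) * logDeriv p ℤ_[p] := by
  have hinj : Function.Injective (map (PadicInt.Coe.ringHom : ℤ_[p] →+* ℚ_[p])) :=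
    map_injective _ Subtype.val_injective
  have h : map (PadicInt.Coe.ringHom : ℤ_[p] →+* ℚ_[p]) (mk (coeffZ p)) = mk (coeffQ p) := by
    ext i
    rw [coeff_map, coeff_mk, coeff_mk]
    rfl
  apply hinj
  rw [← derivative_map, RingHom.map_mul, h, map_logDeriv, derivative_mk_coeffQ]

section series

variable {A B : Type*} [CommRing A] [CommRing B]

theorem prime_pow_ne_zero (k : ℕ) : p ^ k ≠ 0 := pow_ne_zero k (Fact.out : p.Prime).ne_zero

/-- The product `∏ₖ H (aₖ X ^ (p ^ k))` for a power series `H = ∑ⱼ hⱼ X ^ j` and a finite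
sequence `a`. -/
noncomputable def prodSeries (h : ℕ → A) {n : ℕ} (a : Fin n → A) : A⟦X⟧ :=
  ∏ k : Fin n, expand (p ^ (k : ℕ)) (prime_pow_ne_zero p k) (rescale (a k) (mk h))

theorem map_prodSeries (f : A →+* B) (h : ℕ → A) {n : ℕ} (a : Fin n → A) :
    map f (prodSeries p h a) = prodSeries p (fun j => f (h j)) fun k => f (a k) := by
  rw [prodSeries, map_prod]
  refine Finset.prod_congr rfl fun k _ => ?_
  rw [map_expand, rescale_map]
  congr 2

theorem coeff_prodSeries (h : ℕ → A) {n : ℕ} (a : Fin n → A) (t : ℕ) :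
    coeff t (prodSeries p h a) = ∑ l ∈ Finset.finsuppAntidiag Finset.univ t, ∏ k : Fin n,
      if p ^ (k : ℕ) ∣ l k then h (l k / p ^ (k : ℕ)) * a k ^ (l k / p ^ (k : ℕ)) else 0 := by
  rw [prodSeries, coeff_prod]
  refine Finset.sum_congr rfl fun l _ => Finset.prod_congr rfl fun k _ => ?_
  rw [coeff_expand]
  split_ifs
  · rw [coeff_rescale, coeff_mk, mul_comm]
  · rfl

theorem constantCoeff_prodSeries (h : ℕ → A) (h0 : h 0 = 1) {n : ℕ} (a : Fin n → A) :
    constantCoeff (prodSeries p h a) = 1 := by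
  rw [prodSeries, map_prod]
  refine Finset.prod_eq_one fun k _ => ?_
  rw [constantCoeff_expand, ← coeff_zero_eq_constantCoeff_apply, coeff_rescale]
  simp [h0]

theorem prodSeries_zero (h : ℕ → A) (h0 : h 0 = 1) {n : ℕ} :
    prodSeries p h (0 : Fin n → A) = 1 := by
  refine Finset.prod_eq_one fun k _ => ?_
  rw [Pi.zero_apply, rescale_zero]
  simp [← coeff_zero_eq_constantCoeff_apply, h0]

/-- The logarithmic derivative of the `k`-th factor of `prodSeries`. -/
noncomputable def factorLogDeriv (a : A) (k : ℕ) : A⟦X⟧ :=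
  expand (p ^ k) (prime_pow_ne_zero p k) (C a * rescale a (logDeriv p A)) *
    (((p : A⟦X⟧) ^ k) * X ^ (p ^ k - 1))

theorem derivative_factor {h : ℕ → A} (hh : d⁄dX A (mk h) = mk h * logDeriv p A) (a : A) (k : ℕ) :
    d⁄dX A (expand (p ^ k) (prime_pow_ne_zero p k) (rescale a (mk h))) =
      expand (p ^ k) (prime_pow_ne_zero p k) (rescale a (mk h)) * factorLogDeriv p a k := by
  rw [expand_apply, derivative_subst (HasSubst.X_pow (prime_pow_ne_zero p k)), derivative_rescale,
    hh, RingHom.map_mul, ← expand_apply _ (prime_pow_ne_zero p k),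
    ← expand_apply _ (prime_pow_ne_zero p k), derivative_pow, factorLogDeriv]
  simp only [map_mul, derivative_X, Nat.cast_pow]
  ring

theorem derivative_prodSeries {h : ℕ → A} (hh : d⁄dX A (mk h) = mk h * logDeriv p A) {n : ℕ}
    (a : Fin n → A) :
    d⁄dX A (prodSeries p h a) = prodSeries p h a * ∑ k : Fin n, factorLogDeriv p (a k) k := by
  induction n with
  | zero => simp [prodSeries]
  | succ n ih =>
    have e : prodSeries p h a = prodSeries p h (fun k : Fin n => a k.castSucc) *
        expand (p ^ n) (prime_pow_ne_zero p n) (rescale (a (Fin.last n)) (mk h)) := by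
      rw [prodSeries, Fin.prod_univ_castSucc]
      rfl
    rw [e, Derivation.leibniz, ih, derivative_factor p hh, Fin.sum_univ_castSucc, smul_eq_mul,
      smul_eq_mul]
    simp only [Fin.val_castSucc, Fin.val_last]
    ring

/-- The summand of the `m`-th ghost component that involves the `k`-th component `a`. -/
theorem coeff_factorLogDeriv (a : A) (k m i : ℕ) (hi : i + 1 = p ^ m) :
    coeff i (factorLogDeriv p a k) = if k ≤ m then (p : A) ^ k * a ^ p ^ (m - k) else 0 := by
  have hp := (Fact.out : p.Prime)
  have e : factorLogDeriv p a k = X ^ (p ^ k - 1) * (C ((p : A) ^ k) *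
      expand (p ^ k) (prime_pow_ne_zero p k) (C a * rescale a (logDeriv p A))) := by
    rw [factorLogDeriv]
    simp only [map_pow, map_natCast]
    ring
  have hpos : 0 < p ^ k := pow_pos hp.pos k
  rw [e, coeff_X_pow_mul']
  by_cases hk : k ≤ m
  · have h1 : p ^ k ≤ p ^ m := Nat.pow_le_pow_right hp.pos hk
    have h2 : i - (p ^ k - 1) = p ^ k * (p ^ (m - k) - 1) := by
      rw [Nat.mul_sub, ← pow_add, Nat.add_sub_cancel' hk]
      omega
    have h3 : p ^ (m - k) - 1 + 1 = p ^ (m - k) := Nat.sub_add_cancel (Nat.one_le_pow _ _ hp.pos)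
    rw [if_pos (by omega), if_pos hk, h2, coeff_C_mul, coeff_expand_mul, coeff_C_mul,
      coeff_rescale, logDeriv, coeff_mk, if_pos ⟨m - k, h3⟩, mul_one, ← pow_succ', h3]
  · have h1 : p ^ m < p ^ k := Nat.pow_lt_pow_right hp.one_lt (by omega)
    rw [if_neg hk, if_neg (by omega)]

theorem coeff_factorLogDeriv_of_ne (a : A) (k i : ℕ) (hi : ∀ m, i + 1 ≠ p ^ m) :
    coeff i (factorLogDeriv p a k) = 0 := by
  have hp := (Fact.out : p.Prime)
  have e : factorLogDeriv p a k = X ^ (p ^ k - 1) * (C ((p : A) ^ k) *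
      expand (p ^ k) (prime_pow_ne_zero p k) (C a * rescale a (logDeriv p A))) := by
    rw [factorLogDeriv]
    simp only [map_pow, map_natCast]
    ring
  have hpos : 0 < p ^ k := pow_pos hp.pos k
  rw [e, coeff_X_pow_mul']
  split_ifs with h
  · rw [coeff_C_mul, coeff_expand]
    split_ifs with h'
    · obtain ⟨c, hc⟩ := h'
      rw [hc, Nat.mul_div_cancel_left _ hpos, coeff_C_mul, coeff_rescale, logDeriv, coeff_mk,
        if_neg, mul_zero, mul_zero, mul_zero]
      rintro ⟨j, hj⟩
      refine hi (k + j) ?_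
      rw [pow_add, ← hj, mul_add, ← hc]
      omega
    · rw [mul_zero]
  · rfl

/-- Additivity of `a ↦ ∏ₖ H (aₖ X ^ (p ^ k))` modulo `X ^ (p ^ n)` on Witt vectors over a
torsion-free ring: both sides have the same logarithmic derivative, whose coefficients are the
ghost components. -/
theorem coeff_prodSeries_add_of_charZero [IsDomain A] [CharZero A] {h : ℕ → A} (h0 : h 0 = 1)
    (hh : d⁄dX A (mk h) = mk h * logDeriv p A) (n : ℕ) (x y : WittVector p A) (t : ℕ)
    (ht : t < p ^ n) :
    coeff t (prodSeries p h fun k : Fin n => (x + y).coeff k) =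
      coeff t ((prodSeries p h fun k : Fin n => x.coeff k) *
        prodSeries p h fun k : Fin n => y.coeff k) := by
  have hp := (Fact.out : p.Prime)
  refine coeff_eq_of_derivative_eq (derivative_prodSeries p hh _)
    (w := (∑ k : Fin n, factorLogDeriv p (x.coeff k) k) +
      ∑ k : Fin n, factorLogDeriv p (y.coeff k) k) ?_ ?_ (p ^ n) ?_ t ht
  · rw [Derivation.leibniz, derivative_prodSeries p hh, derivative_prodSeries p hh, smul_eq_mul,
      smul_eq_mul]
    ring
  · rw [RingHom.map_mul, constantCoeff_prodSeries p h h0, constantCoeff_prodSeries p h h0,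
      constantCoeff_prodSeries p h h0, one_mul]
  · intro i hi
    rw [map_add, map_sum, map_sum, map_sum]
    by_cases hm : ∃ m, i + 1 = p ^ m
    · obtain ⟨m, hm⟩ := hm
      have hmn : m < n := (Nat.pow_lt_pow_iff_right hp.one_lt).1 (hm ▸ hi)
      have key : ∀ z : WittVector p A, ∑ k : Fin n, coeff i (factorLogDeriv p (z.coeff k) k) =
          WittVector.ghostComponent m z := by
        intro z
        simp only [coeff_factorLogDeriv p _ _ m i hm]
        rw [WittVector.ghostComponent_apply, wittPolynomial_eq_sum_C_mul_X_pow, map_sum,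
          Fin.sum_univ_eq_sum_range
            (fun k => if k ≤ m then (p : A) ^ k * z.coeff k ^ p ^ (m - k) else 0) n,
          ← Finset.sum_filter]
        have : (Finset.range n).filter (fun k => k ≤ m) = Finset.range (m + 1) := by
          ext k
          simp only [Finset.mem_filter, Finset.mem_range]
          omega
        rw [this]
        refine Finset.sum_congr rfl fun k _ => ?_
        simp
      rw [key, key, key, map_add]
    · have hm : ∀ m, i + 1 ≠ p ^ m := fun m h => hm ⟨m, h⟩
      simp only [coeff_factorLogDeriv_of_ne p _ _ i hm, Finset.sum_const_zero, add_zero]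

end series

/-- The coefficients of the Artin–Hasse exponential modulo `p`, lifted to natural numbers. Their
images in a ring in which `p = 0` are the coefficients of the Artin–Hasse exponential over this
ring. -/
noncomputable def coeffN (j : ℕ) : ℕ := (PadicInt.toZMod (coeffZ p j)).val

variable {p}

theorem coeffZ_zero : coeffZ p 0 = 1 := Subtype.ext (by simp [coeffZ, coeffQ])

theorem coeffN_cast {S : Type*} [CommRing S] [CharP S p] (j : ℕ) :
    (coeffN p j : S) = ZMod.castHom (dvd_refl p) S (PadicInt.toZMod (coeffZ p j)) := by
  rw [ZMod.castHom_apply, coeffN, ZMod.natCast_val]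

theorem coeffN_zero : coeffN p 0 = 1 := by
  have : Fact (1 < p) := ⟨(Fact.out : p.Prime).one_lt⟩
  rw [coeffN, coeffZ_zero, map_one, ZMod.val_one]

/-- Below degree `p` the logarithmic derivative of the Artin–Hasse exponential is `1`. -/
theorem succ_mul_coeffQ (j : ℕ) (hj : j + 1 < p) :
    ((j : ℚ_[p]) + 1) * coeffQ p (j + 1) = coeffQ p j := by
  have h := congrArg (coeff j) (derivative_mk_coeffQ p)
  rw [coeff_derivative, coeff_mul, coeff_mk, mul_comm, Finset.sum_eq_single (j, 0)] at h
  · rw [h, coeff_mk, logDeriv, coeff_mk, if_pos ⟨0, by simp⟩, mul_one]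
  · rintro ⟨a, b⟩ hab hne
    rw [logDeriv, coeff_mk, coeff_mk, if_neg, mul_zero]
    rintro ⟨k, hk⟩
    have hab : a + b = j := Finset.HasAntidiagonal.mem_antidiagonal.1 hab
    cases k with
    | zero =>
      simp only [pow_zero] at hk
      exact hne (by ext <;> simp <;> omega)
    | succ k =>
      have : p ≤ p ^ (k + 1) := Nat.le_self_pow (Nat.succ_ne_zero k) p
      simp only at hk
      omega
  · intro h
    simp at h

/-- The Artin–Hasse exponential agrees with the usual exponential below degree `p`; in particular
its coefficients are units there. -/
theorem factorial_mul_coeffN {S : Type*} [CommRing S] (hp : (p : S) = 0) (j : ℕ) (hj : j < p) :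
    (j.factorial : S) * coeffN p j = 1 := by
  rcases subsingleton_or_nontrivial S with h | h
  · exact Subsingleton.elim _ _
  have : CharP S p := (CharP.charP_iff_prime_eq_zero (Fact.out : p.Prime)).mpr hp
  rw [coeffN_cast]
  have key : ∀ j, j < p → (j.factorial : ℤ_[p]) * coeffZ p j = 1 := by
    intro j
    induction j with
    | zero => intro _; simp [coeffZ_zero]
    | succ j ih =>
      intro hj
      have h1 : ((j : ℤ_[p]) + 1) * coeffZ p (j + 1) = coeffZ p j := by
        apply Subtype.ext
        rw [PadicInt.coe_mul, PadicInt.coe_add, PadicInt.coe_natCast, PadicInt.coe_one]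
        exact succ_mul_coeffQ j hj
      rw [Nat.factorial_succ, Nat.cast_mul, Nat.cast_succ, mul_comm ((j : ℤ_[p]) + 1), mul_assoc, h1]
      exact ih (by omega)
  have := congrArg (fun z => ZMod.castHom (dvd_refl p) S (PadicInt.toZMod z)) (key j hj)
  simpa using this

/-- Additivity of `a ↦ ∏ₖ H (aₖ X ^ (p ^ k))` modulo `X ^ (p ^ n)` on `W_n(S)` for a ring `S` in
which `p = 0`, where `H` is the Artin–Hasse exponential. -/
theorem coeff_prodSeries_add {S : Type u} [CommRing S] (hp : (p : S) = 0) (n : ℕ)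
    (x y : TruncatedWittVector p n S) (t : ℕ) (ht : t < p ^ n) :
    coeff t (prodSeries p (fun j => (coeffN p j : S)) (x + y).coeff) =
      coeff t (prodSeries p (fun j => (coeffN p j : S)) x.coeff *
        prodSeries p (fun j => (coeffN p j : S)) y.coeff) := by
  rcases subsingleton_or_nontrivial S with h | h
  · exact Subsingleton.elim _ _
  have : CharP S p := (CharP.charP_iff_prime_eq_zero (Fact.out : p.Prime)).mpr hp
  -- the statement is the image of an identity in a universal torsion-free ring
  let U := MvPolynomial (ℕ ⊕ ℕ) ℤ_[p]
  let κ : ℤ_[p] →+* S := (ZMod.castHom (dvd_refl p) S).comp PadicInt.toZMod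
  let φ : U →+* S := MvPolynomial.eval₂Hom κ (Sum.elim x.out.coeff y.out.coeff)
  let h : ℕ → U := fun j => MvPolynomial.C (coeffZ p j)
  have hh : d⁄dX U (mk h) = mk h * logDeriv p U := by
    have := congrArg (map (MvPolynomial.C : ℤ_[p] →+* U)) (derivative_mk_coeffZ p)
    rw [← derivative_map, RingHom.map_mul, map_logDeriv] at this
    have e : map (MvPolynomial.C : ℤ_[p] →+* U) (mk (coeffZ p)) = mk h := by
      ext1 j
      rw [coeff_map, coeff_mk, coeff_mk]
    rwa [e] at this
  let a : WittVector p U := WittVector.mk p fun k => MvPolynomial.X (Sum.inl k)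
  let b : WittVector p U := WittVector.mk p fun k => MvPolynomial.X (Sum.inr k)
  have key := congrArg φ (coeff_prodSeries_add_of_charZero p (h := h)
    (by simp [h, coeffZ_zero]) hh n a b t ht)
  have ha : WittVector.map φ a = x.out := by
    ext k
    exact MvPolynomial.eval₂Hom_X' _ _ _
  have hb : WittVector.map φ b = y.out := by
    ext k
    exact MvPolynomial.eval₂Hom_X' _ _ _
  have hφh : (fun j => φ (h j)) = fun j => (coeffN p j : S) := by
    ext j
    rw [coeffN_cast]
    exact MvPolynomial.eval₂Hom_C _ _ _
  have hc : ∀ (z : WittVector p U) (w : TruncatedWittVector p n S),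
      WittVector.truncate n (WittVector.map φ z) = w →
      (fun k : Fin n => φ (z.coeff k)) = w.coeff := by
    rintro z _ rfl
    ext k
    rw [WittVector.coeff_truncate, WittVector.map_coeff]
  have hout : ∀ w : TruncatedWittVector p n S, WittVector.truncate n w.out = w :=
    TruncatedWittVector.truncateFun_out
  rw [← coeff_map, ← coeff_map, RingHom.map_mul, map_prodSeries, map_prodSeries, map_prodSeries,
    hφh, hc (a + b) (x + y) (by rw [map_add, ha, hb, map_add, hout, hout]),
    hc a x (by rw [ha, hout]), hc b y (by rw [hb, hout])] at key
  exact key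

end ArtinHasse

/-! ### Monomial bases of complete intersections of the form `R[x] / (xₛ ^ p - gₛ)` -/

namespace WeightedReduction

open MvPolynomial

variable {σ : Type} [Fintype σ] [DecidableEq σ] {R : Type u} [CommRing R] (w : σ → ℕ)

variable (R) in
/-- Polynomials of weighted degree `< m`. -/
noncomputable def degLT (m : ℕ) : Submodule R (MvPolynomial σ R) :=
  restrictSupport R {d | Finsupp.weight w d < m}

variable (R) in
/-- Polynomials of weighted degree `≤ m`. -/
noncomputable def degLE (m : ℕ) : Submodule R (MvPolynomial σ R) :=
  restrictSupport R {d | Finsupp.weight w d ≤ m}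

variable {w}

theorem degLT_mono {m m' : ℕ} (h : m ≤ m') : degLT R w m ≤ degLT R w m' :=
  restrictSupport_mono R fun _ hd => lt_of_lt_of_le hd h

theorem degLE_mono {m m' : ℕ} (h : m ≤ m') : degLE R w m ≤ degLE R w m' :=
  restrictSupport_mono R fun _ hd => le_trans hd h

theorem degLT_le_degLE (m : ℕ) : degLT R w m ≤ degLE R w m :=
  restrictSupport_mono R fun _ hd => Nat.le_of_lt (Set.mem_ofPred.1 hd)

theorem degLT_succ (m : ℕ) : degLT R w (m + 1) = degLE R w m :=
  congrArg (restrictSupport R) (Set.ext fun _ => Nat.lt_succ_iff)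

theorem degLE_mul {m m' : ℕ} {f g : MvPolynomial σ R} (hf : f ∈ degLE R w m)
    (hg : g ∈ degLE R w m') : f * g ∈ degLE R w (m + m') := by
  have := Submodule.mul_mem_mul hf hg
  rw [degLE, degLE, ← restrictSupport_add] at this
  refine restrictSupport_mono R ?_ this
  rintro _ ⟨a, ha, b, hb, rfl⟩
  simp only [Set.mem_ofPred_eq, map_add] at *
  omega

theorem degLT_mul {m m' : ℕ} {f g : MvPolynomial σ R} (hf : f ∈ degLT R w m)
    (hg : g ∈ degLE R w m') : f * g ∈ degLT R w (m + m') := by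
  have := Submodule.mul_mem_mul hf hg
  rw [degLT, degLE, ← restrictSupport_add] at this
  refine restrictSupport_mono R ?_ this
  rintro _ ⟨a, ha, b, hb, rfl⟩
  simp only [Set.mem_ofPred_eq, map_add] at *
  omega

theorem monomial_mem_degLE (d : σ →₀ ℕ) (r : R) :
    monomial d r ∈ degLE R w (Finsupp.weight w d) :=
  (monomial_mem_restrictSupport R).2 (Or.inl (Set.mem_ofPred.2 le_rfl))

theorem exists_mem_degLT (f : MvPolynomial σ R) : ∃ m, f ∈ degLT R w m := by
  refine ⟨f.support.sup (Finsupp.weight w) + 1, ?_⟩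
  rw [degLT, mem_restrictSupport_iff]
  intro d hd
  exact Nat.lt_succ_of_le (Finset.le_sup (f := Finsupp.weight w) hd)

theorem degLT_zero : degLT R w 0 = ⊥ := by
  rw [eq_bot_iff]
  intro f hf
  rw [degLT, mem_restrictSupport_iff] at hf
  rw [Submodule.mem_bot, ← support_eq_empty, Finset.eq_empty_iff_forall_notMem]
  intro d hd
  exact Nat.not_lt_zero _ (hf hd)

/-- `f` is a monomial plus terms of smaller weight. -/
def Lead (w : σ → ℕ) (d : σ →₀ ℕ) (f : MvPolynomial σ R) : Prop :=
  f - monomial d 1 ∈ degLT R w (Finsupp.weight w d)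

theorem Lead.mem_degLE {d : σ →₀ ℕ} {f : MvPolynomial σ R} (h : Lead w d f) :
    f ∈ degLE R w (Finsupp.weight w d) := by
  have := add_mem (degLT_le_degLE _ h) (monomial_mem_degLE (w := w) d (1 : R))
  simpa using this

theorem Lead.monomial (d : σ →₀ ℕ) : Lead w d (MvPolynomial.monomial d (1 : R)) := by
  rw [Lead, sub_self]
  exact zero_mem _

theorem Lead.mul {d e : σ →₀ ℕ} {f g : MvPolynomial σ R} (hf : Lead w d f) (hg : Lead w e g) :
    Lead w (d + e) (f * g) := by
  have h1 := degLT_mul hf hg.mem_degLE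
  have h2 := degLT_mul hg (monomial_mem_degLE (w := w) d (1 : R))
  have h3 : (MvPolynomial.monomial (d + e) (1 : R)) =
    MvPolynomial.monomial d 1 * MvPolynomial.monomial e 1 := by simp [monomial_mul]
  rw [Lead, map_add, h3]
  rw [add_comm] at h2
  convert add_mem h1 h2 using 1
  ring

theorem Lead.pow {d : σ →₀ ℕ} {f : MvPolynomial σ R} (hf : Lead w d f) (k : ℕ) :
    Lead w (k • d) (f ^ k) := by
  induction k with
  | zero => simpa using Lead.monomial (R := R) (w := w) 0
  | succ k ih => rw [pow_succ, succ_nsmul]; exact ih.mul hf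

theorem Lead.prod {ι : Type*} (s : Finset ι) (d : ι → σ →₀ ℕ) (f : ι → MvPolynomial σ R)
    (h : ∀ i ∈ s, Lead w (d i) (f i)) : Lead w (∑ i ∈ s, d i) (∏ i ∈ s, f i) := by
  classical
  induction s using Finset.induction_on with
  | empty => simpa using Lead.monomial (R := R) (w := w) 0
  | insert i s hi ih =>
    rw [Finset.sum_insert hi, Finset.prod_insert hi]
    exact (h i (Finset.mem_insert_self i s)).mul
      (ih fun j hj => h j (Finset.mem_insert_of_mem hj))

/-- If `f` is a linear map which is unitriangular with respect to the weight filtration then it is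
bijective. -/
theorem bijective_of_lead (Φ : MvPolynomial σ R →ₗ[R] MvPolynomial σ R)
    (h : ∀ d, Lead w d (Φ (monomial d 1))) : Function.Bijective Φ := by
  have low : ∀ m, ∀ f ∈ degLT R w (m + 1), Φ f - f ∈ degLT R w m := by
    intro m f hf
    rw [degLT, restrictSupport_eq_span] at hf
    induction hf using Submodule.span_induction with
    | mem f hf =>
      obtain ⟨d, hd, rfl⟩ := hf
      exact degLT_mono (Nat.lt_succ_iff.1 hd) (h d)
    | zero => simp
    | add x y _ _ hx hy => rw [map_add, add_sub_add_comm]; exact add_mem hx hy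
    | smul a x _ hx => rw [map_smul, ← smul_sub]; exact Submodule.smul_mem _ _ hx
  constructor
  · rw [injective_iff_map_eq_zero]
    intro f hf
    obtain ⟨m, hm⟩ := exists_mem_degLT (w := w) f
    induction m with
    | zero => rwa [degLT_zero, Submodule.mem_bot] at hm
    | succ m ih =>
      have := low m f hm
      rw [hf, zero_sub, neg_mem_iff] at this
      exact ih this
  · intro f
    obtain ⟨m, hm⟩ := exists_mem_degLT (w := w) f
    induction m generalizing f with
    | zero =>
      rw [degLT_zero, Submodule.mem_bot] at hm
      exact ⟨0, by simp [hm]⟩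
    | succ m ih =>
      obtain ⟨g, hg⟩ := ih _ (low m f hm)
      exact ⟨f - g, by rw [map_sub, hg, sub_sub_cancel]⟩

variable {p : ℕ} (hp : 0 < p) {g : σ → MvPolynomial σ R}

variable (p g) in
/-- The ideal generated by the polynomials `xₛ ^ p - gₛ`. -/
noncomputable def relIdeal : Ideal (MvPolynomial σ R) :=
  Ideal.span (Set.range fun s => X s ^ p - g s)

variable (p g) in
/-- The linear map sending `∏ xₛ ^ (p mₛ + aₛ)` with `aₛ < p` to `∏ (xₛ ^ p - gₛ) ^ mₛ xₛ ^ aₛ`. -/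
noncomputable def rewriteMap : MvPolynomial σ R →ₗ[R] MvPolynomial σ R :=
  (basisMonomials σ R).constr R fun d => ∏ s, (X s ^ p - g s) ^ (d s / p) * X s ^ (d s % p)

theorem rewriteMap_monomial (d : σ →₀ ℕ) : rewriteMap p g (monomial d 1) =
    ∏ s, (X s ^ p - g s) ^ (d s / p) * X s ^ (d s % p) := by
  have e : monomial d (1 : R) = basisMonomials σ R d := by rw [coe_basisMonomials]
  rw [e, rewriteMap, Module.Basis.constr_basis]

theorem X_pow_eq_monomial' (s : σ) (k : ℕ) :
    (X s : MvPolynomial σ R) ^ k = monomial (Finsupp.single s k) 1 := X_pow_eq_monomial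

theorem rewriteMap_lead (hg : ∀ s, g s ∈ degLT R w (p * w s)) (d : σ →₀ ℕ) :
    Lead w d (rewriteMap p g (monomial d 1)) := by
  rw [rewriteMap_monomial]
  have h1 : ∀ s, Lead w (Finsupp.single s p) (X s ^ p - g s) := by
    intro s
    rw [Lead, ← X_pow_eq_monomial', sub_sub_cancel_left, neg_mem_iff, Finsupp.weight_single]
    exact hg s
  have h2 : ∀ s, Lead w (Finsupp.single s (d s)) ((X s ^ p - g s) ^ (d s / p) * X s ^ (d s % p)) := by
    intro s
    have := ((h1 s).pow (d s / p)).mul (Lead.monomial (R := R) (w := w) (Finsupp.single s (d s % p)))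
    rwa [← X_pow_eq_monomial', Finsupp.smul_single, smul_eq_mul, ← Finsupp.single_add,
      mul_comm, Nat.div_add_mod] at this
  have := Lead.prod (w := w) Finset.univ _ _ fun s _ => h2 s
  rwa [Finsupp.univ_sum_single] at this

include hp in
theorem rewriteMap_X_pow_mul (s : σ) (f : MvPolynomial σ R) :
    rewriteMap p g (X s ^ p * f) = (X s ^ p - g s) * rewriteMap p g f := by
  induction f using MvPolynomial.induction_on' with
  | add f h hf hh => rw [mul_add, map_add, map_add, hf, hh, mul_add]
  | monomial d r =>
    have e1 : monomial d r = r • monomial d (1 : R) := by rw [smul_monomial, smul_eq_mul, mul_one]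
    rw [e1, mul_smul_comm, map_smul, map_smul, mul_smul_comm]
    congr 1
    rw [X_pow_eq_monomial', monomial_mul, one_mul, rewriteMap_monomial, rewriteMap_monomial,
      ← Finset.mul_prod_erase _ _ (Finset.mem_univ s),
      ← Finset.mul_prod_erase (a := s) Finset.univ
        (fun s => (X s ^ p - g s) ^ (d s / p) * X s ^ (d s % p)) (Finset.mem_univ s),
      ← mul_assoc, ← mul_assoc]
    congr 1
    · have e : (Finsupp.single s p + d) s = p + d s := by simp
      rw [e, Nat.add_div_left _ hp, Nat.add_mod_left, pow_succ', X_pow_eq_monomial']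
    · refine Finset.prod_congr rfl fun i hi => ?_
      have e : (Finsupp.single s p + d) i = d i := by
        simp [Finsupp.single_eq_of_ne (Finset.ne_of_mem_erase hi)]
      rw [e]

include hp in
/-- A polynomial with exponents `< p` which lies in the ideal generated by the `xₛ ^ p - gₛ` is zero
if the weight of `gₛ` is smaller than that of `xₛ ^ p`. -/
theorem eq_zero_of_mem_relIdeal (hg : ∀ s, g s ∈ degLT R w (p * w s)) {f : MvPolynomial σ R}
    (hf : f ∈ relIdeal p g) (hred : ∀ d ∈ f.support, ∀ s, d s < p) : f = 0 := by
  have hbij := bijective_of_lead _ (rewriteMap_lead hg)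
  rw [relIdeal, Ideal.mem_span_range_iff_exists_fun] at hf
  obtain ⟨c, hc⟩ := hf
  choose c' hc' using fun s => hbij.2 (c s)
  have h1 : rewriteMap p g f = f := by
    conv_lhs => rw [f.as_sum, map_sum]
    conv_rhs => rw [f.as_sum]
    refine Finset.sum_congr rfl fun d hd => ?_
    have e1 : monomial d (f.coeff d) = (f.coeff d) • monomial d (1 : R) := by
      rw [smul_monomial, smul_eq_mul, mul_one]
    rw [e1, map_smul, rewriteMap_monomial]
    congr 1
    rw [monomial_eq, map_one, one_mul, Finsupp.prod_fintype _ _ (fun i => pow_zero _)]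
    refine Finset.prod_congr rfl fun s _ => ?_
    rw [Nat.div_eq_of_lt (hred d hd s), Nat.mod_eq_of_lt (hred d hd s), pow_zero, one_mul]
  have h2 : f = ∑ s, X s ^ p * c' s := by
    apply hbij.1
    rw [h1, map_sum, ← hc]
    refine Finset.sum_congr rfl fun s _ => ?_
    rw [rewriteMap_X_pow_mul hp, hc', mul_comm]
  by_contra hne
  obtain ⟨d, hd⟩ := support_nonempty.2 hne
  rw [mem_support_iff] at hd
  refine hd ?_
  rw [h2, coeff_sum]
  refine Finset.sum_eq_zero fun s _ => ?_
  rw [X_pow_eq_monomial', coeff_monomial_mul', if_neg]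
  intro hle
  have := hle s
  rw [Finsupp.single_eq_same] at this
  exact absurd (hred d (mem_support_iff.2 hd) s) (by omega)

/-- A monomial with some exponent `≥ p` is congruent to a polynomial of smaller weight. -/
theorem exists_sub_mem_relIdeal (hg : ∀ s, g s ∈ degLT R w (p * w s)) (d : σ →₀ ℕ) (s : σ)
    (hs : p ≤ d s) :
    ∃ f ∈ degLT R w (Finsupp.weight w d), monomial d 1 - f ∈ relIdeal p g := by
  have hle : Finsupp.single s p ≤ d := Finsupp.single_le_iff.2 hs
  have e : Finsupp.single s p + (d - Finsupp.single s p) = d := add_tsub_cancel_of_le hle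
  refine ⟨g s * monomial (d - Finsupp.single s p) 1, ?_, ?_⟩
  · have := degLT_mul (hg s) (monomial_mem_degLE (w := w) (d - Finsupp.single s p) (1 : R))
    have e2 := congrArg (Finsupp.weight w) e
    rw [map_add, Finsupp.weight_single, smul_eq_mul] at e2
    rwa [e2] at this
  · have e3 : (monomial d (1 : R)) = X s ^ p * monomial (d - Finsupp.single s p) 1 := by
      rw [X_pow_eq_monomial', monomial_mul, one_mul, e]
    rw [e3, ← sub_mul]
    exact Ideal.mul_mem_right _ _ (Ideal.subset_span ⟨s, rfl⟩)

/-- A submodule containing the ideal of relations is everything if it contains all monomials with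
exponents `< p` up to terms of smaller weight. -/
theorem eq_top_of_reduced (hg : ∀ s, g s ∈ degLT R w (p * w s))
    (S : Submodule R (MvPolynomial σ R)) (hI : ∀ f ∈ relIdeal p g, f ∈ S)
    (hS : ∀ d : σ →₀ ℕ, (∀ s, d s < p) →
      ∃ f ∈ degLT R w (Finsupp.weight w d), monomial d 1 - f ∈ S) : S = ⊤ := by
  have key : ∀ m, degLT R w m ≤ S := by
    intro m
    induction m with
    | zero => rw [degLT_zero]; exact bot_le
    | succ m ih =>
      rw [degLT, restrictSupport_eq_span, Submodule.span_le]
      rintro _ ⟨d, hd, rfl⟩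
      have hd : Finsupp.weight w d ≤ m := Nat.lt_succ_iff.1 hd
      obtain ⟨f, hf, hfS⟩ : ∃ f ∈ degLT R w (Finsupp.weight w d), monomial d 1 - f ∈ S := by
        by_cases h : ∀ s, d s < p
        · exact hS d h
        · push Not at h
          obtain ⟨s, hs⟩ := h
          obtain ⟨f, hf, h⟩ := exists_sub_mem_relIdeal hg d s hs
          exact ⟨f, hf, hI _ h⟩
      have := add_mem hfS (ih (degLT_mono hd hf))
      simpa using this
  rw [eq_top_iff]
  intro f _
  obtain ⟨m, hm⟩ := exists_mem_degLT (w := w) f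
  exact key m hm

include hp in
/-- A family of the right cardinality whose span contains, modulo the relations and up to terms of
smaller weight, all monomials with exponents `< p` is a basis of `R[x] / (xₛ ^ p - gₛ)`. -/
theorem existsUnique_sum_smul (hg : ∀ s, g s ∈ degLT R w (p * w s)) {B : Type} [Fintype B]
    (hB : Fintype.card B = Fintype.card (σ → Fin p)) (e : B → MvPolynomial σ R)
    (he : ∀ d : σ →₀ ℕ, (∀ s, d s < p) → ∃ f ∈ degLT R w (Finsupp.weight w d),
      monomial d 1 - f ∈ Submodule.span R (Set.range e) ⊔ (relIdeal p g).restrictScalars R)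
    (x : MvPolynomial σ R ⧸ relIdeal p g) :
    ∃! c : B → R, x = ∑ β, c β • Ideal.Quotient.mk (relIdeal p g) (e β) := by
  let π : MvPolynomial σ R →ₗ[R] MvPolynomial σ R ⧸ relIdeal p g :=
    (Ideal.Quotient.mkₐ R (relIdeal p g)).toLinearMap
  have hπ : ∀ f, π f = Ideal.Quotient.mk (relIdeal p g) f := fun f => rfl
  have surj : ∀ {B : Type} [Fintype B] (e : B → MvPolynomial σ R),
      (∀ d : σ →₀ ℕ, (∀ s, d s < p) → ∃ f ∈ degLT R w (Finsupp.weight w d),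
      monomial d 1 - f ∈ Submodule.span R (Set.range e) ⊔ (relIdeal p g).restrictScalars R) →
      Function.Surjective (Fintype.linearCombination R fun β => π (e β)) := by
    intro B _ e he x
    obtain ⟨f, rfl⟩ := Ideal.Quotient.mk_surjective x
    have : f ∈ Submodule.span R (Set.range e) ⊔ (relIdeal p g).restrictScalars R := by
      rw [eq_top_of_reduced hg _ (fun f hf => Submodule.mem_sup_right hf) he]
      trivial
    obtain ⟨y, hy, z, hz, rfl⟩ := Submodule.mem_sup.1 this
    rw [Submodule.mem_span_range_iff_exists_fun] at hy
    obtain ⟨c, rfl⟩ := hy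
    refine ⟨c, ?_⟩
    rw [Fintype.linearCombination_apply, map_add, Ideal.Quotient.eq_zero_iff_mem.2 hz, add_zero,
      ← hπ, map_sum]
    simp
  let E0 : (σ → Fin p) → MvPolynomial σ R := fun d =>
    monomial (Finsupp.equivFunOnFinite.symm fun s => (d s : ℕ)) 1
  have hE0 : Function.Bijective (Fintype.linearCombination R fun β => π (E0 β)) := by
    constructor
    · rw [injective_iff_map_eq_zero]
      intro c hc
      have h1 : π (∑ d, c d • E0 d) = 0 := by
        rw [← hc, Fintype.linearCombination_apply, map_sum]
        simp
      have hco : ∀ d₀ : σ →₀ ℕ, coeff d₀ (∑ d, c d • E0 d) =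
          ∑ d, c d * if (Finsupp.equivFunOnFinite.symm fun s => (d s : ℕ)) = d₀ then 1 else 0 := by
        intro d₀
        rw [coeff_sum]
        refine Finset.sum_congr rfl fun d _ => ?_
        rw [coeff_smul, coeff_monomial, smul_eq_mul]
      have h2 := eq_zero_of_mem_relIdeal hp hg (Ideal.Quotient.eq_zero_iff_mem.1 h1) (by
        intro d hd s
        rw [mem_support_iff, hco] at hd
        obtain ⟨d', -, hd'⟩ := Finset.exists_ne_zero_of_sum_ne_zero hd
        have : (Finsupp.equivFunOnFinite.symm fun s => (d' s : ℕ)) = d := by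
          by_contra h
          rw [if_neg h, mul_zero] at hd'
          exact hd' rfl
        rw [← this]
        exact (d' s).2)
      ext d
      have h3 := hco (Finsupp.equivFunOnFinite.symm fun s => (d s : ℕ))
      rw [h2, coeff_zero, Finset.sum_eq_single d] at h3
      · simpa using h3.symm
      · intro d' _ hne
        rw [if_neg, mul_zero]
        intro h
        refine hne (funext fun s => Fin.ext ?_)
        exact DFunLike.congr_fun h s
      · simp
    · refine surj E0 fun d hd => ⟨0, zero_mem _, ?_⟩
      rw [sub_zero]
      refine Submodule.mem_sup_left (Submodule.subset_span ⟨fun s => ⟨d s, hd s⟩, ?_⟩)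
      have e : (Finsupp.equivFunOnFinite.symm fun s => d s) = d := by
        ext s
        rfl
      exact congrArg (fun d => monomial d (1 : R)) e
  let eB : B ≃ (σ → Fin p) := Fintype.equivOfCardEq hB
  let L := LinearEquiv.ofBijective _ hE0
  let T : (B → R) →ₗ[R] (B → R) := (LinearEquiv.funCongrLeft R R eB).toLinearMap ∘ₗ
    L.symm.toLinearMap ∘ₗ Fintype.linearCombination R fun β => π (e β)
  have hT : Function.Injective T := by
    apply OrzechProperty.injective_of_surjective_endomorphism
    exact (LinearEquiv.surjective (LinearEquiv.funCongrLeft R R eB)).comp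
      (L.symm.surjective.comp (surj e he))
  have hinj : Function.Injective (Fintype.linearCombination R fun β => π (e β)) := by
    intro a b hab
    apply hT
    simp only [T, LinearMap.comp_apply, hab]
  obtain ⟨c, hc⟩ := surj e he x
  refine ⟨c, ?_, fun c' hc' => hinj ?_⟩
  · rw [← hc]
    rfl
  · rw [hc]
    exact hc'.symm

end WeightedReduction

/-! ### Complements on truncated Witt vectors -/

namespace TWitt

open PowerSeries ArtinHasse

variable {p : ℕ} [Fact p.Prime] {R S : Type u} [CommRing R] [CommRing S] {n : ℕ}

theorem frobenius_ver (hp : (p : S) = 0) (x : TruncatedWittVector p n S) :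
    frobenius n hp (ver n x) = p * x := by
  obtain ⟨x, rfl⟩ := WittVector.truncate_surjective p n S x
  rw [ver_truncate, frobenius_truncate, WittVector.frobenius_verschiebung, map_mul, mul_comm,
    map_natCast]

/-- The coefficient of `X ^ t` in the series `∏ₖ AH (xₖ X ^ (p ^ k))`, where `AH` is the
Artin–Hasse exponential. -/
noncomputable def ahCoeff (t : ℕ) (x : TruncatedWittVector p n S) : S :=
  coeff t (prodSeries p (fun j => (coeffN p j : S)) x.coeff)

theorem ahCoeff_index_zero (x : TruncatedWittVector p n S) : ahCoeff 0 x = 1 := by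
  rw [ahCoeff, coeff_zero_eq_constantCoeff_apply, constantCoeff_prodSeries]
  simp [coeffN_zero]

theorem ahCoeff_zero {t : ℕ} (ht : t ≠ 0) : ahCoeff t (0 : TruncatedWittVector p n S) = 0 := by
  have : (0 : TruncatedWittVector p n S).coeff = 0 := funext fun i => by simp
  rw [ahCoeff, this, prodSeries_zero _ _ (by simp [coeffN_zero]), coeff_one, if_neg ht]

theorem map_ahCoeff (f : R →+* S) (t : ℕ) (x : TruncatedWittVector p n R) :
    f (ahCoeff t x) = ahCoeff t (map n f x) := by
  rw [ahCoeff, ← PowerSeries.coeff_map, map_prodSeries, ahCoeff]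
  congr 2
  · ext j
    simp
  · ext k
    rw [coeff_map]

theorem ahCoeff_add (hp : (p : S) = 0) (x y : TruncatedWittVector p n S) {t : ℕ} (ht : t < p ^ n) :
    ahCoeff t (x + y) = ∑ ij ∈ Finset.HasAntidiagonal.antidiagonal t,
      ahCoeff ij.1 x * ahCoeff ij.2 y := by
  rw [ahCoeff, coeff_prodSeries_add hp n x y t ht, coeff_mul]
  rfl

theorem ahCoeff_eq_sum (t : ℕ) (x : TruncatedWittVector p n S) :
    ahCoeff t x = ∑ l ∈ Finset.finsuppAntidiag Finset.univ t, ∏ k : Fin n,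
      if p ^ (k : ℕ) ∣ l k then
        (coeffN p (l k / p ^ (k : ℕ)) : S) * x.coeff k ^ (l k / p ^ (k : ℕ)) else 0 :=
  coeff_prodSeries p _ _ t

theorem ahCoeff_one (hp : (p : S) = 0) [NeZero n] (x : TruncatedWittVector p n S) :
    ahCoeff 1 x = x.coeff 0 := by
  have hp' := (Fact.out : p.Prime)
  have h1 : (coeffN p 1 : S) = 1 := by simpa using factorial_mul_coeffN hp 1 hp'.one_lt
  rw [ahCoeff_eq_sum, Finset.sum_eq_single (Finsupp.single 0 1)]
  · rw [Finset.prod_eq_single 0]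
    · simp [h1]
    · intro k _ hk
      simp [Finsupp.single_eq_of_ne hk, coeffN_zero]
    · simp
  · intro l hl hne
    rw [Finset.mem_finsuppAntidiag] at hl
    have hl := hl.1
    by_contra h
    have h : ∀ k : Fin n, p ^ (k : ℕ) ∣ l k := by
      intro k
      by_contra hk
      exact h (Finset.prod_eq_zero (Finset.mem_univ k) (by rw [if_neg hk]))
    have hz : ∀ k : Fin n, k ≠ 0 → l k = 0 := by
      intro k hk
      have hk0 : (k : ℕ) ≠ 0 := fun h => hk (Fin.ext h)
      have h2 : l k ≤ 1 := hl ▸ Finset.single_le_sum (f := l) (fun _ _ => Nat.zero_le _)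
        (Finset.mem_univ k)
      by_contra h3
      have h4 := Nat.le_of_dvd (Nat.pos_of_ne_zero h3) (h k)
      have h5 : 1 < p ^ (k : ℕ) := Nat.one_lt_pow hk0 hp'.one_lt
      omega
    refine hne (Finsupp.ext fun k => ?_)
    rw [Finset.sum_eq_single 0 (fun k _ hk => hz k hk) (by simp)] at hl
    by_cases hk : k = 0
    · subst hk
      rw [hl, Finsupp.single_eq_same]
    · rw [hz k hk, Finsupp.single_eq_of_ne hk]
  · intro h
    refine absurd ?_ h
    rw [Finset.mem_finsuppAntidiag]
    refine ⟨?_, by simp⟩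
    rw [Finset.sum_eq_single 0 (fun k _ hk => Finsupp.single_eq_of_ne hk) (by simp),
      Finsupp.single_eq_same]

/-- The value of `∏ₖ AH (xₖ X ^ (p ^ k))` at an element `r` with `r ^ (p ^ n) = 0`, where `AH` is
the Artin–Hasse exponential. -/
noncomputable def ahExp (r : S) (x : TruncatedWittVector p n S) : S :=
  ∑ t ∈ Finset.range (p ^ n), ahCoeff t x * r ^ t

theorem map_ahExp (f : R →+* S) (r : R) (x : TruncatedWittVector p n R) :
    f (ahExp r x) = ahExp (f r) (map n f x) := by
  simp only [ahExp, map_sum, map_mul, map_pow, map_ahCoeff]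

theorem eval_eq_sum_of_pow_eq_zero {q : ℕ} {r : S} (hr : r ^ q = 0) (P : Polynomial S) :
    P.eval r = ∑ t ∈ Finset.range q, P.coeff t * r ^ t := by
  rw [Polynomial.eval_eq_sum_range' (n := max (P.natDegree + 1) q)
    (lt_of_lt_of_le (Nat.lt_succ_self _) (le_max_left _ _))]
  symm
  apply Finset.sum_subset
  · exact Finset.range_subset_range.2 (le_max_right _ _)
  · intro t _ ht
    rw [Finset.mem_range, not_lt] at ht
    rw [pow_eq_zero_of_le ht hr, mul_zero]

theorem ahExp_add (hp : (p : S) = 0) {r : S} (hr : r ^ p ^ n = 0)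
    (x y : TruncatedWittVector p n S) : ahExp r (x + y) = ahExp r x * ahExp r y := by
  have key : ∀ z : TruncatedWittVector p n S, ahExp r z =
      (trunc (p ^ n) (prodSeries p (fun j => (coeffN p j : S)) z.coeff)).eval r := by
    intro z
    rw [eval_eq_sum_of_pow_eq_zero hr, ahExp]
    refine Finset.sum_congr rfl fun t ht => ?_
    rw [coeff_trunc, if_pos (Finset.mem_range.1 ht), ahCoeff]
  rw [key x, key y, ← Polynomial.eval_mul, eval_eq_sum_of_pow_eq_zero hr, ahExp]
  refine Finset.sum_congr rfl fun t ht => ?_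
  have ht := Finset.mem_range.1 ht
  rw [ahCoeff_add hp x y ht, Polynomial.coeff_mul]
  congr 1
  refine Finset.sum_congr rfl fun ij hij => ?_
  have := Finset.HasAntidiagonal.mem_antidiagonal.1 hij
  rw [coeff_trunc, coeff_trunc, if_pos (by omega), if_pos (by omega)]
  rfl

theorem ahExp_zero (r : S) : ahExp r (0 : TruncatedWittVector p n S) = 1 := by
  rw [ahExp, Finset.sum_eq_single 0]
  · simp [ahCoeff_index_zero]
  · intro t _ ht
    rw [ahCoeff_zero ht, zero_mul]
  · intro h
    exact absurd (Finset.mem_range.2 (pow_pos (Fact.out : p.Prime).pos n)) h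

theorem ahExp_eq_of_sq_eq_zero (hp : (p : S) = 0) [NeZero n] {r : S} (hr : r * r = 0)
    (x : TruncatedWittVector p n S) : ahExp r x = 1 + r * x.coeff 0 := by
  have h2 : 2 ≤ p ^ n := le_trans (Fact.out : p.Prime).two_le (Nat.le_self_pow (NeZero.ne n) p)
  rw [ahExp, ← Finset.sum_subset (Finset.range_subset_range.2 h2), Finset.sum_range_succ,
    Finset.sum_range_one, ahCoeff_index_zero, ahCoeff_one hp]
  · ring
  · intro t _ ht
    rw [Finset.mem_range, not_lt] at ht
    rw [pow_eq_zero_of_le ht (by rw [pow_two, hr]), mul_zero]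

end TWitt

/-! ### A weight filtration on Witt vectors over a polynomial ring -/

namespace WittVector

variable {p : ℕ} [Fact p.Prime] {R : Type*} [CommRing R]

theorem coeff_teichmuller_mul [CharP R p] (r : R) (x : WittVector p R) (k : ℕ) :
    (teichmuller p r * x).coeff k = r ^ p ^ k * x.coeff k := by
  induction k generalizing r x with
  | zero => simp [mul_coeff_zero]
  | succ k ih =>
    let y : WittVector p R := mk p fun i => x.coeff (i + 1)
    have add : ∀ (a : R) (b : WittVector p R), (teichmuller p a + verschiebung b).coeff (k + 1) =
        b.coeff k := by
      intro a b
      rw [coeff_add_of_disjoint, teichmuller_coeff_pos _ _ _ (Nat.succ_pos k),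
        verschiebung_coeff_succ, zero_add]
      intro i
      rcases Nat.eq_zero_or_pos i with rfl | hi
      · right; simp
      · left; exact teichmuller_coeff_pos _ _ _ hi
    have hx : x = teichmuller p (x.coeff 0) + verschiebung y := by
      ext i
      rw [coeff_add_of_disjoint]
      · cases i with
        | zero => simp
        | succ i => 
          rw [teichmuller_coeff_pos _ _ _ (Nat.succ_pos i), verschiebung_coeff_succ, zero_add]
          rfl
      · intro i
        rcases Nat.eq_zero_or_pos i with rfl | hi
        · right; simp
        · left; exact teichmuller_coeff_pos _ _ _ hi
    have h1 : teichmuller p r * x =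
        teichmuller p (r * x.coeff 0) + verschiebung (teichmuller p (r ^ p) * y) := by
      conv_lhs => rw [hx, mul_add]
      have h2 : frobenius (teichmuller p r) = teichmuller p (r ^ p) := by
        rw [frobenius_eq_map_frobenius, map_teichmuller, frobenius_def]
      rw [← _root_.map_mul, mul_comm (teichmuller p r) (verschiebung y),
        ← verschiebung_mul_frobenius, h2, mul_comm y]
    rw [h1, add, ih, ← pow_mul, ← pow_succ']
    rfl

theorem exists_map_subtype_eq (B : Subring R) (x : WittVector p R) (hx : ∀ k, x.coeff k ∈ B) :
    ∃ y : WittVector p B, map B.subtype y = x :=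
  ⟨mk p fun k => ⟨x.coeff k, hx k⟩, by ext k; simp⟩

end WittVector

namespace WeightedReduction

open MvPolynomial TWitt

variable {σ : Type} [Fintype σ] [DecidableEq σ] {R : Type u} [CommRing R] (w : σ → ℕ)

variable (R) in
/-- The Rees ring of the weight filtration of a polynomial ring: polynomials `∑ fₘ T ^ m` such that
`fₘ` has weight `≤ m`. -/
noncomputable def reesRing : Subring (Polynomial (MvPolynomial σ R)) where
  carrier := {f | ∀ m, f.coeff m ∈ degLE R w m}
  zero_mem' m := by simp
  add_mem' hf hg m := by rw [Polynomial.coeff_add]; exact add_mem (hf m) (hg m)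
  neg_mem' hf m := by rw [Polynomial.coeff_neg]; exact neg_mem (hf m)
  one_mem' m := by
    rw [Polynomial.coeff_one]
    split_ifs with h
    · exact degLE_mono (Nat.zero_le m) (by simpa using monomial_mem_degLE (w := w) 0 (1 : R))
    · exact zero_mem _
  mul_mem' hf hg m := by
    rw [Polynomial.coeff_mul]
    refine sum_mem fun ij hij => ?_
    rw [← Finset.HasAntidiagonal.mem_antidiagonal.1 hij]
    exact degLE_mul (hf _) (hg _)

variable {w}

theorem X_pow_mul_C_mem_reesRing {f : MvPolynomial σ R} {m : ℕ} :
    Polynomial.X ^ m * Polynomial.C f ∈ reesRing R w ↔ f ∈ degLE R w m := by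
  constructor
  · intro h
    have := h m
    rwa [Polynomial.coeff_X_pow_mul', if_pos le_rfl, Nat.sub_self, Polynomial.coeff_C_zero] at this
  · intro h m'
    rw [Polynomial.coeff_X_pow_mul']
    split_ifs with h1
    · rw [Polynomial.coeff_C]
      split_ifs with h2
      · exact degLE_mono h1 h
      · exact zero_mem _
    · exact zero_mem _

variable {p : ℕ} [Fact p.Prime]

/-- The multiplication by `[T]` turns the weight filtration into a subring of the Witt vectors. -/
theorem mem_degLE_iff_exists [CharP R p] (x : WittVector p (MvPolynomial σ R)) :
    (∀ k, x.coeff k ∈ degLE R w (p ^ k)) ↔ ∃ y : WittVector p (reesRing R w),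
      WittVector.map (reesRing R w).subtype y = WittVector.teichmuller p Polynomial.X *
        WittVector.map Polynomial.C x := by
  have hc : ∀ k, (WittVector.teichmuller p Polynomial.X * WittVector.map Polynomial.C x).coeff k =
      Polynomial.X ^ p ^ k * Polynomial.C (x.coeff k) := by
    intro k
    rw [WittVector.coeff_teichmuller_mul, WittVector.map_coeff]
  constructor
  · intro h
    refine WittVector.exists_map_subtype_eq _ _ fun k => ?_
    rw [hc, X_pow_mul_C_mem_reesRing]
    exact h k
  · rintro ⟨y, hy⟩ k
    rw [← X_pow_mul_C_mem_reesRing, ← hc, ← hy, WittVector.map_coeff]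
    exact (y.coeff k).2

theorem out_mem_degLE {n : ℕ} {x : TruncatedWittVector p n (MvPolynomial σ R)}
    (hx : ∀ k : Fin n, x.coeff k ∈ degLE R w (p ^ (k : ℕ))) (k : ℕ) :
    x.out.coeff k ∈ degLE R w (p ^ k) := by
  by_cases hk : k < n
  · have := TruncatedWittVector.coeff_out x ⟨k, hk⟩
    simp only at this
    rw [this]
    exact hx ⟨k, hk⟩
  · have : x.out.coeff k = 0 := by simp [TruncatedWittVector.out, hk]
    rw [this]
    exact zero_mem _

theorem truncate_out_eq {S : Type u} [CommRing S] {n : ℕ} (x : TruncatedWittVector p n S) :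
    WittVector.truncate n x.out = x := TruncatedWittVector.truncateFun_out x

variable (w) in
/-- Truncated Witt vectors over a polynomial ring whose `k`-th component has weight `≤ p ^ k`. -/
noncomputable def wittDegLE (hp : (p : R) = 0) (n : ℕ) :
    AddSubgroup (TruncatedWittVector p n (MvPolynomial σ R)) where
  carrier := {x | ∀ k : Fin n, x.coeff k ∈ degLE R w (p ^ (k : ℕ))}
  zero_mem' k := by simp
  add_mem' {x y} hx hy := by
    rcases subsingleton_or_nontrivial R with h | h
    · intro k
      rw [Subsingleton.elim ((x + y).coeff k) 0]
      exact zero_mem _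
    have := charP_of_nontrivial hp
    obtain ⟨x', hx'⟩ := (mem_degLE_iff_exists _).1 (out_mem_degLE hx)
    obtain ⟨y', hy'⟩ := (mem_degLE_iff_exists _).1 (out_mem_degLE hy)
    have key := (mem_degLE_iff_exists (w := w) (x.out + y.out)).2
      ⟨x' + y', by rw [map_add, hx', hy', map_add, mul_add]⟩
    intro k
    rw [← truncate_out_eq x, ← truncate_out_eq y, ← map_add, WittVector.coeff_truncate]
    exact key k
  neg_mem' {x} hx := by
    rcases subsingleton_or_nontrivial R with h | h
    · intro k
      rw [Subsingleton.elim ((-x).coeff k) 0]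
      exact zero_mem _
    have := charP_of_nontrivial hp
    obtain ⟨x', hx'⟩ := (mem_degLE_iff_exists _).1 (out_mem_degLE hx)
    have key := (mem_degLE_iff_exists (w := w) (-x.out)).2
      ⟨-x', by rw [map_neg, hx', map_neg]; ring⟩
    intro k
    rw [← truncate_out_eq x, ← map_neg, WittVector.coeff_truncate]
    exact key k

theorem map_C_mul_mem_wittDegLE (hp : (p : R) = 0) {n : ℕ} (c : TruncatedWittVector p n R)
    {x : TruncatedWittVector p n (MvPolynomial σ R)} (hx : x ∈ wittDegLE w hp n) :
    TWitt.map n C c * x ∈ wittDegLE w hp n := by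
  rcases subsingleton_or_nontrivial R with h | h
  · intro k
    have h0 : ∀ f ∈ (⊤ : Submodule R (MvPolynomial σ R)), f ∈ degLE R w (p ^ (k : ℕ)) := by
      intro f _
      rw [Subsingleton.elim f 0]
      exact zero_mem _
    exact h0 _ trivial
  have := charP_of_nontrivial hp
  let κ : R →+* reesRing R w := (Polynomial.C.comp C).codRestrict (reesRing R w) fun r => by
    have h0 : C r ∈ degLE R w 0 := by simpa using monomial_mem_degLE (w := w) 0 r
    simpa using X_pow_mul_C_mem_reesRing.2 h0
  obtain ⟨x', hx'⟩ := (mem_degLE_iff_exists _).1 (out_mem_degLE hx)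
  have key := (mem_degLE_iff_exists (w := w) (WittVector.map C c.out * x.out)).2
    ⟨WittVector.map κ c.out * x', by
      have e : WittVector.map (reesRing R w).subtype (WittVector.map κ c.out) =
          WittVector.map Polynomial.C (WittVector.map C c.out) := by
        ext k
        simp only [WittVector.map_coeff]
        rfl
      rw [_root_.map_mul, hx', e, _root_.map_mul, mul_left_comm]⟩
  intro k
  rw [← truncate_out_eq c, ← truncate_out_eq x, map_truncate, ← _root_.map_mul,
    WittVector.coeff_truncate]
  exact key k

theorem ver_mem_wittDegLE (hp : (p : R) = 0) {n : ℕ}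
    {x : TruncatedWittVector p n (MvPolynomial σ R)} (hx : x ∈ wittDegLE w hp n) :
    ver n x ∈ wittDegLE w hp n := by
  rintro ⟨k, hk⟩
  cases k with
  | zero => rw [coeff_ver_zero]; exact zero_mem _
  | succ k =>
    rw [coeff_ver_succ]
    exact degLE_mono (Nat.pow_le_pow_right (Fact.out : p.Prime).pos (Nat.le_succ k)) (hx _)

end WeightedReduction

/-! ### Systems of equations `F(a) = τ(a)` in Witt vectors -/

open TWitt

/-- A system of equations `F(aⱼ) = τⱼ(a)` for `a ∈ W_n(S) ^ D`, where the `τⱼ` are additive, natural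
in the `R`-algebra `S`, and take values in every subgroup that contains the `aⱼ` and is stable under
`W_n(R)` and `V`. -/
structure FrobSystem (p : ℕ) [Fact p.Prime] (n : ℕ) (R : Type u) [CommRing R] (D : Type) where
  /-- the right hand sides of the equations -/
  τ : ∀ {S : Type u} [CommRing S], (R →+* S) →
    (D → TruncatedWittVector p n S) →+ (D → TruncatedWittVector p n S)
  map_τ : ∀ {S S' : Type u} [CommRing S] [CommRing S'] (f : R →+* S) (h : S →+* S')
    (a : D → TruncatedWittVector p n S) (j : D),
    TWitt.map n h (τ f a j) = τ (h.comp f) (fun k => TWitt.map n h (a k)) j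
  τ_mem : ∀ {S : Type u} [CommRing S] (f : R →+* S) (a : D → TruncatedWittVector p n S)
    (H : AddSubgroup (TruncatedWittVector p n S)), (∀ j, a j ∈ H) →
    (∀ c, ∀ x ∈ H, TWitt.map n f c * x ∈ H) → (∀ x ∈ H, ver n x ∈ H) → ∀ j, τ f a j ∈ H

namespace FrobSystem

variable {p : ℕ} [Fact p.Prime] {n : ℕ} {R : Type u} [CommRing R] {D : Type}
  {S S' : Type u} [CommRing S] [CommRing S']

/-- The solutions of a system of equations, which form a group. -/
noncomputable def points (𝔰 : FrobSystem p n R D) (hp : (p : R) = 0) (f : R →+* S) :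
    AddSubgroup (D → TruncatedWittVector p n S) where
  carrier := {a | ∀ j, frobenius n (natCast_eq_zero_of_hom f hp) (a j) = 𝔰.τ f a j}
  zero_mem' j := by simp
  add_mem' ha hb j := by
    rw [map_add, Pi.add_apply, Pi.add_apply, map_add, ha j, hb j]
  neg_mem' ha j := by
    rw [map_neg, Pi.neg_apply, Pi.neg_apply, map_neg, ha j]

variable (𝔰 : FrobSystem p n R D) {hp : (p : R) = 0}

theorem map_mem_points {f : R →+* S} (h : S →+* S') {a : D → TruncatedWittVector p n S}
    (ha : a ∈ 𝔰.points hp f) : (fun j => TWitt.map n h (a j)) ∈ 𝔰.points hp (h.comp f) := by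
  intro j
  rw [← 𝔰.map_τ f h, ← ha j, map_frobenius n h]

variable (hp) in
/-- Functoriality of the group of solutions. -/
noncomputable def map (f : R →+* S) (h : S →+* S') : 𝔰.points hp f →+ 𝔰.points hp (h.comp f) where
  toFun a := ⟨fun j => TWitt.map n h (a.1 j), 𝔰.map_mem_points h a.2⟩
  map_zero' := Subtype.ext (funext fun _ => map_zero _)
  map_add' _ _ := Subtype.ext (funext fun _ => map_add _ _ _)

end FrobSystem

/-! ### Frames of semidisplays -/

namespace WeakSemidisplay

variable {p : ℕ} [Fact p.Prime] {R : Type u} [CommRing R] {hp : (p : R) = 0} {n : ℕ} [NeZero n]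

/-- A frame of a weak semidisplay `P = (M, Q, F, F₁)` with normal decomposition `M = T ⊕ L`: a
dual basis of the projective module `T`, that is, linear forms `φₖ` on `M` and elements `mₖ` such
that `x ↦ ∑ φₖ(x) mₖ` is a projection onto `T` along `L`. Only its consequences for the pair
`(M, Q)` are recorded. -/
structure Frame (P : WeakSemidisplay hp n) (D : Type) [Fintype D] where
  /-- the linear forms -/
  φ : D → P.M →ₗ[TruncatedWittVector p n R] TruncatedWittVector p n R
  /-- the elements generating `T` -/
  m : D → P.M
  eq_sum : ∀ j, m j = ∑ k, φ k (m j) • m k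
  sub_mem : ∀ x, x - ∑ k, φ k x • m k ∈ P.Q
  mem_I : ∀ k, ∀ x ∈ P.Q, φ k x ∈ I p R n

theorem exists_frame (P : WeakSemidisplay hp n) : ∃ c : ℕ, Nonempty (Frame P (Fin c)) := by
  obtain ⟨T, _, _, i, π, _, _, hi, hQ, -⟩ := P.normal.normal'
  obtain ⟨c, f, g, -, -, hfg⟩ :=
    Module.Finite.exists_comp_eq_id_of_projective (TruncatedWittVector p n R) T
  have e1 : ∀ t : T, ∑ k, g t k • f (Pi.single k 1) = t := by
    intro t
    conv_rhs => rw [← LinearMap.id_apply (R := TruncatedWittVector p n R) t, ← hfg,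
      LinearMap.comp_apply, ← Finset.univ_sum_single (g t), map_sum]
    refine Finset.sum_congr rfl fun k _ => ?_
    rw [← map_smul, ← Pi.single_smul, smul_eq_mul, mul_one]
  have e2 : ∀ x : P.M, ∑ k, (LinearMap.proj k ∘ₗ g ∘ₗ π) x • i (f (Pi.single k 1)) = i (π x) := by
    intro x
    conv_rhs => rw [← e1 (π x), map_sum]
    refine Finset.sum_congr rfl fun k _ => ?_
    rw [map_smul]
    rfl
  refine ⟨c, ⟨{
    φ := fun k => LinearMap.proj k ∘ₗ g ∘ₗ π
    m := fun k => i (f (Pi.single k 1))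
    eq_sum := fun j => by rw [e2, hi]
    sub_mem := fun x => by
      rw [e2, hQ, map_sub, hi, sub_self]
      exact zero_mem _
    mem_I := fun k x hx => ?_ }⟩⟩
  rw [hQ] at hx
  have : ∀ t ∈ (I p R n • ⊤ : Submodule (TruncatedWittVector p n R) T), g t k ∈ I p R n := by
    intro t ht
    induction ht using Submodule.smul_induction_on' with
    | smul a ha y hy =>
      rw [map_smul, Pi.smul_apply, smul_eq_mul]
      exact Ideal.mul_mem_right _ _ ha
    | add x hx y hy h1 h2 => rw [map_add]; exact add_mem h1 h2
  exact this _ hx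

namespace Frame

variable {P : WeakSemidisplay hp n} {D : Type} [Fintype D] (𝔉 : Frame P D)
  {S S' : Type u} [CommRing S] [CommRing S']

/-- The projection `M → L ⊂ Q`. -/
noncomputable def projQ : P.M →ₗ[TruncatedWittVector p n R] P.Q :=
  LinearMap.codRestrict P.Q (LinearMap.id - ∑ k, (𝔉.φ k).smulRight (𝔉.m k)) fun x => by
    simpa [LinearMap.sum_apply] using 𝔉.sub_mem x

theorem coe_projQ (x : P.M) : (𝔉.projQ x : P.M) = x - ∑ k, 𝔉.φ k x • 𝔉.m k := by
  simp [projQ, LinearMap.sum_apply]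

theorem projQ_m (j : D) : 𝔉.projQ (𝔉.m j) = 0 := by
  ext
  rw [coe_projQ, ← 𝔉.eq_sum, sub_self]
  rfl

end Frame

section ver

variable {P : WeakSemidisplay hp n} {S S' : Type u} [CommRing S] [CommRing S'] {f : R →+* S}

/-- The value `V(η(w))` for `w ∈ M / J M` does not depend on a lift of `w` to `M`. -/
theorem ver_apply_eq_of_mkQ_eq (η : P.M →ₛₗ[TWitt.map (p := p) n f] TruncatedWittVector p n S)
    {z z' : P.M} (h : (J p R n • ⊤ : Submodule (TruncatedWittVector p n R) P.M).mkQ z =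
      (J p R n • ⊤ : Submodule (TruncatedWittVector p n R) P.M).mkQ z') :
    ver n (η z) = ver n (η z') := by
  rw [← sub_eq_zero, ← map_sub, ← map_sub, ver_eq_zero_iff]
  rw [← sub_eq_zero, ← map_sub, Submodule.mkQ_apply, Submodule.Quotient.mk_eq_zero] at h
  generalize z - z' = w at h
  induction h using Submodule.smul_induction_on' with
  | smul a ha y hy =>
    rw [LinearMap.map_smulₛₗ, smul_eq_mul]
    exact Ideal.mul_mem_right _ _ (map_mem_J n f ha)
  | add x hx y hy h1 h2 => rw [map_add]; exact add_mem h1 h2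

/-- The map `V ∘ η` on `M / J M`. -/
noncomputable def verApply (η : P.M →ₛₗ[TWitt.map (p := p) n f] TruncatedWittVector p n S)
    (w : P.M ⧸ (J p R n • ⊤ : Submodule (TruncatedWittVector p n R) P.M)) :
    TruncatedWittVector p n S :=
  ver n (η (Function.surjInv (Submodule.mkQ_surjective _) w))

theorem verApply_mkQ (η : P.M →ₛₗ[TWitt.map (p := p) n f] TruncatedWittVector p n S) (z : P.M) :
    verApply η ((J p R n • ⊤ : Submodule (TruncatedWittVector p n R) P.M).mkQ z) = ver n (η z) :=
  ver_apply_eq_of_mkQ_eq η (Function.surjInv_eq _ _)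

theorem verApply_add (η : P.M →ₛₗ[TWitt.map (p := p) n f] TruncatedWittVector p n S)
    (w w' : P.M ⧸ (J p R n • ⊤ : Submodule (TruncatedWittVector p n R) P.M)) :
    verApply η (w + w') = verApply η w + verApply η w' := by
  obtain ⟨z, rfl⟩ := Submodule.mkQ_surjective _ w
  obtain ⟨z', rfl⟩ := Submodule.mkQ_surjective _ w'
  rw [← map_add, verApply_mkQ, verApply_mkQ, verApply_mkQ, map_add, map_add]

theorem verApply_frobenius_smul (η : P.M →ₛₗ[TWitt.map (p := p) n f] TruncatedWittVector p n S)
    (c : TruncatedWittVector p n R)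
    (w : P.M ⧸ (J p R n • ⊤ : Submodule (TruncatedWittVector p n R) P.M)) :
    verApply η (frobenius n hp c • w) = TWitt.map n f c * verApply η w := by
  obtain ⟨z, rfl⟩ := Submodule.mkQ_surjective _ w
  rw [← map_smul, verApply_mkQ, verApply_mkQ, LinearMap.map_smulₛₗ, smul_eq_mul,
    map_frobenius n f hp (natCast_eq_zero_of_hom f hp), mul_comm, ← ver_mul, mul_comm]

end ver

namespace Frame

variable {P : WeakSemidisplay hp n} {D : Type} [Fintype D] (𝔉 : Frame P D)
  {S S' : Type u} [CommRing S] [CommRing S']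

/-- For a given `a ∈ W_n(S) ^ D`, the operator `η ↦ (x ↦ ∑ φₖ(x) aₖ + V(η(F₁(x - ∑ φₖ(x) mₖ))))`
on semilinear maps `M → W_n(S)`. -/
noncomputable def step (f : R →+* S) (a : D → TruncatedWittVector p n S)
    (η : P.M →ₛₗ[TWitt.map (p := p) n f] TruncatedWittVector p n S) :
    P.M →ₛₗ[TWitt.map (p := p) n f] TruncatedWittVector p n S where
  toFun x := ∑ k, TWitt.map n f (𝔉.φ k x) * a k + verApply η (P.F₁ (𝔉.projQ x))
  map_add' x y := by
    simp only [map_add, verApply_add, add_mul, Finset.sum_add_distrib]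
    abel
  map_smul' c x := by
    rw [map_smul, LinearMap.map_smulₛₗ P.F₁, verApply_frobenius_smul, smul_eq_mul, mul_add,
      Finset.mul_sum]
    congr 1
    refine Finset.sum_congr rfl fun k _ => ?_
    rw [map_smul, smul_eq_mul, map_mul, mul_assoc]

theorem step_apply (f : R →+* S) (a : D → TruncatedWittVector p n S)
    (η : P.M →ₛₗ[TWitt.map (p := p) n f] TruncatedWittVector p n S) (x : P.M) :
    𝔉.step f a η x =
      ∑ k, TWitt.map n f (𝔉.φ k x) * a k + verApply η (P.F₁ (𝔉.projQ x)) := rfl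

/-- The operator `step` is contracting: its `i`-th iterate depends only on the starting value
modulo `V ^ i`. -/
theorem coeff_iterate_step_sub (f : R →+* S) (a : D → TruncatedWittVector p n S)
    (η θ : P.M →ₛₗ[TWitt.map (p := p) n f] TruncatedWittVector p n S) (i : ℕ) (x : P.M) (k : Fin n)
    (hk : (k : ℕ) < i) :
    (((𝔉.step f a)^[i] η) x - ((𝔉.step f a)^[i] θ) x).coeff k = 0 := by
  induction i generalizing x k with
  | zero => omega
  | succ i ih =>
    rw [Function.iterate_succ_apply', Function.iterate_succ_apply', step_apply, step_apply,
      add_sub_add_left_eq_sub]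
    obtain ⟨z, hz⟩ := Submodule.mkQ_surjective _ (P.F₁ (𝔉.projQ x))
    rw [← hz, verApply_mkQ, verApply_mkQ, ← map_sub]
    obtain ⟨k, hkn⟩ := k
    cases k with
    | zero => rw [coeff_ver_zero]
    | succ k =>
      rw [coeff_ver_succ]
      exact ih z _ (by simpa using hk)

theorem eq_of_step_eq (f : R →+* S) (a : D → TruncatedWittVector p n S)
    {η θ : P.M →ₛₗ[TWitt.map (p := p) n f] TruncatedWittVector p n S}
    (hη : 𝔉.step f a η = η) (hθ : 𝔉.step f a θ = θ) : η = θ := by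
  ext1 x
  rw [← sub_eq_zero]
  ext k
  have := 𝔉.coeff_iterate_step_sub f a η θ n x k k.2
  rw [Function.iterate_fixed hη, Function.iterate_fixed hθ] at this
  rw [this, TruncatedWittVector.coeff_zero]

/-- The unique semilinear map `η : M → W_n(S)` such that
`η(x) = ∑ φₖ(x) aₖ + V(η(F₁(x - ∑ φₖ(x) mₖ)))`. -/
noncomputable def extend (f : R →+* S) (a : D → TruncatedWittVector p n S) :
    P.M →ₛₗ[TWitt.map (p := p) n f] TruncatedWittVector p n S :=
  (𝔉.step f a)^[n] 0

theorem step_extend (f : R →+* S) (a : D → TruncatedWittVector p n S) :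
    𝔉.step f a (𝔉.extend f a) = 𝔉.extend f a := by
  ext1 x
  rw [← sub_eq_zero, extend, ← Function.iterate_succ_apply' (𝔉.step f a),
    Function.iterate_succ_apply]
  ext k
  rw [𝔉.coeff_iterate_step_sub f a _ _ n x k k.2, TruncatedWittVector.coeff_zero]

theorem extend_apply (f : R →+* S) (a : D → TruncatedWittVector p n S) (x : P.M) :
    𝔉.extend f a x = ∑ k, TWitt.map n f (𝔉.φ k x) * a k +
      verApply (𝔉.extend f a) (P.F₁ (𝔉.projQ x)) := by
  conv_lhs => rw [← step_extend]
  rfl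

theorem extend_m (f : R →+* S) (a : D → TruncatedWittVector p n S) (j : D) :
    𝔉.extend f a (𝔉.m j) = ∑ k, TWitt.map n f (𝔉.φ k (𝔉.m j)) * a k := by
  have h0 : verApply (𝔉.extend f a) 0 = 0 := by
    rw [← map_zero (Submodule.mkQ _), verApply_mkQ, map_zero, map_zero]
  rw [extend_apply, projQ_m, map_zero, h0, add_zero]

theorem eq_extend (f : R →+* S) (a : D → TruncatedWittVector p n S)
    (η : P.M →ₛₗ[TWitt.map (p := p) n f] TruncatedWittVector p n S)
    (h : ∀ x, η x = ∑ k, TWitt.map n f (𝔉.φ k x) * a k + verApply η (P.F₁ (𝔉.projQ x))) :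
    η = 𝔉.extend f a :=
  𝔉.eq_of_step_eq f a (LinearMap.ext fun x => (h x).symm) (𝔉.step_extend f a)

theorem extend_add (f : R →+* S) (a b : D → TruncatedWittVector p n S) :
    𝔉.extend f (a + b) = 𝔉.extend f a + 𝔉.extend f b := by
  symm
  apply eq_extend
  intro x
  obtain ⟨z, hz⟩ := Submodule.mkQ_surjective _ (P.F₁ (𝔉.projQ x))
  rw [LinearMap.add_apply, extend_apply, 𝔉.extend_apply f b, ← hz, verApply_mkQ, verApply_mkQ,
    verApply_mkQ, LinearMap.add_apply, map_add]
  simp only [Pi.add_apply, mul_add, Finset.sum_add_distrib]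
  abel

theorem extend_zero (f : R →+* S) : 𝔉.extend f 0 = 0 := by
  have := 𝔉.extend_add f 0 0
  rwa [add_zero, left_eq_add] at this

theorem map_extend (f : R →+* S) (h : S →+* S') (f' : R →+* S') (hf : h.comp f = f')
    (a : D → TruncatedWittVector p n S) (x : P.M) :
    TWitt.map n h (𝔉.extend f a x) = 𝔉.extend f' (fun j => TWitt.map n h (a j)) x := by
  subst hf
  let θ : P.M →ₛₗ[TWitt.map (p := p) n (h.comp f)] TruncatedWittVector p n S' :=
    { toFun := fun x => TWitt.map n h (𝔉.extend f a x)
      map_add' := fun x y => by simp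
      map_smul' := fun c x => by simp [twitt_map_comp] }
  have : θ = 𝔉.extend (h.comp f) (fun j => TWitt.map n h (a j)) := by
    apply eq_extend
    intro x
    obtain ⟨z, hz⟩ := Submodule.mkQ_surjective _ (P.F₁ (𝔉.projQ x))
    rw [← hz, verApply_mkQ]
    change TWitt.map n h (𝔉.extend f a x) = _ + ver n (TWitt.map n h (𝔉.extend f a z))
    rw [extend_apply, ← hz, verApply_mkQ, map_add, map_ver, map_sum]
    simp only [map_mul, twitt_map_comp]
  rw [← this]
  rfl

theorem extend_mem (f : R →+* S) (a : D → TruncatedWittVector p n S)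
    (H : AddSubgroup (TruncatedWittVector p n S)) (ha : ∀ j, a j ∈ H)
    (hH : ∀ c, ∀ x ∈ H, TWitt.map n f c * x ∈ H) (hV : ∀ x ∈ H, ver n x ∈ H) (x : P.M) :
    𝔉.extend f a x ∈ H := by
  have : ∀ i x, ((𝔉.step f a)^[i] 0) x ∈ H := by
    intro i
    induction i with
    | zero => intro x; exact zero_mem _
    | succ i ih =>
      intro x
      rw [Function.iterate_succ_apply', step_apply]
      exact add_mem (sum_mem fun k _ => hH _ _ (ha k)) (hV _ (ih _))
  exact this n x

/-- The system of equations `F(aⱼ) = η(F(mⱼ))`, where `η : M → W_n(S)` is the extension of `a`. -/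
noncomputable def system : FrobSystem p n R D where
  τ f :=
    { toFun := fun a j => 𝔉.extend f a (P.F (𝔉.m j))
      map_zero' := funext fun j => by rw [extend_zero]; rfl
      map_add' := fun a b => funext fun j => by rw [extend_add]; rfl }
  map_τ f h a j := 𝔉.map_extend f h _ rfl a _
  τ_mem f a H ha hH hV j := 𝔉.extend_mem f a H ha hH hV _

/-- The group functor of `a ∈ W_n(S) ^ D` such that `F(aⱼ) = η(F(mⱼ))`, where `η : M → W_n(S)` is
the extension of `a`. If the `mⱼ` form a basis of `T`, this is the group functor of homomorphisms
to the unit object; in general the latter is a retract of it. -/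
noncomputable abbrev points (f : R →+* S) : AddSubgroup (D → TruncatedWittVector p n S) :=
  𝔉.system.points hp f

theorem mem_points {f : R →+* S} {a : D → TruncatedWittVector p n S} : a ∈ 𝔉.points f ↔
    ∀ j, frobenius n (natCast_eq_zero_of_hom f hp) (a j) = 𝔉.extend f a (P.F (𝔉.m j)) := Iff.rfl

/-- A homomorphism to the unit object is determined by its values on the `mⱼ`. -/
theorem eq_extend_apply_m (f : R →+* S) (η : homUnit P f) :
    η.1 = 𝔉.extend f fun j => η.1 (𝔉.m j) := by
  apply eq_extend
  intro x
  obtain ⟨z, hz⟩ := Submodule.mkQ_surjective _ (P.F₁ (𝔉.projQ x))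
  rw [← hz, verApply_mkQ, ← η.2.2 _ z hz, coe_projQ, map_sub, map_sum]
  simp

/-- The inclusion of the group functor of homomorphisms to the unit object into `points`. -/
noncomputable def ofHom (f : R →+* S) : homUnit P f →+ 𝔉.points f where
  toFun η := ⟨fun j => η.1 (𝔉.m j), 𝔉.mem_points.2 fun j => by
    rw [← eq_extend_apply_m, ← η.2.1]⟩
  map_zero' := rfl
  map_add' _ _ := rfl

/-- The relation `η(y) = V(η(F₁ y))`, which holds on the summand `L` by construction, holds on
`I T` because of `F₁(V(c) m) = c F(m)` and the equations `F(aⱼ) = η(F(mⱼ))`. -/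
theorem extend_apply_mem_Q (f : R →+* S) {a : D → TruncatedWittVector p n S} (ha : a ∈ 𝔉.points f)
    (y : P.Q) : 𝔉.extend f a y = verApply (𝔉.extend f a) (P.F₁ y) := by
  have hp' := natCast_eq_zero_of_hom f hp
  have ha := 𝔉.mem_points.1 ha
  choose c hc using fun k => (TWitt.mem_I n).1 (𝔉.mem_I k y y.2)
  have hy : y = 𝔉.projQ y + ∑ k, (⟨ver n (c k) • 𝔉.m k, ver_smul_mem P _ _⟩ : P.Q) := by
    ext
    rw [Submodule.coe_add, coe_projQ, Submodule.coe_sum]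
    simp only [hc, sub_add_cancel]
  conv_rhs => rw [hy]
  have hsum : ∀ (s : Finset D) (v : D → P.M ⧸ (J p R n • ⊤ :
      Submodule (TruncatedWittVector p n R) P.M)),
      verApply (𝔉.extend f a) (∑ k ∈ s, v k) = ∑ k ∈ s, verApply (𝔉.extend f a) (v k) := by
    classical
    intro s v
    induction s using Finset.induction_on with
    | empty =>
      rw [Finset.sum_empty, Finset.sum_empty, ← map_zero (Submodule.mkQ _), verApply_mkQ, map_zero,
        map_zero]
    | insert k s hk ih => rw [Finset.sum_insert hk, verApply_add, ih, Finset.sum_insert hk]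
  rw [extend_apply, map_add, verApply_add, add_comm, map_sum, hsum]
  congr 1
  refine Finset.sum_congr rfl fun k _ => ?_
  rw [P.F₁_ver_smul, ← map_smul, verApply_mkQ, LinearMap.map_smulₛₗ, ← ha k, smul_eq_mul,
    ← ver_mul n hp', ← map_ver, hc]

/-- The retraction of `points` to the group functor of homomorphisms to the unit object. -/
noncomputable def toHom (f : R →+* S) : 𝔉.points f →+ homUnit P f where
  toFun a := ⟨𝔉.extend f a.1, by
    have hp' := natCast_eq_zero_of_hom f hp
    -- on `Q` the relation `F η = η F` follows from `F V = p` and `F = p F₁`; on the `mⱼ` it is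
    -- the given system of equations
    have hQ : ∀ y : P.Q, 𝔉.extend f a.1 (P.F y) = frobenius n hp' (𝔉.extend f a.1 y) := by
      intro y
      obtain ⟨z, hz⟩ := Submodule.mkQ_surjective _ (P.F₁ y)
      rw [𝔉.extend_apply_mem_Q f a.2, ← hz, verApply_mkQ, frobenius_ver, P.F_eq_p_smul y z hz,
        LinearMap.map_smulₛₗ, map_natCast, smul_eq_mul]
    have hm : ∀ j, 𝔉.extend f a.1 (P.F (𝔉.m j)) = frobenius n hp' (𝔉.extend f a.1 (𝔉.m j)) := by
      intro j
      rw [extend_m, map_sum]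
      conv_lhs => rw [𝔉.eq_sum j, map_sum, map_sum]
      refine Finset.sum_congr rfl fun k _ => ?_
      rw [LinearMap.map_smulₛₗ, LinearMap.map_smulₛₗ, map_frobenius n f hp hp', ← 𝔉.mem_points.1 a.2 k,
        smul_eq_mul, map_mul]
    refine ⟨fun x => ?_, fun y z hz => ?_⟩
    · have hx : x = 𝔉.projQ x + ∑ k, 𝔉.φ k x • 𝔉.m k := by rw [coe_projQ, sub_add_cancel]
      conv_lhs => rw [hx]
      conv_rhs => rw [hx]
      rw [map_add, map_add, map_add, map_add, hQ]
      congr 1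
      simp only [map_sum]
      refine Finset.sum_congr rfl fun k _ => ?_
      rw [LinearMap.map_smulₛₗ, LinearMap.map_smulₛₗ, LinearMap.map_smulₛₗ, hm, smul_eq_mul,
        smul_eq_mul, map_mul, map_frobenius n f hp hp']
    · rw [𝔉.extend_apply_mem_Q f a.2, ← hz, verApply_mkQ]⟩
  map_zero' := Subtype.ext (𝔉.extend_zero f)
  map_add' a b := Subtype.ext (𝔉.extend_add f a.1 b.1)

theorem toHom_ofHom (f : R →+* S) (η : homUnit P f) : 𝔉.toHom f (𝔉.ofHom f η) = η :=
  Subtype.ext (𝔉.eq_extend_apply_m f η).symm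

theorem toHom_map (f : R →+* S) (h : S →+* S') (a : 𝔉.points f) :
    𝔉.toHom (h.comp f) (𝔉.system.map hp f h a) = homUnitMap P f h (𝔉.toHom f a) := by
  apply Subtype.ext
  ext1 x
  exact (𝔉.map_extend f h _ rfl a.1 x).symm

end Frame

end WeakSemidisplay

/-! ### Artin–Hasse bases of coordinate rings -/

namespace FrobSystem

open TWitt ArtinHasse MvPolynomial WeightedReduction

variable {p : ℕ} [Fact p.Prime] {n : ℕ} [NeZero n] {R : Type u} [CommRing R] {D : Type} [Fintype D]
  [DecidableEq D] {S S' : Type u} [CommRing S] [CommRing S'] {R' : Type u} [CommRing R']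

/-- The function `a ↦ ∏ⱼ c_{β(j)}(aⱼ)` on `W_n(S) ^ D`, where `c_t` denotes `ahCoeff t`. -/
noncomputable def basisFun (β : D → Fin (p ^ n)) (a : D → TruncatedWittVector p n S) : S :=
  ∏ j, ahCoeff (β j) (a j)

theorem map_basisFun (h : S →+* S') (β : D → Fin (p ^ n)) (a : D → TruncatedWittVector p n S) :
    h (basisFun β a) = basisFun β fun j => TWitt.map n h (a j) := by
  simp only [basisFun, map_prod, map_ahCoeff]

section universal

variable (D p n R') in
/-- The tuple of Witt vectors whose components are independent variables. -/
noncomputable def univ (j : D) : TruncatedWittVector p n (MvPolynomial (D × Fin n) R') :=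
  TruncatedWittVector.mk p fun k => X (j, k)

theorem coeff_univ (j : D) (k : Fin n) : (univ p n D R' j).coeff k = X (j, k) := rfl

variable (D n) in
/-- The `k`-th component of a Witt vector has weight `p ^ k`. -/
abbrev wt (p : ℕ) (s : D × Fin n) : ℕ := p ^ (s.2 : ℕ)

/-- The right hand sides of the equations for the `p`-th powers of the variables. -/
noncomputable def rel (𝔰 : FrobSystem p n R D) (f : R →+* R') (s : D × Fin n) :
    MvPolynomial (D × Fin n) R' :=
  (𝔰.τ (C.comp f) (univ p n D R') s.1).coeff s.2

theorem rel_mem (𝔰 : FrobSystem p n R D) (hp' : (p : R') = 0) (f : R →+* R') (s : D × Fin n) :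
    rel 𝔰 f s ∈ degLT R' (wt n D p) (p * wt n D p s) := by
  have h1 := 𝔰.τ_mem (C.comp f) (univ p n D R') (wittDegLE (wt n D p) hp' n) (fun j k => by
      have := monomial_mem_degLE (w := wt n D p) (Finsupp.single (j, k) 1) (1 : R')
      rwa [Finsupp.weight_single, one_smul] at this) (fun c x hx => by
      rw [WeakSemidisplay.twitt_map_comp]
      exact map_C_mul_mem_wittDegLE hp' _ hx) (fun x hx => ver_mem_wittDegLE hp' hx) s.1 s.2
  have h2 := (Fact.out : p.Prime).one_lt
  rw [← degLT_succ] at h1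
  refine degLT_mono ?_ h1
  have h3 : 0 < p ^ (s.2 : ℕ) := Nat.pow_pos (by omega)
  change p ^ (s.2 : ℕ) + 1 ≤ p * p ^ (s.2 : ℕ)
  nlinarith

end universal

/-- Modulo polynomials of smaller weight, the monomial with given exponents `< p` is a multiple of
the basis function whose index has these exponents as digits: the coefficients `c_{p ^ k d}` involve
the term `x_k ^ d` with a unit coefficient. -/
theorem monomial_mem (hp' : (p : R') = 0) {g : D × Fin n → MvPolynomial (D × Fin n) R'}
    (hg : ∀ s, g s ∈ degLT R' (wt n D p) (p * wt n D p s)) (d : D × Fin n →₀ ℕ)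
    (hd : ∀ s, d s < p) :
    ∃ f ∈ degLT R' (wt n D p) (Finsupp.weight (wt n D p) d), monomial d 1 - f ∈
      Submodule.span R' (Set.range fun β : D → Fin (p ^ n) => basisFun β (univ p n D R')) ⊔
        (relIdeal p g).restrictScalars R' := by
  set A := Submodule.span R' (Set.range fun β : D → Fin (p ^ n) => basisFun β (univ p n D R')) ⊔
        (relIdeal p g).restrictScalars R' with hA
  suffices h : monomial d (1 : R') ∈ degLT R' (wt n D p) (Finsupp.weight (wt n D p) d) ⊔ A by
    obtain ⟨f, hf, a, ha, h⟩ := Submodule.mem_sup.1 h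
    exact ⟨f, hf, by rw [← h, add_sub_cancel_left]; exact ha⟩
  set B := degLT R' (wt n D p) (Finsupp.weight (wt n D p) d) ⊔ A with hB
  have hpos : 0 < p := (Fact.out : p.Prime).pos
  have hweight : ∀ e : D × Fin n →₀ ℕ,
      Finsupp.weight (wt n D p) e = ∑ j, ∑ k : Fin n, p ^ (k : ℕ) * e (j, k) := by
    intro e
    rw [Finsupp.weight_apply, Finsupp.sum_fintype _ _ (by simp), Fintype.sum_prod_type]
    simp [mul_comm]
  -- the digits of `β j` are the exponents `d (j, k)`
  let β : D → Fin (p ^ n) := fun j => finFunctionFinEquiv fun k => ⟨d (j, k), hd _⟩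
  have hβ : ∀ j, (β j : ℕ) = ∑ k : Fin n, p ^ (k : ℕ) * d (j, k) := by
    intro j
    simp [β, mul_comm]
  let term : (D → Fin n →₀ ℕ) → MvPolynomial (D × Fin n) R' := fun L =>
    ∏ j, ∏ k : Fin n, if p ^ (k : ℕ) ∣ L j k then
      (coeffN p (L j k / p ^ (k : ℕ)) : MvPolynomial (D × Fin n) R') *
        X (j, k) ^ (L j k / p ^ (k : ℕ)) else 0
  have hterm : ∀ e : D × Fin n →₀ ℕ, ∀ L : D → Fin n →₀ ℕ,
      (∀ j k, L j k = p ^ (k : ℕ) * e (j, k)) →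
      term L = (∏ s, (coeffN p (e s) : R')) • monomial e 1 := by
    intro e L hL
    have h1 : ∀ (j : D) (k : Fin n), L j k / p ^ (k : ℕ) = e (j, k) := fun j k => by
      rw [hL, Nat.mul_div_cancel_left _ (Nat.pow_pos hpos)]
    have h2 : ∀ (j : D) (k : Fin n), p ^ (k : ℕ) ∣ L j k := fun j k => ⟨_, hL j k⟩
    simp only [term, h1, if_pos (h2 _ _)]
    rw [← Fintype.prod_prod_type' (f := fun (j : D) (k : Fin n) =>
      (coeffN p (e (j, k)) : MvPolynomial (D × Fin n) R') * X (j, k) ^ e (j, k)),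
      Finset.prod_mul_distrib, smul_eq_C_mul, map_prod, monomial_eq, map_one, one_mul,
      Finsupp.prod_fintype _ _ (fun i => pow_zero _)]
    simp
  have hsum : basisFun β (univ p n D R') =
      ∑ L ∈ Fintype.piFinset fun j => Finset.finsuppAntidiag Finset.univ (β j : ℕ), term L := by
    simp only [basisFun, ahCoeff_eq_sum, coeff_univ]
    rw [Finset.prod_univ_sum]
  -- the term of the expansion that gives the monomial `d`; all other terms are zero or multiples of
  -- monomials of the same weight with some exponent `≥ p`, which can be reduced to smaller weight
  let L₀ : D → Fin n →₀ ℕ := fun j => Finsupp.equivFunOnFinite.symm fun k => p ^ (k : ℕ) * d (j, k)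
  have hL₀ : ∀ j k, L₀ j k = p ^ (k : ℕ) * d (j, k) := fun j k => rfl
  have hL₀mem : L₀ ∈ Fintype.piFinset fun j => Finset.finsuppAntidiag Finset.univ (β j : ℕ) := by
    rw [Fintype.mem_piFinset]
    intro j
    rw [Finset.mem_finsuppAntidiag]
    exact ⟨(hβ j).symm, Finset.subset_univ _⟩
  have hother : ∀ L ∈ Fintype.piFinset fun j => Finset.finsuppAntidiag Finset.univ (β j : ℕ),
      L ≠ L₀ → term L ∈ B := by
    intro L hL hne
    rw [Fintype.mem_piFinset] at hL
    by_cases hdvd : ∀ j (k : Fin n), p ^ (k : ℕ) ∣ L j k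
    · choose e' he' using hdvd
      let e : D × Fin n →₀ ℕ := Finsupp.equivFunOnFinite.symm fun s => e' s.1 s.2
      have he : ∀ j k, L j k = p ^ (k : ℕ) * e (j, k) := he'
      have hLsum : ∀ j, ∑ k : Fin n, p ^ (k : ℕ) * e (j, k) = β j := by
        intro j
        rw [← (Finset.mem_finsuppAntidiag.1 (hL j)).1]
        exact Finset.sum_congr rfl fun k _ => (he j k).symm
      rw [hterm e L he]
      refine Submodule.smul_mem _ _ ?_
      by_cases hred : ∀ s, e s < p
      · exfalso
        refine hne (funext fun j => Finsupp.ext fun k => ?_)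
        rw [he, hL₀]
        congr 1
        have : (finFunctionFinEquiv fun k => (⟨e (j, k), hred _⟩ : Fin p)) = β j := by
          apply Fin.ext
          rw [← hLsum]
          simp [mul_comm]
        have := congrFun (finFunctionFinEquiv.injective this) k
        exact congrArg Fin.val this
      · push Not at hred
        obtain ⟨s, hs⟩ := hred
        obtain ⟨f, hf, hfr⟩ := exists_sub_mem_relIdeal hg e s hs
        have hw : Finsupp.weight (wt n D p) e = Finsupp.weight (wt n D p) d := by
          rw [hweight, hweight]
          exact Finset.sum_congr rfl fun j _ => (hLsum j).trans (hβ j)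
        rw [hw] at hf
        rw [← sub_add_cancel (monomial e (1 : R')) f]
        exact add_mem (Submodule.mem_sup_right (Submodule.mem_sup_right hfr))
          (Submodule.mem_sup_left hf)
    · push Not at hdvd
      obtain ⟨j, k, hjk⟩ := hdvd
      have : term L = 0 := Finset.prod_eq_zero (Finset.mem_univ j)
        (Finset.prod_eq_zero (Finset.mem_univ k) (if_neg hjk))
      rw [this]
      exact zero_mem _
  have hL₀B : term L₀ ∈ B := by
    rw [← Finset.add_sum_erase _ _ hL₀mem] at hsum
    rw [eq_sub_of_add_eq hsum.symm]
    refine sub_mem (Submodule.mem_sup_right (Submodule.mem_sup_left (Submodule.subset_span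
      ⟨β, rfl⟩))) (sum_mem fun L hL => ?_)
    exact hother L (Finset.mem_of_mem_erase hL) (Finset.ne_of_mem_erase hL)
  rw [hterm d L₀ hL₀] at hL₀B
  -- the coefficient of the monomial is inverse to `∏ (d s)!`
  have := Submodule.smul_mem _ (∏ s, ((d s).factorial : R')) hL₀B
  rw [smul_smul, ← Finset.prod_mul_distrib,
    Finset.prod_congr rfl fun s _ => factorial_mul_coeffN hp' (d s) (hd s), Finset.prod_const_one,
    one_smul] at this
  exact this

/-- Every function on the functor of solutions of a system of equations is a unique linear
combination of the basis functions: the coordinate ring is `R'[x] / (xₛ ^ p - gₛ)`, where the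
weight of `gₛ` is less than that of `xₛ ^ p`. -/
theorem existsUnique_expansion (𝔰 : FrobSystem p n R D) {hp : (p : R) = 0} (f : R →+* R')
    (u : ∀ {S : Type u} [CommRing S] (g : R' →+* S), 𝔰.points hp (g.comp f) → S)
    (hu : ∀ {S S' : Type u} [CommRing S] [CommRing S'] (g : R' →+* S) (h : S →+* S')
      (a : 𝔰.points hp (g.comp f)), u (h.comp g) (𝔰.map hp (g.comp f) h a) = h (u g a)) :
    ∃! c : (D → Fin (p ^ n)) → R', ∀ {S : Type u} [CommRing S] (g : R' →+* S)
      (a : 𝔰.points hp (g.comp f)), u g a = ∑ β, g (c β) * basisFun β a.1 := by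
  have hp' := natCast_eq_zero_of_hom f hp
  let I := relIdeal p (rel 𝔰 f)
  let A := MvPolynomial (D × Fin n) R' ⧸ I
  let π : MvPolynomial (D × Fin n) R' →+* A := Ideal.Quotient.mk I
  let κ : R' →+* A := π.comp C
  -- the universal solution
  let pt : 𝔰.points hp (κ.comp f) := ⟨fun j => TWitt.map n π (univ p n D R' j), by
    intro j
    have h1 := 𝔰.map_τ (C.comp f) π (univ p n D R') j
    rw [← RingHom.comp_assoc] at h1
    rw [← h1]
    ext k
    rw [TWitt.coeff_map, TWitt.frobenius, TWitt.coeff_map, TWitt.coeff_map, frob_apply, coeff_univ, ← map_pow]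
    exact Ideal.Quotient.eq.2 (Ideal.subset_span ⟨(j, k), rfl⟩)⟩
  have hpt : ∀ β : D → Fin (p ^ n), basisFun β pt.1 = π (basisFun β (univ p n D R')) :=
    fun β => (map_basisFun π β _).symm
  have heq : ∀ {S : Type u} [CommRing S] (g g' : R' →+* S) (a : 𝔰.points hp (g.comp f))
      (a' : 𝔰.points hp (g'.comp f)), g' = g → a'.1 = a.1 → u g' a' = u g a := by
    rintro S _ g g' a a' rfl h
    rw [Subtype.ext h]
  have hsmul : ∀ c : (D → Fin (p ^ n)) → R', ∑ β, c β • π (basisFun β (univ p n D R')) =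
      ∑ β, κ (c β) * basisFun β pt.1 := by
    intro c
    refine Finset.sum_congr rfl fun β _ => ?_
    rw [hpt]
    exact Algebra.smul_def (c β) (Ideal.Quotient.mk I (basisFun β (univ p n D R')))
  have hcard : Fintype.card (D → Fin (p ^ n)) = Fintype.card (D × Fin n → Fin p) := by
    simp only [Fintype.card_pi, Fintype.card_fin, Finset.prod_const, Finset.card_univ,
      Fintype.card_prod]
    rw [← pow_mul, mul_comm]
  obtain ⟨c, hc, hcu⟩ := existsUnique_sum_smul (Fact.out : p.Prime).pos (rel_mem 𝔰 hp' f) hcard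
    (fun β => basisFun β (univ p n D R')) (monomial_mem hp' (rel_mem 𝔰 hp' f)) (u κ pt)
  refine ⟨c, fun {S} _ g a => ?_, fun c' hc' => hcu c' ((hc' κ pt).trans (hsmul c').symm)⟩
  -- the homomorphism that takes the universal solution to `a`
  let ψ₀ : MvPolynomial (D × Fin n) R' →+* S := eval₂Hom g fun s => (a.1 s.1).coeff s.2
  have hψ₀C : ψ₀.comp C = g := RingHom.ext fun x => by simp [ψ₀]
  have hψ₀a : (fun j => TWitt.map n ψ₀ (univ p n D R' j)) = a.1 := by
    ext j k
    rw [TWitt.coeff_map, coeff_univ]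
    simp [ψ₀]
  have hker : ∀ x ∈ I, ψ₀ x = 0 := by
    intro x hx
    have hle : I ≤ RingHom.ker ψ₀ := by
      refine Ideal.span_le.2 ?_
      rintro _ ⟨⟨j, k⟩, rfl⟩
      have h1 := 𝔰.map_τ (C.comp f) ψ₀ (univ p n D R') j
      rw [← RingHom.comp_assoc, hψ₀C, hψ₀a, ← a.2 j] at h1
      have h2 := congrArg (fun z => z.coeff k) h1
      simp only [TWitt.frobenius, TWitt.coeff_map, frob_apply] at h2
      change ψ₀ (X (j, k) ^ p - rel 𝔰 f (j, k)) = 0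
      rw [map_sub, map_pow, rel, h2, sub_eq_zero]
      congr 1
      simp [ψ₀]
    exact hle hx
  let ψ : A →+* S := Ideal.Quotient.lift I ψ₀ hker
  have hψ : ψ.comp π = ψ₀ := RingHom.ext fun x => Ideal.Quotient.lift_mk I ψ₀ hker
  have hψκ : ψ.comp κ = g := by rw [← hψ₀C, ← hψ]; rfl
  have hψpt : (𝔰.map hp (κ.comp f) ψ pt).1 = a.1 := by
    rw [← hψ₀a, ← hψ]
    ext j : 1
    exact (WeakSemidisplay.twitt_map_comp _ _ _).symm
  rw [← heq g (ψ.comp κ) a (𝔰.map hp (κ.comp f) ψ pt) hψκ hψpt, hu, hc]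
  refine (congrArg ψ (hsmul c)).trans ?_
  rw [map_sum]
  refine Finset.sum_congr rfl fun β _ => ?_
  rw [map_mul, map_basisFun, ← hψpt, ← hψκ]
  rfl

end FrobSystem

/-! ### Additive, multiplicative and poly-additive functions -/

namespace FrobSystem

open TWitt ArtinHasse

variable {p : ℕ} [Fact p.Prime] {n : ℕ} [NeZero n] {R : Type u} [CommRing R]
  {R' : Type u} [CommRing R'] {S S' : Type u} [CommRing S] [CommRing S']

instance : NeZero (p ^ n) := ⟨pow_ne_zero _ (Fact.out : p.Prime).ne_zero⟩

variable (p n) in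
theorem val_one : ((1 : Fin (p ^ n)) : ℕ) = 1 := by
  rw [Fin.val_one', Nat.mod_eq_of_lt (Nat.one_lt_pow (NeZero.ne n) (Fact.out : p.Prime).one_lt)]

section single

variable {D : Type} [Fintype D] [DecidableEq D]

theorem basisFun_index_zero (a : D → TruncatedWittVector p n S) : basisFun 0 a = 1 :=
  Finset.prod_eq_one fun j _ => by rw [Pi.zero_apply, Fin.val_zero, ahCoeff_index_zero]

theorem basisFun_zero {β : D → Fin (p ^ n)} (hβ : β ≠ 0) :
    basisFun β (0 : D → TruncatedWittVector p n S) = 0 := by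
  obtain ⟨j, hj⟩ := Function.ne_iff.1 hβ
  refine Finset.prod_eq_zero (Finset.mem_univ j) ?_
  rw [Pi.zero_apply, ahCoeff_zero]
  intro h
  exact hj (Fin.ext h)

theorem basisFun_single (hp : (p : S) = 0) (j : D) (a : D → TruncatedWittVector p n S) :
    basisFun (Pi.single j 1) a = (a j).coeff 0 := by
  rw [basisFun, Finset.prod_eq_single j, Pi.single_eq_same, val_one, ahCoeff_one hp]
  · intro k _ hk
    rw [Pi.single_eq_of_ne hk, Fin.val_zero, ahCoeff_index_zero]
  · simp

/-- The basis functions behave like divided powers under addition. -/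
theorem basisFun_add (hp : (p : S) = 0) (β : D → Fin (p ^ n))
    (a b : D → TruncatedWittVector p n S) :
    basisFun β (a + b) = ∑ δ : D → Fin (p ^ n), ∑ ε : D → Fin (p ^ n),
      if ∀ j, (δ j + ε j : ℕ) = β j then basisFun δ a * basisFun ε b else 0 := by
  have h1 : ∀ j, ahCoeff (β j) ((a + b) j) = ∑ st : Fin (p ^ n) × Fin (p ^ n),
      if (st.1 + st.2 : ℕ) = β j then ahCoeff st.1 (a j) * ahCoeff st.2 (b j) else 0 := by
    intro j
    rw [Pi.add_apply, ahCoeff_add hp _ _ (β j).2, ← Finset.sum_filter]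
    symm
    refine Finset.sum_bij (fun st _ => ((st.1 : ℕ), (st.2 : ℕ))) ?_ ?_ ?_ ?_
    · intro st hst
      exact Finset.HasAntidiagonal.mem_antidiagonal.2 (Finset.mem_filter.1 hst).2
    · intro st _ st' _ h
      exact Prod.ext (Fin.ext (congrArg Prod.fst h)) (Fin.ext (congrArg Prod.snd h))
    · intro st hst
      have h := Finset.HasAntidiagonal.mem_antidiagonal.1 hst
      have h2 := (β j).2
      exact ⟨(⟨st.1, by omega⟩, ⟨st.2, by omega⟩), by simpa using h, rfl⟩
    · intro st _
      rfl
  have h2 : basisFun β (a + b) = ∏ j, ∑ st : Fin (p ^ n) × Fin (p ^ n),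
      if (st.1 + st.2 : ℕ) = β j then ahCoeff st.1 (a j) * ahCoeff st.2 (b j) else 0 :=
    Finset.prod_congr rfl fun j _ => h1 j
  rw [h2, Finset.prod_univ_sum, Fintype.piFinset_univ, ← Fintype.sum_prod_type',
    ← (Equiv.arrowProdEquivProdArrow D (fun _ => Fin (p ^ n)) fun _ => Fin (p ^ n)).sum_comp]
  refine Finset.sum_congr rfl fun x _ => ?_
  rw [Fintype.prod_ite_zero, Finset.prod_mul_distrib]
  rfl

variable (𝔰 : FrobSystem p n R D) (hp : (p : R) = 0)

include hp in
theorem eq_of_expansion_eq (f : R →+* R') {c c' : (D → Fin (p ^ n)) → R'}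
    (h : ∀ {S : Type u} [CommRing S] (g : R' →+* S) (a : 𝔰.points hp (g.comp f)),
      ∑ β, g (c β) * basisFun β a.1 = ∑ β, g (c' β) * basisFun β a.1) : c = c' := by
  refine (𝔰.existsUnique_expansion f (fun g a => ∑ β, g (c β) * basisFun β a.1) ?_).unique
    (fun g a => rfl) fun g a => h g a
  intro S S' _ _ g h a
  rw [map_sum]
  refine Finset.sum_congr rfl fun β _ => ?_
  rw [map_mul, map_basisFun]
  rfl

/-- The coefficients of the function `(a, b) ↦ u(a + b)`, where `c` are the coefficients of `u`. -/
def comul (c : (D → Fin (p ^ n)) → R') (δ ε : D → Fin (p ^ n)) : R' :=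
  ∑ β : D → Fin (p ^ n), if ∀ j, (δ j + ε j : ℕ) = β j then c β else 0

theorem comul_of_eq (c : (D → Fin (p ^ n)) → R') {δ ε β : D → Fin (p ^ n)}
    (h : ∀ j, (δ j + ε j : ℕ) = β j) : comul c δ ε = c β := by
  rw [comul, Finset.sum_eq_single β, if_pos h]
  · intro β' _ hne
    refine if_neg fun h' => hne (funext fun j => Fin.ext ?_)
    rw [← h, ← h']
  · simp

theorem comul_of_forall_ne (c : (D → Fin (p ^ n)) → R') {δ ε : D → Fin (p ^ n)}
    (h : ∀ β : D → Fin (p ^ n), ¬ ∀ j, (δ j + ε j : ℕ) = β j) : comul c δ ε = 0 :=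
  Finset.sum_eq_zero fun β _ => if_neg (h β)

theorem sum_mul_basisFun_add (hp : (p : S) = 0) (g : R' →+* S) (c : (D → Fin (p ^ n)) → R')
    (a b : D → TruncatedWittVector p n S) : ∑ β, g (c β) * basisFun β (a + b) =
      ∑ δ, (∑ ε, g (comul c δ ε) * basisFun ε b) * basisFun δ a := by
  simp only [basisFun_add hp, Finset.mul_sum, Finset.sum_mul, comul, map_sum]
  rw [Finset.sum_comm]
  refine Finset.sum_congr rfl fun δ _ => ?_
  rw [Finset.sum_comm]
  refine Finset.sum_congr rfl fun ε _ => Finset.sum_congr rfl fun β _ => ?_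
  split_ifs
  · ring
  · simp

include hp in
/-- The coefficients of `u(a + b)` as a function of `a` and `b` are determined by uniqueness of
expansions in `a`, over the ring where `b` is defined, and then in `b`. -/
theorem comul_eq (f : R →+* R') {c : (D → Fin (p ^ n)) → R'}
    {d : (D → Fin (p ^ n)) → (D → Fin (p ^ n)) → R'}
    (h : ∀ {S : Type u} [CommRing S] (g : R' →+* S) (a b : 𝔰.points hp (g.comp f)),
      ∑ β, g (c β) * basisFun β (a.1 + b.1) =
        ∑ δ, (∑ ε, g (d δ ε) * basisFun ε b.1) * basisFun δ a.1) : comul c = d := by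
  funext δ
  refine 𝔰.eq_of_expansion_eq hp f fun {S} _ g b => ?_
  refine congrFun (𝔰.eq_of_expansion_eq hp (g.comp f)
    (c := fun δ => ∑ ε, g (comul c δ ε) * basisFun ε b.1)
    (c' := fun δ => ∑ ε, g (d δ ε) * basisFun ε b.1) fun {S'} _ h' a => ?_) δ
  have h1 := h (h'.comp g) a (𝔰.map hp (g.comp f) h' b)
  rw [sum_mul_basisFun_add (natCast_eq_zero_of_hom ((h'.comp g).comp f) hp)] at h1
  simp only [map_sum, map_mul, map_basisFun]
  exact h1

variable {hp}

/-- A function `u` with `u(a + b) = u(a) + u(b)` is a linear combination of the functions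
`a ↦ (aⱼ)₀`. -/
theorem coeff_eq_zero_of_additive (f : R →+* R') {c : (D → Fin (p ^ n)) → R'}
    (h : ∀ {S : Type u} [CommRing S] (g : R' →+* S) (a b : 𝔰.points hp (g.comp f)),
      ∑ β, g (c β) * basisFun β (a.1 + b.1) =
        ∑ β, g (c β) * basisFun β a.1 + ∑ β, g (c β) * basisFun β b.1)
    (β : D → Fin (p ^ n)) (hβ : ∀ j, β ≠ Pi.single j 1) : c β = 0 := by
  have key := 𝔰.comul_eq hp f (c := c)
    (d := fun δ ε => (if ε = 0 then c δ else 0) + if δ = 0 then c ε else 0) (by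
      intro S _ g a b
      rw [h]
      simp only [map_add, add_mul, Finset.sum_add_distrib]
      congr 1
      · refine Finset.sum_congr rfl fun δ _ => ?_
        congr 1
        rw [Finset.sum_eq_single 0, if_pos rfl, basisFun_index_zero, mul_one]
        · intro ε _ hε
          rw [if_neg hε, map_zero, zero_mul]
        · simp
      · symm
        rw [Finset.sum_eq_single 0, basisFun_index_zero, mul_one]
        · simp
        · intro δ _ hδ
          simp [hδ]
        · simp)
  by_cases h0 : β = 0
  · subst h0
    have h1 := congrFun (congrFun key 0) 0
    rw [comul_of_eq c (β := 0) (fun j => by simp)] at h1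
    simpa using h1
  · obtain ⟨j, hj⟩ := Function.ne_iff.1 h0
    have hj : (β j : ℕ) ≠ 0 := fun h => hj (Fin.ext h)
    have hjlt := (β j).2
    -- `β = δ + ε` with `δ = Pi.single j 1` and `ε` both nonzero
    let ε : D → Fin (p ^ n) := Function.update β j ⟨β j - 1, by omega⟩
    have hε : ∀ k, ((Pi.single j 1 : D → Fin (p ^ n)) k + ε k : ℕ) = β k := by
      intro k
      by_cases hk : k = j
      · subst hk
        rw [Pi.single_eq_same, val_one]
        simp only [ε, Function.update_self]
        omega
      · simp [ε, hk]
    have hs0 : (Pi.single j 1 : D → Fin (p ^ n)) ≠ 0 := by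
      intro h
      have := congrArg Fin.val (congrFun h j)
      rw [Pi.single_eq_same, val_one] at this
      simp at this
    have hε0 : ε ≠ 0 := by
      intro h
      refine hβ j (funext fun k => Fin.ext ?_)
      rw [← hε k, h]
      simp
    have h1 := congrFun (congrFun key (Pi.single j 1)) ε
    rw [comul_of_eq c hε] at h1
    simpa [hs0, hε0] using h1

/-- The non-constant coefficients of a function `u` with `u(a + b) = u(a) u(b)` are killed by the
`p ^ n`-power map: `c_δ c_ε = c_{δ + ε}` holds if the right hand side makes sense, and otherwise
the left hand side is zero. -/
theorem coeff_pow_eq_zero_of_multiplicative (f : R →+* R') {c : (D → Fin (p ^ n)) → R'}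
    (h : ∀ {S : Type u} [CommRing S] (g : R' →+* S) (a b : 𝔰.points hp (g.comp f)),
      ∑ β, g (c β) * basisFun β (a.1 + b.1) =
        (∑ β, g (c β) * basisFun β a.1) * ∑ β, g (c β) * basisFun β b.1)
    (β : D → Fin (p ^ n)) (hβ : β ≠ 0) : c β ^ p ^ n = 0 := by
  have key := 𝔰.comul_eq hp f (c := c) (d := fun δ ε => c δ * c ε) (by
      intro S _ g a b
      rw [h, Finset.sum_mul]
      refine Finset.sum_congr rfl fun δ _ => ?_
      rw [Finset.mul_sum, Finset.sum_mul]
      refine Finset.sum_congr rfl fun ε _ => ?_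
      rw [map_mul]
      ring)
  have hmul : ∀ δ ε, c δ * c ε = 0 ∨ ∃ γ : D → Fin (p ^ n),
      (∀ j, (γ j : ℕ) = δ j + ε j) ∧ c δ * c ε = c γ := by
    intro δ ε
    have hk : comul c δ ε = c δ * c ε := congrFun (congrFun key δ) ε
    by_cases hγ : ∃ γ : D → Fin (p ^ n), ∀ j, (δ j + ε j : ℕ) = γ j
    · obtain ⟨γ, hγ⟩ := hγ
      exact Or.inr ⟨γ, fun j => (hγ j).symm, by rw [← hk, comul_of_eq c hγ]⟩
    · left
      rw [← hk, comul_of_forall_ne c fun γ hγ' => hγ ⟨γ, hγ'⟩]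
  have hpow : ∀ k, c β ^ (k + 1) = 0 ∨ ∃ γ : D → Fin (p ^ n),
      (∀ j, (γ j : ℕ) = (k + 1) * β j) ∧ c β ^ (k + 1) = c γ := by
    intro k
    induction k with
    | zero => exact Or.inr ⟨β, by simp⟩
    | succ k ih =>
      rcases ih with h0 | ⟨γ, hγ, h1⟩
      · left
        rw [pow_succ, h0, zero_mul]
      · rw [pow_succ, h1]
        rcases hmul γ β with h0 | ⟨γ', hγ', h2⟩
        · exact Or.inl h0
        · exact Or.inr ⟨γ', fun j => by rw [hγ', hγ]; ring, h2⟩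
  have hq : p ^ n - 1 + 1 = p ^ n :=
    Nat.sub_add_cancel (Nat.pow_pos (Fact.out : p.Prime).pos)
  rcases hpow (p ^ n - 1) with h0 | ⟨γ, hγ, -⟩
  · rwa [hq] at h0
  · exfalso
    obtain ⟨j, hj⟩ := Function.ne_iff.1 hβ
    have hj : (β j : ℕ) ≠ 0 := fun h => hj (Fin.ext h)
    have h1 := hγ j
    rw [hq] at h1
    have h2 := (γ j).2
    rw [h1] at h2
    exact absurd (Nat.le_mul_of_pos_right (p ^ n) (Nat.pos_of_ne_zero hj)) (not_le.2 h2)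

end single

section product

variable {ι : Type} {D : ι → Type}

/-- The product of a family of systems of equations. -/
noncomputable def pi (𝔰 : ∀ i, FrobSystem p n R (D i)) : FrobSystem p n R (Σ i, D i) where
  τ f :=
    { toFun := fun a j => (𝔰 j.1).τ f (fun k => a ⟨j.1, k⟩) j.2
      map_zero' := funext fun j => congrFun ((𝔰 j.1).τ f).map_zero j.2
      map_add' := fun _ _ => funext fun j => congrFun (((𝔰 j.1).τ f).map_add _ _) j.2 }
  map_τ f h _ j := (𝔰 j.1).map_τ f h _ _
  τ_mem f _ H ha hH hV j := (𝔰 j.1).τ_mem f _ H (fun k => ha ⟨j.1, k⟩) hH hV j.2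

variable [Fintype ι] [DecidableEq ι] [∀ i, Fintype (D i)] [∀ i, DecidableEq (D i)]
  (𝔰 : ∀ i, FrobSystem p n R (D i)) (hp : (p : R) = 0)

/-- Every function on a product of functors of solutions is a unique linear combination of products
of basis functions. -/
theorem existsUnique_expansion_pi (f : R →+* R')
    (u : ∀ {S : Type u} [CommRing S] (g : R' →+* S), (∀ i, (𝔰 i).points hp (g.comp f)) → S)
    (hu : ∀ {S S' : Type u} [CommRing S] [CommRing S'] (g : R' →+* S) (h : S →+* S')
      (x : ∀ i, (𝔰 i).points hp (g.comp f)),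
      u (h.comp g) (fun i => (𝔰 i).map hp (g.comp f) h (x i)) = h (u g x)) :
    ∃! c : (∀ i, D i → Fin (p ^ n)) → R', ∀ {S : Type u} [CommRing S] (g : R' →+* S)
      (x : ∀ i, (𝔰 i).points hp (g.comp f)),
      u g x = ∑ β, g (c β) * ∏ i, basisFun (β i) (x i).1 := by
  have E := (pi 𝔰).existsUnique_expansion (hp := hp) f
    (fun g a => u g fun i => ⟨fun j => a.1 ⟨i, j⟩, fun j => a.2 ⟨i, j⟩⟩) fun g h a =>
      hu g h fun i => ⟨fun j => a.1 ⟨i, j⟩, fun j => a.2 ⟨i, j⟩⟩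
  have e : ∀ {S : Type u} [CommRing S] (g : R' →+* S) (c : (∀ i, D i → Fin (p ^ n)) → R')
      (a : (Σ i, D i) → TruncatedWittVector p n S),
      ∑ β : (Σ i, D i) → Fin (p ^ n), g (c fun i j => β ⟨i, j⟩) * basisFun β a =
        ∑ β, g (c β) * ∏ i, basisFun (β i) fun j => a ⟨i, j⟩ := by
    intro S _ g c a
    rw [← (Equiv.piCurry fun (i : ι) (_ : D i) => Fin (p ^ n)).sum_comp]
    refine Finset.sum_congr rfl fun β _ => ?_
    rw [basisFun, Fintype.prod_sigma]
    rfl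
  obtain ⟨c, hc, hcu⟩ := E
  refine ⟨fun β => c fun j => β j.1 j.2, fun g x => ?_, fun c' hc' => ?_⟩
  · exact (hc g ⟨fun j => (x j.1).1 j.2, fun j => (x j.1).2 j.2⟩).trans
      (e g (fun β => c fun j => β j.1 j.2) _)
  · have := hcu (fun β => c' fun i j => β ⟨i, j⟩) fun g a => (hc' g _).trans (e g c' a.1).symm
    rw [← this]

theorem natural_sum_pi (c : (∀ i, D i → Fin (p ^ n)) → R') (f : R →+* R') (g : R' →+* S)
    (h : S →+* S') (x : ∀ i, (𝔰 i).points hp (g.comp f)) :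
    ∑ β, (h.comp g) (c β) * ∏ i, basisFun (β i) ((𝔰 i).map hp (g.comp f) h (x i)).1 =
      h (∑ β, g (c β) * ∏ i, basisFun (β i) (x i).1) := by
  rw [map_sum]
  refine Finset.sum_congr rfl fun β _ => ?_
  rw [map_mul, map_prod]
  simp only [map_basisFun]
  rfl

include hp in
theorem eq_of_expansion_pi_eq (f : R →+* R') {c c' : (∀ i, D i → Fin (p ^ n)) → R'}
    (h : ∀ {S : Type u} [CommRing S] (g : R' →+* S) (x : ∀ i, (𝔰 i).points hp (g.comp f)),
      ∑ β, g (c β) * ∏ i, basisFun (β i) (x i).1 = ∑ β, g (c' β) * ∏ i, basisFun (β i) (x i).1) :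
    c = c' :=
  (existsUnique_expansion_pi 𝔰 hp f (fun g x => ∑ β, g (c β) * ∏ i, basisFun (β i) (x i).1)
    fun g h x => natural_sum_pi 𝔰 hp c f g h x).unique (fun _ _ => rfl) fun g a => h g a

/-- A poly-additive function is a linear combination of the functions `x ↦ ∏ᵢ (x_{i,jᵢ})₀`. -/
theorem coeff_eq_zero_of_polyAdditive (f : R →+* R') {c : (∀ i, D i → Fin (p ^ n)) → R'}
    (h : ∀ {S : Type u} [CommRing S] (g : R' →+* S) (x : ∀ i, (𝔰 i).points hp (g.comp f)) (i : ι)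
      (a b : (𝔰 i).points hp (g.comp f)),
      ∑ β, g (c β) * ∏ k, basisFun (β k) (Function.update x i (a + b) k).1 =
        ∑ β, g (c β) * ∏ k, basisFun (β k) (Function.update x i a k).1 +
          ∑ β, g (c β) * ∏ k, basisFun (β k) (Function.update x i b k).1)
    (β : ∀ i, D i → Fin (p ^ n)) (i : ι) (hβ : ∀ j, β i ≠ Pi.single j 1) : c β = 0 := by
  -- the coefficients of the given function as a function of the `i`-th variable only
  let d : ∀ {S : Type u} [CommRing S] (g : R' →+* S) (x : ∀ i, (𝔰 i).points hp (g.comp f)),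
      (D i → Fin (p ^ n)) → S := fun g x γ =>
    ∑ β ∈ Finset.univ.filter (fun β : ∀ i, D i → Fin (p ^ n) => β i = γ),
      g (c β) * ∏ k ∈ Finset.univ.erase i, basisFun (β k) (x k).1
  have hd : ∀ {S : Type u} [CommRing S] (g : R' →+* S) (x : ∀ i, (𝔰 i).points hp (g.comp f))
      (a : (𝔰 i).points hp (g.comp f)),
      ∑ β, g (c β) * ∏ k, basisFun (β k) (Function.update x i a k).1 =
        ∑ γ, d g x γ * basisFun γ a.1 := by
    intro S _ g x a
    rw [← Finset.sum_fiberwise _ (fun β : ∀ i, D i → Fin (p ^ n) => β i)]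
    refine Finset.sum_congr rfl fun γ _ => ?_
    rw [Finset.sum_mul]
    refine Finset.sum_congr rfl fun β hβ => ?_
    rw [← Finset.mul_prod_erase _ _ (Finset.mem_univ i), Function.update_self,
      (Finset.mem_filter.1 hβ).2, mul_assoc, mul_comm (basisFun γ a.1)]
    congr 2
    refine Finset.prod_congr rfl fun k hk => ?_
    rw [Function.update_of_ne (Finset.ne_of_mem_erase hk)]
  have hdnat : ∀ {S S' : Type u} [CommRing S] [CommRing S'] (g : R' →+* S) (h : S →+* S')
      (x : ∀ i, (𝔰 i).points hp (g.comp f)) (γ : D i → Fin (p ^ n)),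
      h (d g x γ) = d (h.comp g) (fun i => (𝔰 i).map hp (g.comp f) h (x i)) γ := by
    intro S S' _ _ g h x γ
    simp only [d, map_sum, map_mul, map_prod, map_basisFun]
    rfl
  have key : ∀ {S : Type u} [CommRing S] (g : R' →+* S) (x : ∀ i, (𝔰 i).points hp (g.comp f)),
      d g x (β i) = 0 := by
    intro S _ g x
    refine (𝔰 i).coeff_eq_zero_of_additive (hp := hp) (g.comp f) (c := d g x) ?_ (β i) hβ
    intro S' _ h' a b
    have := h (h'.comp g) (fun i => (𝔰 i).map hp (g.comp f) h' (x i)) i a b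
    rw [hd, hd, hd] at this
    simp only [hdnat]
    exact this
  have := eq_of_expansion_pi_eq 𝔰 hp f (c := fun β' => if β' i = β i then c β' else 0)
    (c' := fun _ => 0) (by
      intro S _ g x
      have h1 : ∑ β', g (if β' i = β i then c β' else 0) * ∏ k, basisFun (β' k) (x k).1 =
          d g x (β i) * basisFun (β i) (x i).1 := by
        rw [Finset.sum_mul, Finset.sum_filter]
        refine Finset.sum_congr rfl fun β' _ => ?_
        split_ifs with h2
        · rw [← Finset.mul_prod_erase _ _ (Finset.mem_univ i), h2]
          ring
        · simp
      rw [h1, key]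
      simp)
  have := congrFun this β
  simpa using this

/-- The index of the function `x ↦ ∏ᵢ (x_{i,jᵢ})₀`. -/
def unitIdx (p n : ℕ) [NeZero (p ^ n)] (j : ∀ i, D i) (i : ι) : D i → Fin (p ^ n) :=
  Pi.single (j i) 1

theorem unitIdx_injective :
    Function.Injective (unitIdx p n : (∀ i, D i) → ∀ i, D i → Fin (p ^ n)) := by
  intro j k h
  funext i
  by_contra hne
  have := congrArg Fin.val (congrFun (congrFun h i) (j i))
  rw [unitIdx, unitIdx, Pi.single_eq_same, Pi.single_eq_of_ne hne, val_one] at this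
  simp at this

theorem sum_eq_sum_unitIdx (hp : (p : S) = 0) (c : (∀ i, D i → Fin (p ^ n)) → S)
    (hc : ∀ β, ∀ i, (∀ j, β i ≠ Pi.single j 1) → c β = 0)
    (x : ∀ i, D i → TruncatedWittVector p n S) :
    ∑ β, c β * ∏ i, basisFun (β i) (x i) =
      ∑ j, c (unitIdx p n j) * ∏ i, (x i (j i)).coeff 0 := by
  symm
  refine Finset.sum_of_injOn (unitIdx p n) unitIdx_injective.injOn (fun _ _ => by simp) ?_ ?_
  · intro β _ hβ
    by_cases h : ∀ i, ∃ j, β i = Pi.single j 1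
    · choose j hj using h
      exact absurd ⟨j, by simp, (funext hj).symm⟩ hβ
    · push Not at h
      obtain ⟨i, hi⟩ := h
      rw [hc β i hi, zero_mul]
  · intro j _
    congr 1
    exact Finset.prod_congr rfl fun i _ => (basisFun_single hp _ _).symm

include hp in
theorem eq_zero_of_sum_coeff_zero_eq_zero (f : R →+* R') {c : (∀ i, D i) → R'}
    (h : ∀ {S : Type u} [CommRing S] (g : R' →+* S) (x : ∀ i, (𝔰 i).points hp (g.comp f)),
      ∑ j, g (c j) * ∏ i, ((x i).1 (j i)).coeff 0 = 0) (j : ∀ i, D i) : c j = 0 := by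
  have key := eq_of_expansion_pi_eq 𝔰 hp f (c := Function.extend (unitIdx p n) c 0)
    (c' := fun _ => 0) (by
      intro S _ g x
      rw [sum_eq_sum_unitIdx (natCast_eq_zero_of_hom (g.comp f) hp)
        (fun β => g (Function.extend (unitIdx p n) c 0 β))]
      · simp only [unitIdx_injective.extend_apply, h]
        simp
      · intro β i hi
        rw [Function.extend_apply', Pi.zero_apply, map_zero]
        rintro ⟨j, rfl⟩
        exact hi (j i) rfl)
  have := congrFun key (unitIdx p n j)
  rwa [unitIdx_injective.extend_apply] at this

end product

end FrobSystem

/-! ### Tensor products of frames -/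

namespace TWitt

variable {p : ℕ} [Fact p.Prime] {S : Type u} [CommRing S] {n : ℕ} [NeZero n]

theorem frob_pow_apply (hp : (p : S) = 0) (n : ℕ) (x : S) : (frob hp ^ n) x = x ^ p ^ n := by
  induction n generalizing x with
  | zero => simp
  | succ n ih => rw [pow_succ, RingHom.mul_def, RingHom.comp_apply, ih, frob_apply, ← pow_mul,
      ← pow_succ']

variable (p S n) in
/-- The ring homomorphism `W_n(S) → S` that sends a Witt vector to its zeroth component. -/
noncomputable def coeffZero : TruncatedWittVector p n S →+* S where
  toFun x := x.coeff 0
  map_one' := by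
    rw [← map_one (WittVector.truncate n), WittVector.coeff_truncate]
    simp
  map_mul' x y := by
    obtain ⟨x, rfl⟩ := WittVector.truncate_surjective p n S x
    obtain ⟨y, rfl⟩ := WittVector.truncate_surjective p n S y
    rw [← _root_.map_mul]
    simp only [WittVector.coeff_truncate, Fin.val_zero, WittVector.mul_coeff_zero]
  map_zero' := by simp
  map_add' x y := by
    obtain ⟨x, rfl⟩ := WittVector.truncate_surjective p n S x
    obtain ⟨y, rfl⟩ := WittVector.truncate_surjective p n S y
    rw [← _root_.map_add]
    simp only [WittVector.coeff_truncate, Fin.val_zero, WittVector.add_coeff_zero]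

theorem coeffZero_apply (x : TruncatedWittVector p n S) : coeffZero p S n x = x.coeff 0 := rfl

theorem coeffZero_map {S' : Type u} [CommRing S'] (f : S →+* S') (x : TruncatedWittVector p n S) :
    coeffZero p S' n (map n f x) = f (coeffZero p S n x) := coeff_map n f x 0

end TWitt

namespace WeakSemidisplay

open TWitt FrobSystem

variable {p : ℕ} [Fact p.Prime] {R : Type u} [CommRing R] {hp : (p : R) = 0} {n : ℕ} [NeZero n]
  {S S' : Type u} [CommRing S] [CommRing S'] {R' R'' : Type u} [CommRing R'] [CommRing R'']

section tensor

variable {ι : Type} [Fintype ι] [DecidableEq ι] [Nonempty ι] {P : ι → WeakSemidisplay hp n}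
  {D : ι → Type} [∀ i, Fintype (D i)]

namespace Frame

/-- The linear form `⊗ xᵢ ↦ ∏ φ_{i,kᵢ}(xᵢ)`. -/
noncomputable def tensorφ (𝔉 : ∀ i, Frame (P i) (D i)) (k : ∀ i, D i) :
    TensorM P →ₗ[TruncatedWittVector p n R] TruncatedWittVector p n R :=
  PiSemi.lift (MultilinearMap.mkPiAlgebra _ ι _) fun i => (𝔉 i).φ (k i)

/-- The element `⊗ m_{i,kᵢ}`. -/
noncomputable def tensorm (𝔉 : ∀ i, Frame (P i) (D i)) (k : ∀ i, D i) : TensorM P :=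
  PiTensorProduct.tprod _ fun i => (𝔉 i).m (k i)

theorem tensorφ_tprod (𝔉 : ∀ i, Frame (P i) (D i)) (k : ∀ i, D i) (x : ∀ i, (P i).M) :
    tensorφ 𝔉 k (PiTensorProduct.tprod _ x) = ∏ i, (𝔉 i).φ (k i) (x i) := by
  simp [tensorφ]

theorem sum_tensorφ_smul_tensorm (𝔉 : ∀ i, Frame (P i) (D i)) (x : ∀ i, (P i).M) :
    ∑ k, tensorφ 𝔉 k (PiTensorProduct.tprod _ x) • tensorm 𝔉 k =
      PiTensorProduct.tprod _ fun i => ∑ k, (𝔉 i).φ k (x i) • (𝔉 i).m k := by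
  rw [MultilinearMap.map_sum]
  refine Finset.sum_congr rfl fun k _ => ?_
  rw [MultilinearMap.map_smul_univ, tensorφ_tprod, tensorm]

theorem sub_mem_tensorQ (𝔉 : ∀ i, Frame (P i) (D i)) (x : TensorM P) :
    x - ∑ k, tensorφ 𝔉 k x • tensorm 𝔉 k ∈ tensorQ P := by
  let L : TensorM P →ₗ[TruncatedWittVector p n R] TensorM P :=
    LinearMap.id - ∑ k, (tensorφ 𝔉 k).smulRight (tensorm 𝔉 k)
  have hL : ∀ x, L x = x - ∑ k, tensorφ 𝔉 k x • tensorm 𝔉 k := fun x => by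
    simp [L, LinearMap.sum_apply]
  rw [← hL]
  induction x using PiTensorProduct.induction_on with
  | smul_tprod r x =>
    rw [map_smul, hL, sum_tensorφ_smul_tensorm]
    exact Submodule.smul_mem _ _ (PiSemi.tprod_sub_mem (fun i => (P i).Q) _
      (tprod_mem_tensorQ P) _ _ fun i => (𝔉 i).sub_mem (x i))
  | add x y hx hy =>
    rw [map_add]
    exact add_mem hx hy

theorem tensorφ_mem_I (𝔉 : ∀ i, Frame (P i) (D i)) (k : ∀ i, D i) (z : TensorM P)
    (hz : z ∈ tensorQ P) : tensorφ 𝔉 k z ∈ I p R n := by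
  rw [tensorQ, PiSemi.ker_map_mkQ] at hz
  induction hz using Submodule.span_induction with
  | mem z hz =>
    obtain ⟨x, j, hj, rfl⟩ := hz
    rw [tensorφ_tprod]
    exact Ideal.prod_mem _ (Finset.mem_univ j) ((𝔉 j).mem_I _ _ hj)
  | zero => rw [map_zero]; exact zero_mem _
  | add x y _ _ h1 h2 => rw [map_add]; exact add_mem h1 h2
  | smul a x _ h => rw [map_smul]; exact Ideal.mul_mem_left _ _ h

/-- The tensor product of frames. -/
noncomputable def tensor (𝔉 : ∀ i, Frame (P i) (D i)) :
    Frame (WeakSemidisplay.tensor P) (∀ i, D i) where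
  φ := tensorφ 𝔉
  m := tensorm 𝔉
  eq_sum j := by
    refine Eq.trans ?_ (sum_tensorφ_smul_tensorm 𝔉 _).symm
    exact congrArg _ (funext fun i => (𝔉 i).eq_sum (j i))
  sub_mem := sub_mem_tensorQ 𝔉
  mem_I := tensorφ_mem_I 𝔉

theorem tensor_φ_m (𝔉 : ∀ i, Frame (P i) (D i)) (k j : ∀ i, D i) :
    (Frame.tensor 𝔉).φ k ((Frame.tensor 𝔉).m j) = ∏ i, (𝔉 i).φ (k i) ((𝔉 i).m (j i)) :=
  tensorφ_tprod 𝔉 k _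

end Frame

end tensor

end WeakSemidisplay

/-! ### Characters and poly-additive maps to the multiplicative group -/

namespace WeakSemidisplay

open TWitt FrobSystem

variable {p : ℕ} [Fact p.Prime] {R : Type u} [CommRing R] {hp : (p : R) = 0} {n : ℕ} [NeZero n]
  {S S' : Type u} [CommRing S] [CommRing S'] {R' R'' : Type u} [CommRing R'] [CommRing R'']

section character

variable {P : WeakSemidisplay hp n} {D : Type} [Fintype D] [DecidableEq D] (𝔉 : Frame P D)

/-- The character `η ↦ ahExp r (η m)` of `Hom(P, W_n)`, where `r ^ (p ^ n) = 0`. -/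
noncomputable def expChar (P : WeakSemidisplay hp n) (f : R →+* R') (m : P.M) (r : R')
    (hr : r ^ p ^ n = 0) : P.zink f where
  toFun {S} _ g (η : homUnit P (g.comp f)) :=
    have hpS := natCast_eq_zero_of_hom (g.comp f) hp
    have hgr : g r ^ p ^ n = 0 := by rw [← map_pow, hr, map_zero]
    { val := ahExp (g r) (η.1 m)
      inv := ahExp (g r) (-η.1 m)
      val_inv := by rw [← ahExp_add hpS hgr, add_neg_cancel, ahExp_zero]
      inv_val := by rw [← ahExp_add hpS hgr, neg_add_cancel, ahExp_zero] }
  map_add g (a b : homUnit P (g.comp f)) := Units.ext (ahExp_add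
    (natCast_eq_zero_of_hom (g.comp f) hp) (by rw [← map_pow, hr, map_zero]) (a.1 m) (b.1 m))
  natural g h (a : homUnit P (g.comp f)) := Units.ext (map_ahExp h (g r) (a.1 m)).symm

/-- The values of a character on homomorphisms to the unit object. -/
def charVal {f : R →+* R'} (χ : P.zink f) (g : R' →+* S) (η : homUnit P (g.comp f)) : S :=
  ((χ.toFun g η : Sˣ) : S)

section charVal

variable {f : R →+* R'} (χ ψ : P.zink f) (g : R' →+* S) (h : S →+* S')

theorem charVal_add (η θ : homUnit P (g.comp f)) :
    charVal χ g (η + θ) = charVal χ g η * charVal χ g θ :=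
  congrArg Units.val (χ.map_add g η θ)

theorem charVal_map (η : homUnit P (g.comp f)) :
    charVal χ (h.comp g) (homUnitMap P (g.comp f) h η) = h (charVal χ g η) :=
  congrArg Units.val (χ.natural g h η)

theorem charVal_zero : charVal χ g 0 = 1 := by
  have h1 := charVal_add χ g 0 0
  rw [add_zero] at h1
  exact (Units.isUnit (χ.toFun g (0 : homUnit P (g.comp f)))).mul_left_cancel
    (h1.symm.trans (mul_one _).symm)

end charVal

theorem charVal_expChar (f : R →+* R') (m : P.M) (r : R') (hr : r ^ p ^ n = 0) (g : R' →+* S)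
    (η : homUnit P (g.comp f)) :
    charVal (expChar P f m r hr) g η = ahExp (g r) (η.1 m) := rfl

/-- The non-constant part of the expansion of a character, whose coefficients are killed by the
`p ^ n`-power map. -/
theorem exists_expansion_character (f : R →+* R') (χ : P.zink f) :
    ∃ d : (D → Fin (p ^ n)) → R', (∀ β, d β ^ p ^ n = 0) ∧
      ∀ {S : Type u} [CommRing S] (g : R' →+* S) (a : 𝔉.points (g.comp f)),
        charVal χ g (𝔉.toHom (g.comp f) a) = 1 + ∑ β, g (d β) * basisFun β a.1 := by
  obtain ⟨c, hc, -⟩ := 𝔉.system.existsUnique_expansion (hp := hp) f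
    (fun g a => charVal χ g (𝔉.toHom (g.comp f) a)) fun g h a => by
      rw [← charVal_map, ← 𝔉.toHom_map]
      rfl
  have hadd : ∀ {S : Type u} [CommRing S] (g : R' →+* S) (a b : 𝔉.points (g.comp f)),
      ∑ β, g (c β) * basisFun β (a.1 + b.1) =
        (∑ β, g (c β) * basisFun β a.1) * ∑ β, g (c β) * basisFun β b.1 := by
    intro S _ g a b
    rw [← hc g a, ← hc g b, ← charVal_add, ← map_add, hc]
    rfl
  have hc0 : c 0 = 1 := by
    have h1 := hc (RingHom.id R') 0
    rw [map_zero, charVal_zero, Finset.sum_eq_single 0, basisFun_index_zero] at h1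
    · simpa using h1.symm
    · intro β _ hβ
      rw [AddSubgroup.coe_zero, basisFun_zero hβ, mul_zero]
    · simp
  refine ⟨Function.update c 0 0, fun β => ?_, fun {S} _ g a => ?_⟩
  · by_cases hβ : β = 0
    · rw [hβ, Function.update_self, zero_pow]
      exact pow_ne_zero _ (Fact.out : p.Prime).ne_zero
    · rw [Function.update_of_ne hβ]
      exact 𝔉.system.coeff_pow_eq_zero_of_multiplicative f (fun g a b => hadd g a b) β hβ
  · rw [hc g a, ← Finset.add_sum_erase _ _ (Finset.mem_univ 0), hc0, map_one,
      basisFun_index_zero, mul_one, ← Finset.add_sum_erase Finset.univ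
      (fun β => g (Function.update c 0 0 β) * basisFun β a.1) (Finset.mem_univ 0),
      Function.update_self, map_zero, zero_mul, zero_add]
    congr 1
    refine Finset.sum_congr rfl fun β hβ => ?_
    rw [Function.update_of_ne (Finset.ne_of_mem_erase hβ)]

variable {f : R →+* R'} {χ : P.zink f} {d : (D → Fin (p ^ n)) → R'}
  (hd : ∀ {S : Type u} [CommRing S] (g : R' →+* S) (a : 𝔉.points (g.comp f)),
    charVal χ g (𝔉.toHom (g.comp f) a) = 1 + ∑ β, g (d β) * basisFun β a.1)

include hd in
theorem character_apply (g : R' →+* S) (η : homUnit P (g.comp f)) :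
    charVal χ g η = 1 + ∑ β, g (d β) * basisFun β fun j => η.1 (𝔉.m j) := by
  rw [← 𝔉.toHom_ofHom (g.comp f) η, hd, 𝔉.toHom_ofHom]
  rfl

include hd in
/-- The coefficients of `χ - 1` vanish over every base over which `χ` is trivial. -/
theorem character_coeff_eq_zero (φ : R' →+* R'')
    (h : ∀ {S : Type u} [CommRing S] (g : R'' →+* S) (η : homUnit P ((g.comp φ).comp f)),
      charVal χ (g.comp φ) η = 1) (β : D → Fin (p ^ n)) : φ (d β) = 0 := by
  refine congrFun (𝔉.system.eq_of_expansion_eq hp (φ.comp f) (c := fun β => φ (d β))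
    (c' := fun _ => 0) fun {S} _ g a => ?_) β
  have h1 := hd (g.comp φ) a
  rw [h g (𝔉.toHom ((g.comp φ).comp f) a), left_eq_add] at h1
  simpa using h1

include hd in
/-- If the products of the coefficients of `χ - 1` vanish then `χ - 1` is additive. -/
theorem character_eq_one_add (g : R' →+* S) (h0 : ∀ β β', g (d β) * g (d β') = 0)
    (η : homUnit P (g.comp f)) : charVal χ g η =
      1 + ∑ j, g (d (Pi.single j 1)) * (η.1 (𝔉.m j)).coeff 0 := by
  have hz := 𝔉.system.coeff_eq_zero_of_additive (hp := hp) (g.comp f) (c := fun β => g (d β)) (by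
    intro S' _ h a b
    have h1 : ∀ a : 𝔉.points ((h.comp g).comp f), ∑ β, h (g (d β)) * basisFun β a.1 =
        charVal χ (h.comp g) (𝔉.toHom ((h.comp g).comp f) a) - 1 :=
      fun a => eq_sub_of_add_eq' (hd (h.comp g) a).symm
    have h2 : (∑ β, h (g (d β)) * basisFun β a.1) * ∑ β, h (g (d β)) * basisFun β b.1 = 0 := by
      rw [Finset.sum_mul_sum]
      refine Finset.sum_eq_zero fun β _ => Finset.sum_eq_zero fun β' _ => ?_
      rw [mul_mul_mul_comm, ← map_mul, h0, map_zero, zero_mul]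
    have h3 := charVal_add χ (h.comp g) (𝔉.toHom ((h.comp g).comp f) a)
      (𝔉.toHom ((h.comp g).comp f) b)
    rw [← map_add] at h3
    have ha := h1 a
    have hb := h1 b
    have hab := h1 (a + b)
    rw [h3] at hab
    rw [ha, hb] at h2
    rw [ha, hb]
    refine hab.trans ?_
    linear_combination h2)
  rw [character_apply 𝔉 hd]
  congr 1
  symm
  refine Finset.sum_of_injOn (fun j => (Pi.single j 1 : D → Fin (p ^ n))) ?_
    (fun _ _ => by simp) ?_ ?_
  · intro j _ k _ h
    by_contra hne
    have := congrArg Fin.val (congrFun h j)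
    simp only [Pi.single_eq_same, Pi.single_eq_of_ne hne, val_one] at this
    simp at this
  · intro β _ hβ
    rw [hz β, zero_mul]
    rintro j rfl
    exact hβ ⟨j, by simp, rfl⟩
  · intro j _
    rw [basisFun_single (natCast_eq_zero_of_hom (g.comp f) hp)]

end character

section polyAdd

variable {ι : Type} [Fintype ι] [DecidableEq ι] {P : ι → WeakSemidisplay hp n}
  {D : ι → Type} [∀ i, Fintype (D i)] [∀ i, DecidableEq (D i)] (𝔉 : ∀ i, Frame (P i) (D i))

/-- The values of a poly-additive map on homomorphisms to the unit objects. -/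
def polyVal {f : R →+* R'} (y : PolyAdd (fun i => (P i).zinkDual) f) (g : R' →+* S)
    (η : ∀ i, homUnit (P i) (g.comp f)) : S := ((y.toFun g η : Sˣ) : S)

section polyVal

variable {f : R →+* R'} (y : PolyAdd (fun i => (P i).zinkDual) f) (g : R' →+* S) (h : S →+* S')

theorem polyVal_update_add (η : ∀ i, homUnit (P i) (g.comp f)) (i : ι)
    (a b : homUnit (P i) (g.comp f)) : polyVal y g (Function.update η i (a + b)) =
      polyVal y g (Function.update η i a) * polyVal y g (Function.update η i b) :=
  congrArg Units.val (y.map_update_add g η i a b)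

theorem polyVal_map (η : ∀ i, homUnit (P i) (g.comp f)) :
    polyVal y (h.comp g) (fun i => homUnitMap (P i) (g.comp f) h (η i)) = h (polyVal y g η) :=
  congrArg Units.val (y.natural g h η)

end polyVal

/-- The non-constant part of the expansion of a poly-additive map. -/
theorem exists_expansion_polyAdd (f : R →+* R') (y : PolyAdd (fun i => (P i).zinkDual) f) :
    ∃ d : (∀ i, D i → Fin (p ^ n)) → R',
      ∀ {S : Type u} [CommRing S] (g : R' →+* S) (x : ∀ i, (𝔉 i).points (g.comp f)),
        polyVal y g (fun i => (𝔉 i).toHom (g.comp f) (x i)) =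
          1 + ∑ β, g (d β) * ∏ i, basisFun (β i) (x i).1 := by
  obtain ⟨d, hd, -⟩ := existsUnique_expansion_pi (fun i => (𝔉 i).system) hp f
    (fun g x => polyVal y g (fun i => (𝔉 i).toHom (g.comp f) (x i)) - 1)
    fun g h x => by
      rw [map_sub, map_one, ← polyVal_map]
      congr 2
      exact funext fun i => (𝔉 i).toHom_map (g.comp f) h (x i)
  exact ⟨d, fun g x => eq_add_of_sub_eq' (hd g x)⟩

variable {f : R →+* R'} {y : PolyAdd (fun i => (P i).zinkDual) f}
  {d : (∀ i, D i → Fin (p ^ n)) → R'}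
  (hd : ∀ {S : Type u} [CommRing S] (g : R' →+* S) (x : ∀ i, (𝔉 i).points (g.comp f)),
    polyVal y g (fun i => (𝔉 i).toHom (g.comp f) (x i)) =
      1 + ∑ β, g (d β) * ∏ i, basisFun (β i) (x i).1)

include hd in
theorem polyAdd_apply (g : R' →+* S) (η : ∀ i, homUnit (P i) (g.comp f)) :
    polyVal y g η = 1 + ∑ β, g (d β) * ∏ i, basisFun (β i) fun j => (η i).1 ((𝔉 i).m j) := by
  have h1 := hd g fun i => (𝔉 i).ofHom (g.comp f) (η i)
  simp only [Frame.toHom_ofHom] at h1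
  exact h1

include hd in
/-- The coefficients of `y - 1` vanish over every base over which `y` is trivial. -/
theorem polyAdd_coeff_eq_zero (φ : R' →+* R'')
    (h : ∀ {S : Type u} [CommRing S] (g : R'' →+* S) (η : ∀ i, homUnit (P i) ((g.comp φ).comp f)),
      polyVal y (g.comp φ) η = 1) (β : ∀ i, D i → Fin (p ^ n)) : φ (d β) = 0 := by
  refine congrFun (eq_of_expansion_pi_eq (fun i => (𝔉 i).system) hp (φ.comp f)
    (c := fun β => φ (d β)) (c' := fun _ => 0) fun {S} _ g x => ?_) β
  have h1 := hd (g.comp φ) x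
  rw [h g fun i => (𝔉 i).toHom ((g.comp φ).comp f) (x i), left_eq_add] at h1
  simpa using h1

include hd in
/-- If the products of the coefficients of `y - 1` vanish then `y - 1` is poly-additive. -/
theorem polyAdd_eq_one_add (g : R' →+* S) (h0 : ∀ β β', g (d β) * g (d β') = 0)
    (η : ∀ i, homUnit (P i) (g.comp f)) : polyVal y g η =
      1 + ∑ j, g (d (unitIdx p n j)) * ∏ i, ((η i).1 ((𝔉 i).m (j i))).coeff 0 := by
  have hz := coeff_eq_zero_of_polyAdditive (fun i => (𝔉 i).system) hp (g.comp f)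
    (c := fun β => g (d β)) (by
    intro S' _ h x i a b
    have h1 : ∀ x : ∀ i, (𝔉 i).points ((h.comp g).comp f),
        ∑ β, h (g (d β)) * ∏ i, basisFun (β i) (x i).1 =
        polyVal y (h.comp g) (fun i => (𝔉 i).toHom ((h.comp g).comp f) (x i)) - 1 :=
      fun x => eq_sub_of_add_eq' (hd (h.comp g) x).symm
    have h2 : ∀ x x' : ∀ i, (𝔉 i).points ((h.comp g).comp f),
        (∑ β, h (g (d β)) * ∏ i, basisFun (β i) (x i).1) *
          ∑ β, h (g (d β)) * ∏ i, basisFun (β i) (x' i).1 = 0 := by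
      intro x x'
      rw [Finset.sum_mul_sum]
      refine Finset.sum_eq_zero fun β _ => Finset.sum_eq_zero fun β' _ => ?_
      rw [mul_mul_mul_comm, ← map_mul, h0, map_zero, zero_mul]
    have h3 : ∀ c : (𝔉 i).points ((h.comp g).comp f),
        (fun k => (𝔉 k).toHom ((h.comp g).comp f) (Function.update x i c k)) =
          Function.update (fun k => (𝔉 k).toHom ((h.comp g).comp f) (x k)) i
            ((𝔉 i).toHom ((h.comp g).comp f) c) := fun c => funext fun k =>
      Function.apply_update (fun k => (𝔉 k).toHom ((h.comp g).comp f)) x i c k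
    have h4 := polyVal_update_add y (h.comp g)
      (fun k => (𝔉 k).toHom ((h.comp g).comp f) (x k)) i ((𝔉 i).toHom ((h.comp g).comp f) a)
      ((𝔉 i).toHom ((h.comp g).comp f) b)
    rw [← map_add, ← h3, ← h3, ← h3] at h4
    have h5 := h2 (Function.update x i a) (Function.update x i b)
    have ha := h1 (Function.update x i a)
    have hb := h1 (Function.update x i b)
    have hab := h1 (Function.update x i (a + b))
    rw [h4] at hab
    rw [ha, hb] at h5
    refine hab.trans (Eq.trans ?_ (congrArg₂ (· + ·) ha hb).symm)
    linear_combination h5)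
  rw [polyAdd_apply 𝔉 hd]
  congr 1
  exact sum_eq_sum_unitIdx (natCast_eq_zero_of_hom (g.comp f) hp) (fun β => g (d β))
    (fun β i hβ => hz β i hβ) _

end polyAdd

end WeakSemidisplay

/-! ### The comparison homomorphism -/

namespace WeakSemidisplay

open TWitt FrobSystem

variable {p : ℕ} [Fact p.Prime] {R : Type u} [CommRing R] {hp : (p : R) = 0} {n : ℕ} [NeZero n]
  {S S' : Type u} [CommRing S] [CommRing S'] {R' R'' : Type u} [CommRing R'] [CommRing R'']
  {ι : Type} [Fintype ι] [DecidableEq ι] [Nonempty ι] {P : ι → WeakSemidisplay hp n}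
  {D : ι → Type} [∀ i, Fintype (D i)] [∀ i, DecidableEq (D i)] (𝔉 : ∀ i, Frame (P i) (D i))
  {f : R →+* R'}

theorem polyVal_zinkToPolyAdd (χ : (tensor P).zink f) (g : R' →+* S)
    (η : ∀ i, homUnit (P i) (g.comp f)) :
    polyVal (zinkToPolyAdd P f χ) g η = charVal χ g (tensorHom P (g.comp f) η) := rfl

theorem polyAdd_ext {y z : PolyAdd (fun i => (P i).zinkDual) f}
    (h : ∀ {S : Type u} [CommRing S] (g : R' →+* S) (η : ∀ i, homUnit (P i) (g.comp f)),
      polyVal y g η = polyVal z g η) : y = z := by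
  apply PolyAdd.ext
  funext S _ g η
  exact Units.ext (h g η)

/-- Evaluation of poly-additive maps as a group homomorphism. -/
def polyEval (g : R' →+* S) (η : ∀ i, homUnit (P i) (g.comp f)) :
    PolyAdd (fun i => (P i).zinkDual) f →* Sˣ where
  toFun y := y.toFun g η
  map_one' := rfl
  map_mul' _ _ := rfl

theorem polyVal_eq (y : PolyAdd (fun i => (P i).zinkDual) f) (g : R' →+* S)
    (η : ∀ i, homUnit (P i) (g.comp f)) : polyVal y g η = (polyEval g η y : Sˣ) := rfl

theorem polyVal_comp_of_baseChange_eq_one {y : PolyAdd (fun i => (P i).zinkDual) f}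
    (φ : R' →+* R'') (hy : PolyAdd.baseChange _ f φ y = 1) (g : R'' →+* S)
    (η : ∀ i, homUnit (P i) ((g.comp φ).comp f)) : polyVal y (g.comp φ) η = 1 := by
  have h : ∀ z : PolyAdd (fun i => (P i).zinkDual) (φ.comp f), z = 1 →
      polyVal z g η = 1 := by
    rintro z rfl
    rfl
  exact h _ hy

theorem prod_one_add_of_mul_eq_zero {κ : Type*} (s : Finset κ) (r : κ → S)
    (h : ∀ j k, r j * r k = 0) : ∏ j ∈ s, (1 + r j) = 1 + ∑ j ∈ s, r j := by
  classical
  induction s using Finset.induction_on with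
  | empty => simp
  | insert j s hj ih =>
    have : r j * ∑ k ∈ s, r k = 0 := by
      rw [Finset.mul_sum]
      exact Finset.sum_eq_zero fun k _ => h j k
    rw [Finset.prod_insert hj, ih, Finset.sum_insert hj]
    linear_combination this

include 𝔉 in
/-- The comparison homomorphism takes values in the kernel of `Fⁿ`. -/
theorem zinkToPolyAdd_mem_frobKer (χ : (tensor P).zink f) :
    zinkToPolyAdd P f χ ∈ PolyAdd.frobKer hp n (fun i => (P i).zinkDual) f := by
  obtain ⟨d, hd0, hd⟩ := exists_expansion_character (Frame.tensor 𝔉) f χ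
  rw [PolyAdd.frobKer, MonoidHom.mem_ker]
  apply polyAdd_ext
  intro S _ g η
  refine (character_apply (Frame.tensor 𝔉) hd (g.comp (frob (natCast_eq_zero_of_hom f hp) ^ n))
    (tensorHom P _ η)).trans ?_
  have : ∀ β, (g.comp (frob (natCast_eq_zero_of_hom f hp) ^ n)) (d β) = 0 := fun β => by
    rw [RingHom.comp_apply, frob_pow_apply, hd0, map_zero]
  simp only [this, zero_mul, Finset.sum_const_zero, add_zero]
  rfl

/-- An ideal spanned by finitely many nilpotent elements is nilpotent. -/
theorem exists_span_pow_eq_bot {B : Type} [Fintype B] (d : B → R') (h : ∀ β, IsNilpotent (d β)) :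
    ∃ k, Ideal.span (Set.range d) ^ (k + 1) = ⊥ := by
  have hfg : (Ideal.span (Set.range d)).FG := ⟨(Set.finite_range d).toFinset, by simp⟩
  have : IsNilpotent (Ideal.span (Set.range d)) := by
    rw [Ideal.FG.isNilpotent_iff_le_nilradical hfg, Ideal.span_le]
    rintro _ ⟨β, rfl⟩
    exact h β
  obtain ⟨k, hk⟩ := this
  refine ⟨k, ?_⟩
  rw [pow_succ, hk, zero_mul]
  rfl

/-- An ideal `I ^ (k + 1)` has square zero modulo `I ^ (k + 2)`. -/
theorem mul_mem_pow_succ {I : Ideal R'} {k : ℕ} {a b : R'} (ha : a ∈ I ^ (k + 1))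
    (hb : b ∈ I ^ (k + 1)) : a * b ∈ I ^ (k + 1 + 1) := by
  have := Ideal.mul_mem_mul ha hb
  rw [← pow_add] at this
  exact Ideal.pow_le_pow_right (by omega) this

include 𝔉 in
/-- By induction on `k`, an element of the kernel of `Fⁿ` is the image of a character modulo
`I ^ k`, where `I` is the nilpotent ideal generated by its coefficients: a defect in `I ^ k` is
poly-additive modulo `I ^ (k + 1)`, and is there the image of a product of exponential
characters. -/
theorem exists_zinkToPolyAdd_eq (y : PolyAdd (fun i => (P i).zinkDual) f)
    (hy : y ∈ PolyAdd.frobKer hp n (fun i => (P i).zinkDual) f) :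
    ∃ χ, zinkToPolyAdd P f χ = y := by
  have hp' := natCast_eq_zero_of_hom f hp
  obtain ⟨d, hd⟩ := exists_expansion_polyAdd 𝔉 f y
  have hdq : ∀ β, (frob hp' ^ n) (d β) = 0 := by
    refine polyAdd_coeff_eq_zero 𝔉 hd (frob hp' ^ n) fun {S} _ g η => ?_
    rw [PolyAdd.frobKer, MonoidHom.mem_ker] at hy
    exact polyVal_comp_of_baseChange_eq_one _ hy g η
  set I := Ideal.span (Set.range d) with hI
  have hIq : ∀ r ∈ I, r ^ p ^ n = 0 := by
    intro r hr
    have : I ≤ RingHom.ker (frob hp' ^ n) := by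
      rw [hI, Ideal.span_le]
      rintro _ ⟨β, rfl⟩
      exact hdq β
    exact (frob_pow_apply hp' n r).symm.trans (RingHom.mem_ker.1 (this hr))
  obtain ⟨K, hK⟩ := exists_span_pow_eq_bot d fun β =>
    ⟨p ^ n, hIq _ (Ideal.subset_span ⟨β, rfl⟩)⟩
  have claim : ∀ k, ∃ χ : (tensor P).zink f, ∀ {S : Type u} [CommRing S] (g : R' →+* S),
      (∀ r ∈ I ^ (k + 1), g r = 0) → ∀ η : ∀ i, homUnit (P i) (g.comp f),
      polyEval g η y = polyEval g η (zinkToPolyAdd P f χ) := by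
    intro k
    induction k with
    | zero =>
      refine ⟨1, fun {S} _ g hg η => ?_⟩
      rw [map_one, map_one]
      refine Units.ext ((polyAdd_apply 𝔉 hd g η).trans ?_)
      have : ∀ β, g (d β) = 0 := fun β => hg _ (by
        rw [zero_add, pow_one]
        exact Ideal.subset_span ⟨β, rfl⟩)
      simp [this]
    | succ k ih =>
      obtain ⟨χ, hχ⟩ := ih
      -- the defect, which is trivial modulo `I ^ (k + 1)`
      let z := y * (zinkToPolyAdd P f χ)⁻¹
      obtain ⟨c, hc⟩ := exists_expansion_polyAdd 𝔉 f z
      have hcI : ∀ β, c β ∈ I ^ (k + 1) := by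
        intro β
        rw [← Ideal.Quotient.eq_zero_iff_mem]
        refine polyAdd_coeff_eq_zero 𝔉 hc (Ideal.Quotient.mk (I ^ (k + 1))) (fun {S} _ g η => ?_) β
        have h1 := hχ (g.comp (Ideal.Quotient.mk (I ^ (k + 1)))) (fun r hr => by
          rw [RingHom.comp_apply, Ideal.Quotient.eq_zero_iff_mem.2 hr, map_zero]) η
        rw [polyVal_eq, map_mul, h1, map_inv, mul_inv_cancel, Units.val_one]
      have hIle : I ^ (k + 1) ≤ I := Ideal.pow_le_self (Nat.succ_ne_zero k)
      let e : (∀ i, D i) → (tensor P).zink f := fun j =>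
        expChar (tensor P) f ((Frame.tensor 𝔉).m j) (c (unitIdx p n j)) (hIq _ (hIle (hcI _)))
      refine ⟨χ * ∏ j, e j, fun {S} _ g hg η => ?_⟩
      have hzero : ∀ β β', g (c β) * g (c β') = 0 := fun β β' => by
        rw [← map_mul]
        exact hg _ (mul_mem_pow_succ (hcI β) (hcI β'))
      have he : ∀ j, ((polyEval g η (zinkToPolyAdd P f (e j)) : Sˣ) : S) =
          1 + g (c (unitIdx p n j)) * ∏ i, ((η i).1 ((𝔉 i).m (j i))).coeff 0 := by
        intro j
        refine (charVal_expChar (P := tensor P) f _ _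
          (hIq _ (hIle (hcI _))) g (tensorHom P (g.comp f) η)).trans ?_
        rw [ahExp_eq_of_sq_eq_zero (natCast_eq_zero_of_hom (g.comp f) hp) (hzero _ _),
          ← coeffZero_apply]
        refine congrArg (fun w => 1 + g (c (unitIdx p n j)) * coeffZero p S n w)
          (tensorHom_tprod P (g.comp f) η fun i => (𝔉 i).m (j i)) |>.trans ?_
        rw [map_prod]
        rfl
      have hprod : polyEval g η z = ∏ j, polyEval g η (zinkToPolyAdd P f (e j)) := by
        apply Units.ext
        rw [Units.coe_prod, Finset.prod_congr rfl fun j _ => he j, prod_one_add_of_mul_eq_zero]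
        · exact polyAdd_eq_one_add 𝔉 hc g hzero η
        · intro j j'
          rw [mul_mul_mul_comm, hzero, zero_mul]
      rw [map_mul, map_mul, map_prod, map_prod, ← hprod, map_mul, map_inv, mul_comm,
        inv_mul_cancel_right]
  obtain ⟨χ, hχ⟩ := claim K
  refine ⟨χ, polyAdd_ext fun {S} _ g η => congrArg Units.val (hχ g (fun r hr => ?_) η).symm⟩
  rw [hK] at hr
  rw [(Submodule.mem_bot _).1 hr, map_zero]

include 𝔉 in
/-- If the image of a character is trivial, then its non-constant coefficients lie in `I ^ k` for
all `k`, where `I` is the nilpotent ideal generated by these coefficients: modulo `I ^ (k + 1)` the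
character is `1 + ∑ rⱼ η(mⱼ)₀`, and since its image is trivial, the row vector `r` is annihilated by
the matrix of the zeroth components of `φₖ(mⱼ)`, which is an idempotent fixing `(η(mⱼ)₀)ⱼ`. -/
theorem zinkToPolyAdd_injective : Function.Injective (zinkToPolyAdd P f) := by
  rw [injective_iff_map_eq_one]
  intro χ hχ
  obtain ⟨d, hd0, hd⟩ := exists_expansion_character (Frame.tensor 𝔉) f χ
  set I := Ideal.span (Set.range d) with hI
  obtain ⟨K, hK⟩ := exists_span_pow_eq_bot d fun β => ⟨p ^ n, hd0 β⟩
  have claim : ∀ k β, d β ∈ I ^ (k + 1) := by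
    intro k
    induction k with
    | zero =>
      intro β
      rw [zero_add, pow_one]
      exact Ideal.subset_span ⟨β, rfl⟩
    | succ k ih =>
      intro β
      rw [← Ideal.Quotient.eq_zero_iff_mem]
      set π := Ideal.Quotient.mk (I ^ (k + 1 + 1)) with hπ
      have hzero : ∀ β β', π (d β) * π (d β') = 0 := fun β β' => by
        rw [← map_mul]
        exact Ideal.Quotient.eq_zero_iff_mem.2 (mul_mem_pow_succ (ih β) (ih β'))
      let r : (∀ i, D i) → R' ⧸ I ^ (k + 1 + 1) := fun j => π (d (Pi.single j 1))
      let ε : (∀ i, D i) → (∀ i, D i) → R := fun j l =>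
        coeffZero p R n ((Frame.tensor 𝔉).φ l ((Frame.tensor 𝔉).m j))
      have hχg : ∀ {S : Type u} [CommRing S] (g : R' ⧸ I ^ (k + 1 + 1) →+* S)
          (η : homUnit (tensor P) ((g.comp π).comp f)), charVal χ (g.comp π) η =
            1 + ∑ j, g (r j) * coeffZero p S n (η.1 ((Frame.tensor 𝔉).m j)) := fun g η =>
        character_eq_one_add (Frame.tensor 𝔉) hd (g.comp π) (fun β β' => by
          rw [RingHom.comp_apply, RingHom.comp_apply, ← map_mul, hzero, map_zero]) η
      -- evaluate the image of `χ` at homomorphisms given by solutions `x i`, and compare coefficients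
      have hrε : ∀ l, ∑ j, r j * π (f (ε j l)) = 0 := by
        refine eq_zero_of_sum_coeff_zero_eq_zero (fun i => (𝔉 i).system) hp (π.comp f)
          fun {S} _ g x => ?_
        have h1 := hχg g (tensorHom P ((g.comp π).comp f)
          fun i => (𝔉 i).toHom ((g.comp π).comp f) (x i))
        rw [← polyVal_zinkToPolyAdd, hχ] at h1
        have h2 : polyVal (1 : PolyAdd (fun i => (P i).zinkDual) f) (g.comp π)
          (fun i => (𝔉 i).toHom ((g.comp π).comp f) (x i)) = 1 := rfl
        rw [h2, left_eq_add] at h1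
        refine Eq.trans ?_ h1
        simp only [map_sum, Finset.sum_mul]
        rw [Finset.sum_comm]
        refine Finset.sum_congr rfl fun j _ => ?_
        have h3 : coeffZero p S n ((tensorHom P ((g.comp π).comp f)
            fun i => (𝔉 i).toHom ((g.comp π).comp f) (x i)).1 ((Frame.tensor 𝔉).m j)) =
            ∑ l, g (π (f (ε j l))) * ∏ i, ((x i).1 (l i)).coeff 0 := by
          refine (congrArg (coeffZero p S n) (tensorHom_tprod P ((g.comp π).comp f)
            (fun i => (𝔉 i).toHom ((g.comp π).comp f) (x i)) fun i => (𝔉 i).m (j i))).trans ?_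
          have h4 : ∀ i, coeffZero p S n (((𝔉 i).toHom ((g.comp π).comp f) (x i)).1
              ((𝔉 i).m (j i))) = ∑ l, g (π (f (coeffZero p R n ((𝔉 i).φ l ((𝔉 i).m (j i)))))) *
                coeffZero p S n ((x i).1 l) := by
            intro i
            refine (congrArg (coeffZero p S n)
              ((𝔉 i).extend_m ((g.comp π).comp f) (x i).1 (j i))).trans ?_
            rw [map_sum]
            refine Finset.sum_congr rfl fun l _ => ?_
            rw [map_mul]
            congr 1
            exact coeffZero_map _ _
          rw [map_prod, Finset.prod_congr rfl fun i _ => h4 i, Finset.prod_univ_sum,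
            Fintype.piFinset_univ]
          refine Finset.sum_congr rfl fun l _ => ?_
          rw [Finset.prod_mul_distrib]
          simp only [ε, Frame.tensor_φ_m, map_prod]
          rfl
        rw [h3, Finset.mul_sum]
        refine Finset.sum_congr rfl fun l _ => ?_
        rw [map_mul, mul_assoc]
      refine character_coeff_eq_zero (Frame.tensor 𝔉) hd π (fun {S} _ g η => ?_) β
      rw [hχg, add_eq_left]
      have h5 : ∀ j, coeffZero p S n (η.1 ((Frame.tensor 𝔉).m j)) =
          ∑ l, g (π (f (ε j l))) * coeffZero p S n (η.1 ((Frame.tensor 𝔉).m l)) := by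
        intro j
        conv_lhs => rw [(Frame.tensor 𝔉).eq_sum j, map_sum, map_sum]
        refine Finset.sum_congr rfl fun l _ => ?_
        rw [LinearMap.map_smulₛₗ, smul_eq_mul, map_mul]
        congr 1
        exact coeffZero_map _ _
      rw [Finset.sum_congr rfl fun j _ => congrArg (g (r j) * ·) (h5 j)]
      simp only [Finset.mul_sum]
      rw [Finset.sum_comm]
      refine Finset.sum_eq_zero fun l _ => ?_
      simp only [← mul_assoc, ← Finset.sum_mul, ← map_mul, ← map_sum]
      rw [hrε, map_zero, zero_mul]
  have hdz : ∀ β, d β = 0 := fun β => by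
    have := claim K β
    rw [hK] at this
    exact (Submodule.mem_bot _).1 this
  apply CartierDual.ext
  funext S _ g η
  refine Units.ext ((character_apply (Frame.tensor 𝔉) hd g η).trans ?_)
  simp only [hdz, map_zero, zero_mul, Finset.sum_const_zero, add_zero]
  rfl

end WeakSemidisplay

/-- The Zink functor of a tensor product. -/
theorem propositionp {p : ℕ} [Fact p.Prime] {R : Type u} [CommRing R] (hp : (p : R) = 0)
    (n : ℕ) [NeZero n] (l : ℕ) [NeZero l] (P : Fin l → WeakSemidisplay hp n) :
    ∃ e : ∀ {R' : Type u} [CommRing R'] (f : R →+* R'),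
        (WeakSemidisplay.tensor P).zink f ≃* PolyAdd.frobKer hp n (fun i => (P i).zinkDual) f,
      (∀ {R' : Type u} [CommRing R'] (f : R →+* R') (χ : (WeakSemidisplay.tensor P).zink f),
        (e f χ : PolyAdd (fun i => (P i).zinkDual) f) = WeakSemidisplay.zinkToPolyAdd P f χ) ∧
      ∀ {R' R'' : Type u} [CommRing R'] [CommRing R''] (f : R →+* R') (h : R' →+* R'')
        (χ : (WeakSemidisplay.tensor P).zink f),
        (e (h.comp f) (CartierDual.baseChange _ f h χ) :
            PolyAdd (fun i => (P i).zinkDual) (h.comp f)) =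
          PolyAdd.baseChange _ f h (e f χ) := by
  choose c hc using fun i => WeakSemidisplay.exists_frame (P i)
  have 𝔉 := fun i => (hc i).some
  refine ⟨fun {R'} _ f => MulEquiv.ofBijective ((WeakSemidisplay.zinkToPolyAdd P f).codRestrict _
    fun χ => WeakSemidisplay.zinkToPolyAdd_mem_frobKer 𝔉 χ) ⟨?_, ?_⟩, ?_, ?_⟩
  · intro χ ψ h
    exact WeakSemidisplay.zinkToPolyAdd_injective 𝔉 (congrArg Subtype.val h)
  · rintro ⟨y, hy⟩
    obtain ⟨χ, hχ⟩ := WeakSemidisplay.exists_zinkToPolyAdd_eq 𝔉 y hy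
    exact ⟨χ, Subtype.ext hχ⟩
  · intro R' _ f χ
    rfl
  · intro R' R'' _ _ f h χ
    rfl
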